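/- **Setting.** Let $p\ge 1$ and $q\ge 0$ be integers and let $\{\varepsilon_t\}_{t\in\mathbb Z}$ be i.i.d. real random variables with $E\varepsilon_0=0$ and $E\varepsilon_0^2=1$. Let $\{X_t\}_{t\in\mathbb Z}$ (with $\sigma_t\ge 0$) be a strictly stationary GARCH$(p,q)$ sequence, i.e. $(X_t,\sigma_t)_{t\in\mathbb Z}$ is strictly stationary and a.s., for all $t\in\mathbb Z$, $$X_t=\sigma_t\varepsilon_t,\qquad \sigma_t^2=\alpha_0+\sum_{i=1}^p\alpha_iX_{t-i}^2+\sum_{j=1}^q\beta_j\sigma_{t-j}^2 ,\qquad \boldsymbol\theta=(\alpha_0,\dots,\alpha_p,\beta_1,\dots,\beta_q),$$ under the Bougerol–Picard condition: the top Lyapunov exponent $\gamma=\inf_{n\ge0}\frac1{n+1}E\log\|A_0A_{-1}\cdots A_{-n}\|$ satisfies $\gamma<0$. Here $\|\cdot\|$ is the operator norm induced by the maximum norm, and $A_t$ is the random matrix in the representation $Y_t=b_t+A_tY_{t-1}$ of the model, with $Y_t=(\sigma_t^2,\dots,\sigma_{t-q+1}^2,X_t^2,\dots,X_{t-p+1}^2)^{\top}$: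 its row for $\sigma_t^2$ is $(\beta_1,\dots,\beta_q,\alpha_1,\dots,\alpha_p)$, its row for $X_t^2$ is $\varepsilon_t^2(\beta_1,\dots,\beta_q,\alpha_1,\dots,\alpha_p)$, and its other rows are shift rows. For $\mathbf u=(s_0,\dots,s_p,t_1,\dots,t_q)\in\mathbb R^{p+q+1}$ define $c_0(\mathbf u)=s_0/(1-(t_1+\dots+t_q))$ and, for $i\ge1$, $c_i(\mathbf u)=s_i+\sum_{j=1}^{\min(q,i-1)}t_jc_{i-j}(\mathbf u)$, where $s_i:=0$ for $i>p$. Let $0<\underline u<\bar u$, $0<\rho_0<1$, $q\underline u<\rho_0$, and $$\Theta=\{\mathbf u:\ t_1+\dots+t_q\le\rho_0,\ \text{all coordinates of }\mathbf u\text{ lie in }[\underline u,\bar u]\}.$$ Let $\hat{\boldsymbol\theta}_n$ be an estimator of $\boldsymbol\theta$ that is a measurable function of $X_0,\dots,X_n$, and for $1\le t\le n$ define the residuals $$\hat\varepsilon_t=\frac{X_t}{\hat\sigma_t},\qquad \hat\sigma_t^2=c_0(\hat{\boldsymbol\theta}_n)+\sum_{i=1}^tc_i(\hat{\boldsymbol\theta}_n)X_{t-i}^2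 .$$ For an integer $k\ge1$ and $0\le u\le1$ put $$\hat T_n^{(k)}(u)=\sum_{t=1}^{\lfloor nu\rfloor}\Big(\hat\varepsilon_t-\frac1n\sum_{s=1}^n\hat\varepsilon_s\Big)^k,\qquad T_n^{(k)}(u)=\sum_{t=1}^{\lfloor nu\rfloor}\Big(\varepsilon_t-\frac1n\sum_{s=1}^n\varepsilon_s\Big)^k,$$ $\hat\sigma_{(n)}=\big(\hat T_n^{(2)}(1)/n\big)^{1/2}$ and $\sigma_{(n)}=\big(T_n^{(2)}(1)/n\big)^{1/2}$. **Theorem 1.4.** Suppose that - (1.5) $\sqrt n\,|\hat{\boldsymbol\theta}_n-\boldsymbol\theta|=O_P(1)$, where $|\cdot|$ is the maximum norm; - (1.6) $\boldsymbol\theta$ is in the interior of $\Theta$; - (1.13) $\varepsilon_0$ is nondegenerate; - (1.14) $\lim_{x\downarrow0}x^{-\zeta}P\{|\varepsilon_0|\le x\}=0$ for some $\zeta>0$; and let $k\ge1$ be an integer with $E|\varepsilon_0|^{\max\{k,2\}}<\infty$. Then $$\sup_{0\le u\le1}\frac1{\sqrt n}\left|\frac{\hat T_n^{(k)}(u)}{\hat\sigma_{(n)}^k}-\frac{T_n^{(k)}(u)}{\sigma_{(n)}^k}\right|=o_P(1)\qquad(n\to\infty).$$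 -/

import Mathlib

open MeasureTheory ProbabilityTheory Filter Topology

namespace GARCH

/-- Parameter vectors `u = (s₀, s₁, …, s_p, t₁, …, t_q)`, with the maximum norm: `s_i` is
`u (Sum.inl i)` and `t_j` is `u (Sum.inr (j - 1))`, since `Fin q` starts at `0`. For the true
parameter, `s_i = α_i` and `t_j = β_j`. -/
abbrev Param (p q : ℕ) : Type := Fin (p + 1) ⊕ Fin q → ℝ

/-- The coefficients `c_i(u)`: `c_0 = s₀ / (1 - (t₁ + ⋯ + t_q))`, and for `i ≥ 1`
`c_i = s_i + ∑ t_j c_{i-j}`, where `s_i` is read as `0` for `i > p` and the sum runs over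
`1 ≤ j ≤ min q (i - 1)` (so `c_0` never enters it). -/
noncomputable def coeff {p q : ℕ} (u : Param p q) : ℕ → ℝ
  | 0 => u (Sum.inl 0) / (1 - ∑ j : Fin q, u (Sum.inr j))
  | i + 1 =>
      (if h : i + 1 < p + 1 then u (Sum.inl ⟨i + 1, h⟩) else 0) +
        ∑ j : Fin q, if _h : (j : ℕ) < i then u (Sum.inr j) * coeff u (i - j) else 0
termination_by i => i
decreasing_by omega

/-- The parameter space `Θ`, with bounds `lo`, `hi` on all coordinates and bound `ρ₀` on
`t₁ + ⋯ + t_q`. -/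
def paramSpace (p q : ℕ) (lo hi ρ₀ : ℝ) : Set (Param p q) :=
  {u | ∑ j : Fin q, u (Sum.inr j) ≤ ρ₀ ∧ ∀ i, lo ≤ u i ∧ u i ≤ hi}

section Model

variable {Ω : Type*} [MeasurableSpace Ω]

/-- The innovations are i.i.d. real random variables with mean `0` and variance `1`. -/
structure IsInnovation (ε : ℤ → Ω → ℝ) (P : Measure Ω) : Prop where
  measurable : ∀ t, Measurable (ε t)
  indep : iIndepFun ε P
  identDistrib : ∀ t, IdentDistrib (ε t) (ε 0) P P
  memLp_two : MemLp (ε 0) 2 P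
  mean_zero : ∫ ω, ε 0 ω ∂P = 0
  variance_one : ∫ ω, ε 0 ω ^ 2 ∂P = 1

/-- `(X, σ)` is a strictly stationary solution of the GARCH(p, q) equations
`X_t = σ_t ε_t`, `σ_t² = α₀ + ∑_{i=1}^p α_i X_{t-i}² + ∑_{j=1}^q β_j σ_{t-j}²`
with parameter `θ = (α₀, …, α_p, β₁, …, β_q)`. -/
structure IsStationarySolution {p q : ℕ} (θ : Param p q) (ε X σ : ℤ → Ω → ℝ)
    (P : Measure Ω) : Prop where
  measurable_X : ∀ t, Measurable (X t)
  measurable_σ : ∀ t, Measurable (σ t)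
  nonneg : ∀ t, ∀ᵐ ω ∂P, 0 ≤ σ t ω
  observation : ∀ t, ∀ᵐ ω ∂P, X t ω = σ t ω * ε t ω
  volatility : ∀ t, ∀ᵐ ω ∂P, σ t ω ^ 2 =
    θ (Sum.inl 0)
      + ∑ i : Fin p, θ (Sum.inl i.succ) * X (t - ((i : ℤ) + 1)) ω ^ 2
      + ∑ j : Fin q, θ (Sum.inr j) * σ (t - ((j : ℤ) + 1)) ω ^ 2
  stationary : ∀ h : ℤ, IdentDistrib
    (fun ω (t : ℤ) => (X (t + h) ω, σ (t + h) ω)) (fun ω (t : ℤ) => (X t ω, σ t ω)) P P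

/-- The matrix `A(e)` of the Markov representation `Y_t = b_t + A(ε_t) Y_{t-1}` of the GARCH
equations, for the state
`Y_t = (σ_t², …, σ_{t-q+1}²; X_t², …, X_{t-p+1}²)`: the row of `σ_t²` is `(β, α)`, the row of
`X_t² = ε_t² σ_t²` is `e² (β, α)`, and all other rows shift the state. -/
def transitionMatrix {p q : ℕ} (θ : Param p q) (e : ℝ) :
    Matrix (Fin q ⊕ Fin p) (Fin q ⊕ Fin p) ℝ :=
  Matrix.of fun r c =>
    let row : ℝ := Sum.elim (fun j : Fin q => θ (Sum.inr j))
      (fun i : Fin p => θ (Sum.inl i.succ)) c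
    match r with
    | Sum.inl j => if (j : ℕ) = 0 then row else
        Sum.elim (fun j' : Fin q => if (j' : ℕ) + 1 = j then 1 else 0) (fun _ => 0) c
    | Sum.inr i => if (i : ℕ) = 0 then e ^ 2 * row else
        Sum.elim (fun _ => 0) (fun i' : Fin p => if (i' : ℕ) + 1 = i then 1 else 0) c

attribute [local instance] Matrix.linftyOpNormedAddCommGroup

/-- The top Lyapunov exponent
`γ = inf_{n ≥ 0} (n + 1)⁻¹ E log ‖A(ε_0) A(ε_{-1}) ⋯ A(ε_{-n})‖`; the norm is the (submultiplicative)
operator norm for the maximum norm of vectors. The infimum is taken in `[-∞, ∞]`. -/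
noncomputable def topLyapunov {p q : ℕ} (θ : Param p q) (ε : ℤ → Ω → ℝ) (P : Measure Ω) : EReal :=
  ⨅ n : ℕ, ((((n : ℝ) + 1)⁻¹ *
    ∫ ω, Real.log ‖((List.range (n + 1)).map
      fun i => transitionMatrix θ (ε (-(i : ℤ)) ω)).prod‖ ∂P : ℝ) : EReal)

/-- `Y_n = O_P(1)`. -/
def BoundedInProbability (Y : ℕ → Ω → ℝ) (P : Measure Ω) : Prop :=
  ∀ η : ℝ, 0 < η → ∃ M : ℝ, ∀ᶠ n in atTop, P {ω | M < |Y n ω|} ≤ ENNReal.ofReal η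

end Model

/-- The truncated conditional variance
`c_0(u) + ∑_{i=1}^t c_i(u) x_{t-i}²` computed from the observations `x_0, …, x_{t-1}`. -/
noncomputable def truncVar {p q : ℕ} (u : Param p q) (x : ℕ → ℝ) (t : ℕ) : ℝ :=
  coeff u 0 + ∑ i ∈ Finset.Icc 1 t, coeff u i * x (t - i) ^ 2

/-- The residual at time `t` computed with the parameter value `u`. -/
noncomputable def residual {p q : ℕ} (u : Param p q) (x : ℕ → ℝ) (t : ℕ) : ℝ :=
  x t / √(truncVar u x t)

/-- The mean of `e_1, …, e_n`. -/
noncomputable def sampleMean (e : ℕ → ℝ) (n : ℕ) : ℝ :=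
  (∑ t ∈ Finset.Icc 1 n, e t) / n

/-- The `k`-th moment centered partial sum `T_n^{(k)}(u)` of `e_1, …, e_n`. -/
noncomputable def centeredSum (e : ℕ → ℝ) (n k : ℕ) (u : ℝ) : ℝ :=
  ∑ t ∈ Finset.Icc 1 ⌊(n : ℝ) * u⌋₊, (e t - sampleMean e n) ^ k

/-- The sample standard deviation of `e_1, …, e_n` (with divisor `n`):
the square root of `T_n^{(2)}(1) / n`. -/
noncomputable def sampleStd (e : ℕ → ℝ) (n : ℕ) : ℝ :=
  √(centeredSum e n 2 1 / n)

/-- The self-normalized process `T_n^{(k)}(u) / σ_{(n)}^k` of `e_1, …, e_n`. -/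
noncomputable def selfNormalized (e : ℕ → ℝ) (n k : ℕ) (u : ℝ) : ℝ :=
  centeredSum e n k u / sampleStd e n ^ k

end GARCH

/-! Write Δ = θhat_n - θ and let 1 + a_t be the ratio of the truncated variance at θhat_n to σ_t².
The residual is ε_t w_t with w_t = (1 + a_t)^(-1/2), so w_t is 1 - a_t/2 to first order. To the
order √n, estimating θ acts on the power sums like one common change of scale, and
self-normalization removes a change of scale.

Expansion of a_t (`IsStationarySolution.exists_varExpansion`). Up to a truncation error of order R^t
with R < 1, a_t is Σ_l Δ_l g_l + O(‖Δ‖² U), where g_l and U are fixed integrable functionals of the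
innovations before time t. Integrability rests on three facts. The negative Lyapunov exponent makes
the state a function of the past innovations with a finite moment of some small order s. The
variance is the ARCH(∞) series Σ c_i x_i, where x_0 = 1 and x_i = X_{t-i}². Finally, the relative
weights c_i x_i / σ_t² sum to 1 and are bounded by constant multiples of r^{is} x_i^s, so that even
Σ ψ^{2i} c_i x_i / σ_t² has a mean for some ψ > 1. This leaves room for the derivatives of c_i,
which exceed c_i by factors of polynomial size in i.

Averaging (`IsInnovation.uniform_wlln`). The functionals g_l and U at time t are independent of ε_t,
so products with powers of ε_t up to the order max(k, 2) have means. A weak law uniform in m ≤ n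
gives Σ_{t≤m} ε_t^j a_t = m E[ε^j] λ + o(√n), with λ = Σ_l Δ_l E[g_l] = O(n^(-1/2)): an error o(n)
in the law of large numbers is multiplied by ‖Δ‖.

Cancellation (`IsPerturbation.sum_selfNormalized_sub`). The j-th centered sum changes by -(j/2) m
E[ε^j] λ + o(√n). For j = 1 this leaves the sample mean unchanged up to o(n^(-1/2)), since E[ε] = 0.
For j = 2 the sample variance changes by -λ, so its power -k/2 changes by (k/2) λ. In the quotient
the two terms ±(k/2) m E[ε^k] λ cancel.

Statements in probability are statements along the filter `inProb` on pairs (n, ω), which makes the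
Landau calculus available for random sequences. O_P bounds become deterministic after restriction to
an event of probability close to 1. Uniformity in u comes from letting the upper limit m of the sums
be an arbitrary function of (n, ω). -/

namespace GARCH

/-! ### The law of the past innovations, and convergence in probability as a filter -/

section Probability

variable {Ω : Type*} [MeasurableSpace Ω] {P : Measure Ω} {ε : ℤ → Ω → ℝ}

/-- The innovations up to time `t`, in reversed time. -/
def past (ε : ℤ → Ω → ℝ) (t : ℤ) (ω : Ω) : ℕ → ℝ := fun i => ε (t - i) ω

/-- The law of the past of the innovations. -/
noncomputable def pastLaw (ε : ℤ → Ω → ℝ) (P : Measure Ω) : Measure (ℕ → ℝ) :=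
  P.map (past ε 0)

lemma IsInnovation.measurable_past (hε : IsInnovation ε P) (t : ℤ) : Measurable (past ε t) :=
  measurable_pi_iff.2 fun i => hε.measurable (t - i)

lemma IsInnovation.isProbabilityMeasure_pastLaw [IsProbabilityMeasure P]
    (hε : IsInnovation ε P) : IsProbabilityMeasure (pastLaw ε P) :=
  Measure.isProbabilityMeasure_map (hε.measurable_past 0).aemeasurable

/-- Both laws are the infinite product of the law of ε_0. Hence integrability and null sets of a
functional of the past need only be studied under `pastLaw`, and transfer to every time t. -/
lemma IsInnovation.map_past [IsProbabilityMeasure P] (hε : IsInnovation ε P) (t : ℤ) :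
    P.map (past ε t) = pastLaw ε P := by
  have key : ∀ t : ℤ, P.map (past ε t) = Measure.infinitePi (fun _ : ℕ => P.map (ε 0)) := by
    intro t
    have hinj : Function.Injective (fun i : ℕ => t - (i : ℤ)) := fun a b h => by
      simp only at h; omega
    have h := iIndepFun.map_fun_eq_infinitePi_map (X := fun (i : ℕ) => ε (t - (i : ℤ)))
      (fun i => hε.measurable (t - (i : ℤ))) (hε.indep.precomp hinj)
    have h2 : (fun i : ℕ => P.map (ε (t - (i : ℤ)))) = fun _ : ℕ => P.map (ε 0) :=
      funext fun i => (hε.identDistrib (t - i)).map_eq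
    change P.map (fun ω (i : ℕ) => ε (t - (i : ℤ)) ω) = _
    rw [h, h2]
  rw [key t, pastLaw, key 0]

lemma IsInnovation.measurePreserving_past [IsProbabilityMeasure P] (hε : IsInnovation ε P)
    (t : ℤ) : MeasurePreserving (past ε t) P (pastLaw ε P) :=
  ⟨hε.measurable_past t, hε.map_past t⟩

lemma IsInnovation.indepFun_of_measurable (hε : IsInnovation ε P) {S T : Set ℤ}
    (hST : Disjoint S T) {α β : Type*} [MeasurableSpace α] [MeasurableSpace β]
    {f : Ω → α} {g : Ω → β}
    (hf : Measurable[⨆ s ∈ S, MeasurableSpace.comap (ε s) inferInstance] f)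
    (hg : Measurable[⨆ s ∈ T, MeasurableSpace.comap (ε s) inferInstance] g) :
    IndepFun f g P := by
  rw [IndepFun_iff_Indep]
  exact indep_of_indep_of_le_left (indep_of_indep_of_le_right
    (indep_iSup_of_disjoint (fun s => (hε.measurable s).comap_le) hε.indep hST)
    hg.comap_le) hf.comap_le

omit [MeasurableSpace Ω] in
lemma measurable_innovation_of_mem (ε : ℤ → Ω → ℝ) {S : Set ℤ} {s : ℤ} (hs : s ∈ S) :
    Measurable[⨆ s ∈ S, MeasurableSpace.comap (ε s) inferInstance] (ε s) := by
  refine Measurable.of_comap_le ?_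
  exact le_iSup₂_of_le s hs le_rfl

/-- The block `ε_t, …, ε_{t-N+1}` is independent of the innovations before it. -/
lemma IsInnovation.indepFun_block_past (hε : IsInnovation ε P) (N : ℕ) (t : ℤ) :
    IndepFun (fun ω (i : Fin N) => past ε t ω i) (past ε (t - N)) P := by
  refine hε.indepFun_of_measurable (S := Set.Ioi (t - N)) (T := Set.Iic (t - N)) ?_ ?_ ?_
  · exact (Set.Iic_disjoint_Ioi le_rfl).symm
  · refine @measurable_pi_lambda _ _ _ (_) _ _ fun i => measurable_innovation_of_mem ε ?_
    have := i.2
    simp only [Set.mem_Ioi]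
    omega
  · refine @measurable_pi_lambda _ _ _ (_) _ _ fun i => measurable_innovation_of_mem ε ?_
    simp only [Set.mem_Iic]
    omega

/-- Convergence in probability as a filter on pairs of a sample size and a sample point. -/
def inProb (P : Measure Ω) : Filter (ℕ × Ω) where
  sets := {S | ∀ η : ℝ, 0 < η → ∀ᶠ n in atTop, P {ω | (n, ω) ∉ S} ≤ ENNReal.ofReal η}
  univ_sets := by simp
  sets_of_superset := by
    intro S T hS hST η hη
    filter_upwards [hS η hη] with n hn
    refine (measure_mono fun ω hω => ?_).trans hn
    exact fun h => hω (hST h)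
  inter_sets := by
    intro S T hS hT η hη
    filter_upwards [hS (η / 2) (by positivity), hT (η / 2) (by positivity)] with n h1 h2
    calc P {ω | (n, ω) ∉ S ∩ T} ≤ P ({ω | (n, ω) ∉ S} ∪ {ω | (n, ω) ∉ T}) := by
          refine measure_mono fun ω hω => ?_
          by_contra hcon
          simp only [Set.mem_union, Set.mem_ofPred_eq, not_or, not_not] at hcon
          exact hω hcon
      _ ≤ _ := measure_union_le _ _
      _ ≤ ENNReal.ofReal (η / 2) + ENNReal.ofReal (η / 2) := add_le_add h1 h2
      _ = ENNReal.ofReal η := by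
          rw [← ENNReal.ofReal_add (by positivity) (by positivity), add_halves]

lemma eventually_inProb {Q : ℕ × Ω → Prop} : (∀ᶠ x in inProb P, Q x) ↔
    ∀ η : ℝ, 0 < η → ∀ᶠ n in atTop, P {ω | ¬ Q (n, ω)} ≤ ENNReal.ofReal η := Iff.rfl

lemma tendsto_fst_inProb : Tendsto (fun x : ℕ × Ω => x.1) (inProb P) atTop := by
  intro S hS
  refine eventually_inProb.2 fun η hη => ?_
  filter_upwards [hS] with n hn
  simp [show n ∈ S from hn]

lemma eventually_inProb_of_ae {Q : Ω → Prop} (h : ∀ᵐ ω ∂P, Q ω) :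
    ∀ᶠ x in inProb P, Q x.2 := by
  refine eventually_inProb.2 fun η hη => Eventually.of_forall fun n => ?_
  rw [ae_iff] at h
  simp [h]

/-- To prove an eventual property along `inProb`, it is enough to do so on events whose
probability is as close to `1` as desired. -/
lemma eventually_inProb_of_forall {Q : ℕ × Ω → Prop}
    (h : ∀ η : ℝ, 0 < η → ∃ E : Set (ℕ × Ω),
      (∀ᶠ n in atTop, P {ω | (n, ω) ∉ E} ≤ ENNReal.ofReal η) ∧
      ∀ᶠ x in inProb P ⊓ 𝓟 E, Q x) :
    ∀ᶠ x in inProb P, Q x := by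
  refine eventually_inProb.2 fun η hη => ?_
  obtain ⟨E, hE, hQ⟩ := h (η / 2) (by positivity)
  rw [eventually_inf_principal] at hQ
  filter_upwards [hE, eventually_inProb.1 hQ (η / 2) (by positivity)] with n h1 h2
  calc P {ω | ¬ Q (n, ω)} ≤ P ({ω | (n, ω) ∉ E} ∪ {ω | ¬ ((n, ω) ∈ E → Q (n, ω))}) := by
        refine measure_mono fun ω hω => ?_
        by_cases hh : (n, ω) ∈ E
        · right
          simpa [hh] using hω
        · exact Or.inl hh
    _ ≤ _ := measure_union_le _ _
    _ ≤ ENNReal.ofReal (η / 2) + ENNReal.ofReal (η / 2) := add_le_add h1 h2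
    _ = ENNReal.ofReal η := by
        rw [← ENNReal.ofReal_add (by positivity) (by positivity), add_halves]

lemma exists_measure_lt_abs_le [IsFiniteMeasure P] {ξ : Ω → ℝ} (hξ : Measurable ξ) {η : ℝ}
    (hη : 0 < η) : ∃ K : ℝ, P {ω | K < |ξ ω|} ≤ ENNReal.ofReal η := by
  have h : Tendsto (fun K : ℕ => P {ω | (K : ℝ) < |ξ ω|}) atTop (𝓝 0) := by
    have h0 : (⋂ K : ℕ, {ω | (K : ℝ) < |ξ ω|}) = ∅ := by
      ext ω
      simp only [Set.mem_iInter, Set.mem_ofPred_eq, Set.mem_empty_iff_false, iff_false, not_forall,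
        not_lt]
      exact exists_nat_ge _
    rw [← measure_empty (μ := P), ← h0]
    refine tendsto_measure_iInter_atTop (fun K => ?_) ?_ ⟨0, measure_ne_top _ _⟩
    · exact (measurableSet_lt measurable_const hξ.abs).nullMeasurableSet
    · intro a b hab ω hω
      have hω' : (b : ℝ) < |ξ ω| := hω
      exact lt_of_le_of_lt (Nat.cast_le.2 hab) hω'
  have := (ENNReal.tendsto_atTop_zero.1 h) (ENNReal.ofReal η) (by simpa using hη)
  obtain ⟨K, hK⟩ := this
  exact ⟨K, hK K le_rfl⟩

end Probability

end GARCH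

namespace GARCH

/-! ### A weak law of large numbers, uniform over partial sums -/

section LawOfLargeNumbers

variable {Ω : Type*} [MeasurableSpace Ω] {P : Measure Ω} {ε : ℤ → Ω → ℝ}

/-- After expanding the square only the pairs with |s - t| ≤ M remain. Each s has at most 2M + 1
partners t, and each such pair contributes at most B². -/
lemma integral_sq_sum_le_of_uncorrelated [IsProbabilityMeasure P] {Z : ℕ → Ω → ℝ}
    (hZ : ∀ t, Measurable (Z t)) {B : ℝ} (hB : ∀ t ω, |Z t ω| ≤ B) {M : ℕ}
    (hcov : ∀ s t : ℕ, s + M < t ∨ t + M < s → ∫ ω, Z s ω * Z t ω ∂P = 0) (m : ℕ) :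
    ∫ ω, (∑ t ∈ Finset.Icc 1 m, Z t ω) ^ 2 ∂P ≤ m * ((2 * M + 1) * B ^ 2) := by
  have hint : ∀ s t, Integrable (fun ω => Z s ω * Z t ω) P := fun s t =>
    Integrable.of_bound ((hZ s).mul (hZ t)).aestronglyMeasurable (B * B)
      (ae_of_all _ fun ω => by
        rw [Real.norm_eq_abs, abs_mul]
        exact mul_le_mul (hB s ω) (hB t ω) (abs_nonneg _) ((abs_nonneg _).trans (hB s ω)))
  have h1 : ∫ ω, (∑ t ∈ Finset.Icc 1 m, Z t ω) ^ 2 ∂P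
      = ∑ s ∈ Finset.Icc 1 m, ∑ t ∈ Finset.Icc 1 m, ∫ ω, Z s ω * Z t ω ∂P := by
    simp_rw [sq, Finset.sum_mul_sum]
    rw [integral_finsetSum _ fun s _ => integrable_finsetSum _ fun t _ => hint s t]
    exact Finset.sum_congr rfl fun s _ => integral_finsetSum _ fun t _ => hint s t
  rw [h1]
  have h2 : ∀ s ∈ Finset.Icc 1 m, ∑ t ∈ Finset.Icc 1 m, ∫ ω, Z s ω * Z t ω ∂P
      ≤ (2 * M + 1) * B ^ 2 := by
    intro s _
    have h3 : ∀ t ∈ Finset.Icc 1 m, ∫ ω, Z s ω * Z t ω ∂P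
        ≤ if t ∈ Finset.Icc (s - M) (s + M) then B ^ 2 else 0 := by
      intro t _
      split_ifs with h
      · calc ∫ ω, Z s ω * Z t ω ∂P ≤ ∫ _, B ^ 2 ∂P := by
              refine integral_mono (hint s t) (integrable_const _) fun ω => ?_
              refine (le_abs_self _).trans ?_
              simp only
              rw [abs_mul, sq]
              exact mul_le_mul (hB s ω) (hB t ω) (abs_nonneg _) ((abs_nonneg _).trans (hB s ω))
          _ = B ^ 2 := by simp
      · refine (hcov s t ?_).le
        simp only [Finset.mem_Icc, not_and_or, not_le] at h
        omega
    refine (Finset.sum_le_sum h3).trans ?_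
    rw [← Finset.sum_filter, Finset.sum_const, nsmul_eq_mul]
    refine mul_le_mul_of_nonneg_right ?_ (sq_nonneg _)
    have h4 : ((Finset.Icc 1 m).filter fun t => t ∈ Finset.Icc (s - M) (s + M)).card
        ≤ 2 * M + 1 := by
      refine (Finset.card_le_card (t := Finset.Icc (s - M) (s + M)) fun t ht => ?_).trans ?_
      · exact (Finset.mem_filter.1 ht).2
      · rw [Nat.card_Icc]
        omega
    exact_mod_cast h4
  refine (Finset.sum_le_sum h2).trans ?_
  simp

/-- The uniform weak law of large numbers for bounded sequences with finite range correlations. -/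
lemma uniform_wlln_of_uncorrelated [IsProbabilityMeasure P] {Z : ℕ → Ω → ℝ}
    (hZ : ∀ t, Measurable (Z t)) {B : ℝ} (hB : ∀ t ω, |Z t ω| ≤ B) {M : ℕ}
    (hcov : ∀ s t : ℕ, s + M < t ∨ t + M < s → ∫ ω, Z s ω * Z t ω ∂P = 0) {δ : ℝ} (hδ : 0 < δ) :
    ∀ᶠ x in inProb P, ∀ m ≤ x.1, |∑ t ∈ Finset.Icc 1 m, Z t x.2| ≤ δ * x.1 := by
  obtain ⟨B, hB0, hB⟩ : ∃ B : ℝ, 0 < B ∧ ∀ t ω, |Z t ω| ≤ B :=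
    ⟨|B| + 1, by positivity, fun t ω => (hB t ω).trans ((le_abs_self B).trans (by linarith))⟩
  -- Chebyshev is used only on the grid j * L with mesh L just above δn/(2B). Between grid points a
  -- partial sum moves by at most δn/2, and at most J + 1 grid points are needed, whatever n is, so
  -- a union bound suffices.
  obtain ⟨J, hJ⟩ := exists_nat_gt (2 * B / δ)
  set V : ℝ := (2 * M + 1) * B ^ 2 with hV
  refine eventually_inProb.2 fun η hη => ?_
  have hlim : Tendsto (fun n : ℕ => (J + 1) * (4 * V / δ ^ 2) / (n : ℝ)) atTop (𝓝 0) :=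
    tendsto_const_div_atTop_nhds_zero_nat _
  filter_upwards [hlim.eventually (gt_mem_nhds hη), eventually_ge_atTop 1] with n hn hn1
  have hn0 : (0 : ℝ) < n := by exact_mod_cast hn1
  set L : ℕ := ⌊δ * n / (2 * B)⌋₊ + 1 with hL
  have hL1 : δ * n / (2 * B) < L := by
    rw [hL]; push_cast; exact Nat.lt_floor_add_one _
  have hL2 : ((L : ℝ) - 1) ≤ δ * n / (2 * B) := by
    rw [hL]; push_cast; rw [add_sub_cancel_right]; exact Nat.floor_le (by positivity)
  let bad : ℕ → Set Ω := fun j =>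
    {ω | j * L ≤ n ∧ (δ * n / 2) ^ 2 ≤ (∑ t ∈ Finset.Icc 1 (j * L), Z t ω) ^ 2}
  have hbad : ∀ j, P.real (bad j) ≤ 4 * V / (δ ^ 2 * n) := by
    intro j
    by_cases hj : j * L ≤ n
    · have h1 : bad j = {ω | (δ * n / 2) ^ 2 ≤ (∑ t ∈ Finset.Icc 1 (j * L), Z t ω) ^ 2} := by
        ext ω; simp [bad, hj]
      have hmeas : Measurable fun ω => ∑ t ∈ Finset.Icc 1 (j * L), Z t ω :=
        Finset.measurable_sum _ fun t _ => hZ t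
      have hint : Integrable (fun ω => (∑ t ∈ Finset.Icc 1 (j * L), Z t ω) ^ 2) P := by
        refine Integrable.of_bound (hmeas.pow_const 2).aestronglyMeasurable
          ((∑ t ∈ Finset.Icc 1 (j * L), B) ^ 2) (ae_of_all _ fun ω => ?_)
        rw [Real.norm_eq_abs, abs_pow]
        refine pow_le_pow_left₀ (abs_nonneg _) ?_ 2
        exact (Finset.abs_sum_le_sum_abs _ _).trans (Finset.sum_le_sum fun t _ => hB t ω)
      have h2 := mul_meas_ge_le_integral_of_nonneg
        (ae_of_all P fun ω => sq_nonneg (∑ t ∈ Finset.Icc 1 (j * L), Z t ω)) hint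
        ((δ * n / 2) ^ 2)
      have h3 := h2.trans (integral_sq_sum_le_of_uncorrelated hZ hB hcov (j * L))
      rw [h1]
      have h4 : ((j * L : ℕ) : ℝ) * V ≤ n * V := by
        refine mul_le_mul_of_nonneg_right (by exact_mod_cast hj) (by positivity)
      have h5 := h3.trans h4
      rw [le_div_iff₀ (by positivity)]
      have h6 : (δ * n / 2) ^ 2 * P.real {ω | (δ * n / 2) ^ 2
          ≤ (∑ t ∈ Finset.Icc 1 (j * L), Z t ω) ^ 2} = (n / 4) * (P.real {ω | (δ * n / 2) ^ 2
          ≤ (∑ t ∈ Finset.Icc 1 (j * L), Z t ω) ^ 2} * (δ ^ 2 * n)) := by ring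
      rw [h6] at h5
      have h7 : (n : ℝ) * V = (n / 4) * (4 * V) := by ring
      rw [h7] at h5
      exact le_of_mul_le_mul_left h5 (by positivity)
    · have h1 : bad j = ∅ := by
        ext ω; simp [bad, hj]
      rw [h1]
      simp only [measureReal_empty]
      positivity
  have hsub : {ω | ¬ ∀ m ≤ n, |∑ t ∈ Finset.Icc 1 m, Z t ω| ≤ δ * n}
      ⊆ ⋃ j ∈ Finset.range (J + 1), bad j := by
    intro ω hω
    by_contra hcon
    refine hω fun m hm => ?_
    have hgood : ∀ j, j < J + 1 → j * L ≤ n →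
        |∑ t ∈ Finset.Icc 1 (j * L), Z t ω| ≤ δ * n / 2 := by
      intro j hj hjL
      by_contra hc
      refine hcon ?_
      simp only [Set.mem_iUnion]
      refine ⟨j, Finset.mem_range.2 hj, hjL, ?_⟩
      rw [← sq_abs (∑ t ∈ Finset.Icc 1 (j * L), Z t ω)]
      exact pow_le_pow_left₀ (by positivity) (not_le.1 hc).le 2
    have hdm : m / L * L ≤ m := Nat.div_mul_le_self m L
    have hj1 : m / L < J + 1 := by
      have h1 : ((m / L : ℕ) : ℝ) * L ≤ n := by exact_mod_cast hdm.trans hm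
      have h2 : ((m / L : ℕ) : ℝ) ≤ 2 * B / δ := by
        rw [le_div_iff₀ hδ]
        by_contra hc
        rw [not_le] at hc
        have h3 : δ * n / (2 * B) * ((m / L : ℕ) : ℝ) ≤ L * ((m / L : ℕ) : ℝ) :=
          mul_le_mul_of_nonneg_right hL1.le (Nat.cast_nonneg _)
        have h4 : δ * n / (2 * B) * ((m / L : ℕ) : ℝ) = n * (((m / L : ℕ) : ℝ) * δ / (2 * B)) := by
          ring
        have h5 : 1 < ((m / L : ℕ) : ℝ) * δ / (2 * B) := by
          rwa [lt_div_iff₀ (by positivity), one_mul]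
        have h6 := mul_lt_mul_of_pos_left h5 hn0
        linarith
      have h3 : ((m / L : ℕ) : ℝ) < J := lt_of_le_of_lt h2 hJ
      have h4 : m / L < J := by exact_mod_cast h3
      omega
    have hsplit : ∑ t ∈ Finset.Icc 1 m, Z t ω
        = ∑ t ∈ Finset.Icc 1 (m / L * L), Z t ω + ∑ t ∈ Finset.Ioc (m / L * L) m, Z t ω := by
      have e1 : ∀ a : ℕ, Finset.Icc 1 a = Finset.Ioc 0 a := fun a => by
        ext t; simp only [Finset.mem_Icc, Finset.mem_Ioc]; omega
      rw [e1, e1, Finset.sum_Ioc_consecutive _ (Nat.zero_le _) hdm]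
    have hrest : |∑ t ∈ Finset.Ioc (m / L * L) m, Z t ω| ≤ δ * n / 2 := by
      have h1 : |∑ t ∈ Finset.Ioc (m / L * L) m, Z t ω|
          ≤ ∑ t ∈ Finset.Ioc (m / L * L) m, B :=
        (Finset.abs_sum_le_sum_abs _ _).trans (Finset.sum_le_sum fun t _ => hB t ω)
      rw [Finset.sum_const, Nat.card_Ioc, nsmul_eq_mul] at h1
      have h2 : ((m - m / L * L : ℕ) : ℝ) ≤ (L : ℝ) - 1 := by
        have h3 : m - m / L * L + 1 ≤ L := by
          have h4 := Nat.div_add_mod' m L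
          have h5 := Nat.mod_lt m (show 0 < L by omega)
          omega
        have h6 : ((m - m / L * L : ℕ) : ℝ) + 1 ≤ L := by exact_mod_cast h3
        linarith
      calc _ ≤ _ := h1
        _ ≤ (δ * n / (2 * B)) * B := mul_le_mul_of_nonneg_right (h2.trans hL2) hB0.le
        _ = δ * n / 2 := by field_simp
    rw [hsplit]
    refine (abs_add_le _ _).trans ?_
    have := hgood (m / L) hj1 (hdm.trans hm)
    linarith
  have hfin : P.real {ω | ¬ ∀ m ≤ n, |∑ t ∈ Finset.Icc 1 m, Z t ω| ≤ δ * n} ≤ η := by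
    calc _ ≤ P.real (⋃ j ∈ Finset.range (J + 1), bad j) := measureReal_mono hsub (measure_ne_top _ _)
      _ ≤ ∑ j ∈ Finset.range (J + 1), P.real (bad j) := measureReal_biUnion_finset_le _ _
      _ ≤ ∑ j ∈ Finset.range (J + 1), 4 * V / (δ ^ 2 * n) := Finset.sum_le_sum fun j _ => hbad j
      _ = (J + 1) * (4 * V / δ ^ 2) / (n : ℝ) := by
          rw [Finset.sum_const, Finset.card_range, nsmul_eq_mul]
          push_cast
          field_simp
      _ ≤ η := hn.le
  rw [← ofReal_measureReal]
  exact ENNReal.ofReal_le_ofReal hfin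

/-- Integrable functions of a sequence are approximated in `L¹` by bounded functions of finitely
many coordinates. -/
lemma exists_finite_range_approx {μ : Measure (ℕ → ℝ)} [IsProbabilityMeasure μ]
    {F : (ℕ → ℝ) → ℝ} (hF : Measurable F) (hint : Integrable F μ) {δ : ℝ} (hδ : 0 < δ) :
    ∃ (M : ℕ) (G : (ℕ → ℝ) → ℝ) (B : ℝ), Measurable[Filtration.piLE (X := fun _ : ℕ => ℝ) M] G ∧
      (∀ x, |G x| ≤ B) ∧ ∫ x, |F x - G x| ∂μ ≤ δ := by
  have hsup : (MeasurableSpace.pi : MeasurableSpace (ℕ → ℝ))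
      ≤ ⨆ M, (Filtration.piLE (X := fun _ : ℕ => ℝ)) M := by
    refine iSup_le fun i => le_iSup_of_le i ?_
    change _ ≤ MeasurableSpace.comap (Preorder.restrictLe i) MeasurableSpace.pi
    have h : (fun x : ℕ → ℝ => x i)
        = (fun y : (Set.Iic i → ℝ) => y ⟨i, Set.mem_Iic.2 le_rfl⟩) ∘ Preorder.restrictLe i := rfl
    rw [h, ← MeasurableSpace.comap_comp]
    exact MeasurableSpace.comap_mono (measurable_pi_apply _).comap_le
  have hstr : StronglyMeasurable[⨆ M, (Filtration.piLE (X := fun _ : ℕ => ℝ)) M] F :=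
    (hF.mono hsup le_rfl).stronglyMeasurable
  -- Lévy's upward theorem: the conditional expectations of F given the coordinates up to M converge
  -- to F in L¹.
  have h1 := hint.tendsto_eLpNorm_condExp hstr
  obtain ⟨M, hM⟩ := (ENNReal.tendsto_atTop_zero.1 h1) (ENNReal.ofReal (δ / 2))
    (by simpa using hδ)
  have hM := hM M le_rfl
  set f : (ℕ → ℝ) → ℝ := μ[F | (Filtration.piLE (X := fun _ : ℕ => ℝ)) M] with hf
  have hfm : Measurable[Filtration.piLE (X := fun _ : ℕ => ℝ) M] f :=
    stronglyMeasurable_condExp.measurable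
  have hfi : Integrable f μ := integrable_condExp
  have hfF : ∫ x, |F x - f x| ∂μ ≤ δ / 2 := by
    have h2 : ∫ x, ‖(f - F) x‖ ∂μ = (eLpNorm (f - F) 1 μ).toReal := by
      rw [integral_norm_eq_lintegral_enorm (hfi.sub hint).aestronglyMeasurable,
        eLpNorm_one_eq_lintegral_enorm]
    have h3 : ∫ x, |F x - f x| ∂μ = ∫ x, ‖(f - F) x‖ ∂μ := by
      refine integral_congr_ae (ae_of_all _ fun x => ?_)
      simp [abs_sub_comm]
    rw [h3, h2]
    exact ENNReal.toReal_le_of_le_ofReal (by positivity) hM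
  have hfm' : Measurable f := hfm.mono (Filtration.le _ M) le_rfl
  -- Clipping at ±B makes the approximation bounded; its L¹ cost tends to 0 by dominated
  -- convergence.
  have hclip : Tendsto (fun B : ℕ => ∫ x, |f x - max (-(B : ℝ)) (min B (f x))| ∂μ) atTop
      (𝓝 (∫ _, (0 : ℝ) ∂μ)) := by
    refine tendsto_integral_of_dominated_convergence (fun x => |f x|) ?_ hfi.abs ?_ ?_
    · intro B
      exact (hfm'.sub (measurable_const.max (measurable_const.min hfm'))).abs.aestronglyMeasurable
    · intro B
      refine ae_of_all _ fun x => ?_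
      rw [Real.norm_eq_abs, abs_abs]
      have hB : (0 : ℝ) ≤ B := Nat.cast_nonneg B
      rcases le_total (f x) 0 with h | h
      · rw [min_eq_right (h.trans hB), abs_of_nonpos h, abs_of_nonpos] <;>
        rcases le_total (-(B : ℝ)) (f x) with h' | h' <;> (simp [h']; try linarith)
      · rw [max_eq_right (by rcases le_total (B : ℝ) (f x) with h' | h' <;> simp [h'] <;> linarith),
          abs_of_nonneg h, abs_of_nonneg] <;>
        rcases le_total (B : ℝ) (f x) with h' | h' <;> simp [h'] <;> linarith
    · refine ae_of_all _ fun x => ?_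
      refine tendsto_const_nhds.congr' ?_
      obtain ⟨B0, hB0⟩ := exists_nat_ge |f x|
      filter_upwards [eventually_ge_atTop B0] with B hB
      have h2 : |f x| ≤ B := hB0.trans (by exact_mod_cast hB)
      rw [abs_le] at h2
      rw [min_eq_right h2.2, max_eq_right h2.1]
      simp
  simp only [integral_zero] at hclip
  obtain ⟨B, hB⟩ := (hclip.eventually (gt_mem_nhds (show (0 : ℝ) < δ / 2 by positivity))).exists
  refine ⟨M, fun x => max (-(B : ℝ)) (min B (f x)), B, ?_, ?_, ?_⟩
  · exact Measurable.max (measurable_const) (Measurable.min measurable_const hfm)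
  · intro x
    rw [abs_le]
    exact ⟨le_max_left _ _, max_le (by simp) (min_le_left _ _)⟩
  · have hGi : Integrable (fun x => max (-(B : ℝ)) (min B (f x))) μ := by
      refine Integrable.of_bound
        (measurable_const.max (measurable_const.min hfm')).aestronglyMeasurable B
        (ae_of_all _ fun x => ?_)
      rw [Real.norm_eq_abs, abs_le]
      exact ⟨le_max_left _ _, max_le (by simp) (min_le_left _ _)⟩
    calc ∫ x, |F x - max (-(B : ℝ)) (min B (f x))| ∂μ
        ≤ ∫ x, (|F x - f x| + |f x - max (-(B : ℝ)) (min B (f x))|) ∂μ := by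
          refine integral_mono (hint.sub hGi).abs ((hint.sub hfi).abs.add (hfi.sub hGi).abs) ?_
          intro x
          exact abs_sub_le _ _ _
      _ = _ := integral_add (hint.sub hfi).abs (hfi.sub hGi).abs
      _ ≤ δ := by linarith

/-- The uniform weak law of large numbers for functionals of the past of the innovations. -/
theorem IsInnovation.uniform_wlln [IsProbabilityMeasure P] (hε : IsInnovation ε P)
    {F : (ℕ → ℝ) → ℝ} (hF : Measurable F) (hint : Integrable F (pastLaw ε P)) {δ : ℝ}
    (hδ : 0 < δ) :
    ∀ᶠ x in inProb P, ∀ m ≤ x.1,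
      |∑ t ∈ Finset.Icc 1 m, F (past ε (t : ℕ) x.2) - m * ∫ y, F y ∂(pastLaw ε P)|
        ≤ δ * x.1 := by
  have := hε.isProbabilityMeasure_pastLaw
  set μ := pastLaw ε P with hμ
  refine eventually_inProb_of_forall fun η hη => ?_
  -- The first bound controls the difference of the means of F and G. With the second, Markov's
  -- inequality gives probability at most η that the summed errors |F - G| reach δn/3.
  set δ' : ℝ := min (δ / 3) (η * (δ / 3)) with hδ'
  have hδ'0 : 0 < δ' := by positivity
  obtain ⟨M, G, B, hG, hGB, hFG⟩ := exists_finite_range_approx hF hint hδ'0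
  have hGm : Measurable G := hG.mono (Filtration.le _ M) le_rfl
  have hGi : Integrable G μ := Integrable.of_bound hGm.aestronglyMeasurable B
    (ae_of_all _ fun x => hGB x)
  set c := ∫ y, G y ∂μ with hc
  have hmp := hε.measurePreserving_past
  have hintG : ∀ t : ℤ, ∫ ω, (G (past ε t ω) - c) ∂P = 0 := by
    intro t
    have h1 : ∫ ω, G (past ε t ω) ∂P = c := by
      rw [hc, hμ, ← hε.map_past t,
        integral_map (hε.measurable_past t).aemeasurable hGm.aestronglyMeasurable]
    rw [integral_sub _ (integrable_const _), h1]
    · simp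
    · exact (hmp t).integrable_comp_of_integrable hGi
  -- The value of G at time t involves only ε_{t-M}, …, ε_t, and these windows are disjoint when the
  -- times are more than M apart.
  have hcov : ∀ s t : ℕ, s + M < t ∨ t + M < s →
      ∫ ω, (G (past ε (s : ℕ) ω) - c) * (G (past ε (t : ℕ) ω) - c) ∂P = 0 := by
    intro s t hst
    have hmeas : ∀ t : ℕ, Measurable[⨆ s ∈ Set.Icc ((t : ℤ) - M) t,
        MeasurableSpace.comap (ε s) inferInstance] fun ω => G (past ε (t : ℕ) ω) - c := by
      intro t
      refine Measurable.sub_const ?_ c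
      refine hG.comp ?_
      refine measurable_iff_comap_le.2 ?_
      change MeasurableSpace.comap _ (MeasurableSpace.comap (Preorder.restrictLe M) _) ≤ _
      rw [MeasurableSpace.comap_comp]
      refine Measurable.comap_le ?_
      refine @measurable_pi_lambda _ _ _ (_) _ _ fun i => measurable_innovation_of_mem ε ?_
      have := i.2
      simp only [Set.mem_Iic] at this
      simp only [Set.mem_Icc]
      omega
    have hind : IndepFun (fun ω => G (past ε (s : ℕ) ω) - c)
        (fun ω => G (past ε (t : ℕ) ω) - c) P := by
      refine hε.indepFun_of_measurable ?_ (hmeas s) (hmeas t)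
      rw [Set.disjoint_left]
      intro a ha hb
      simp only [Set.mem_Icc] at ha hb
      omega
    rw [hind.integral_fun_mul_eq_mul_integral
      ((hGm.comp (hε.measurable_past s)).sub_const c).aestronglyMeasurable
      ((hGm.comp (hε.measurable_past t)).sub_const c).aestronglyMeasurable, hintG]
    simp
  have hmain := uniform_wlln_of_uncorrelated (P := P)
    (Z := fun (t : ℕ) ω => G (past ε (t : ℕ) ω) - c) (B := B + |c|) (M := M)
    (fun t => (hGm.comp (hε.measurable_past t)).sub_const c)
    (fun t ω => (abs_sub _ _).trans (add_le_add (hGB _) le_rfl)) hcov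
    (show (0 : ℝ) < δ / 3 by positivity)
  have hcc : |c - ∫ y, F y ∂μ| ≤ δ / 3 := by
    rw [hc, ← integral_sub hGi hint]
    refine (abs_integral_le_integral_abs).trans ?_
    refine le_trans (le_of_eq ?_) (hFG.trans (min_le_left _ _))
    exact integral_congr_ae (ae_of_all _ fun x => abs_sub_comm _ _)
  -- The sum of absolute errors up to n dominates the error of every partial sum, so it handles all
  -- m ≤ n at once.
  let R : ℕ → Ω → ℝ := fun n ω =>
    ∑ t ∈ Finset.Icc 1 n, |F (past ε (t : ℕ) ω) - G (past ε (t : ℕ) ω)|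
  refine ⟨{x | R x.1 x.2 < δ / 3 * x.1}, ?_, ?_⟩
  · filter_upwards [eventually_ge_atTop 1] with n hn
    have hn0 : (0 : ℝ) < n := by exact_mod_cast hn
    have hterm : ∀ t : ℤ, Integrable (fun ω => |F (past ε t ω) - G (past ε t ω)|) P :=
      fun t => (hmp t).integrable_comp_of_integrable (hint.sub hGi).abs
    have hRi : Integrable (R n) P := integrable_finsetSum _ fun t _ => hterm t
    have hR : ∫ ω, R n ω ∂P ≤ n * δ' := by
      simp only [R]
      rw [integral_finsetSum _ fun (t : ℕ) _ => hterm t]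
      have h1 : ∀ t ∈ Finset.Icc 1 n,
          ∫ ω, |F (past ε (t : ℕ) ω) - G (past ε (t : ℕ) ω)| ∂P ≤ δ' := by
        intro t _
        refine le_trans (le_of_eq ?_) hFG
        rw [hμ, ← hε.map_past t]
        exact (integral_map (hε.measurable_past t).aemeasurable
          (hF.sub hGm).abs.aestronglyMeasurable).symm
      refine (Finset.sum_le_sum h1).trans ?_
      simp
    have h2 := mul_meas_ge_le_integral_of_nonneg
      (ae_of_all P fun ω => Finset.sum_nonneg fun t _ => abs_nonneg _) hRi (δ / 3 * n)
    have h3 : δ / 3 * n * P.real {ω | δ / 3 * n ≤ R n ω} ≤ δ / 3 * n * η := by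
      refine (h2.trans hR).trans ?_
      have : δ' ≤ η * (δ / 3) := min_le_right _ _
      nlinarith
    have h4 := le_of_mul_le_mul_left h3 (by positivity)
    simp only [not_lt]
    rw [← ofReal_measureReal]
    exact ENNReal.ofReal_le_ofReal h4
  · rw [eventually_inf_principal]
    filter_upwards [hmain] with x hx hxR m hm
    have hxR' : R x.1 x.2 < δ / 3 * x.1 := hxR
    have h1 := hx m hm
    have h2 : |∑ t ∈ Finset.Icc 1 m, (F (past ε (t : ℕ) x.2) - G (past ε (t : ℕ) x.2))|
        ≤ R x.1 x.2 :=
      (Finset.abs_sum_le_sum_abs _ _).trans (Finset.sum_le_sum_of_subset_of_nonneg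
        (Finset.Icc_subset_Icc_right hm) fun _ _ _ => abs_nonneg _)
    have h3 : |(m : ℝ) * (c - ∫ y, F y ∂μ)| ≤ δ / 3 * x.1 := by
      rw [abs_mul, Nat.abs_cast, mul_comm]
      exact mul_le_mul hcc (by exact_mod_cast hm) (Nat.cast_nonneg _) (by positivity)
    have h4 : ∑ t ∈ Finset.Icc 1 m, F (past ε (t : ℕ) x.2) - m * ∫ y, F y ∂μ
        = ∑ t ∈ Finset.Icc 1 m, (F (past ε (t : ℕ) x.2) - G (past ε (t : ℕ) x.2))
          + ∑ t ∈ Finset.Icc 1 m, (G (past ε (t : ℕ) x.2) - c)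
          + m * (c - ∫ y, F y ∂μ) := by
      simp only [Finset.sum_sub_distrib, Finset.sum_const, Nat.card_Icc, nsmul_eq_mul,
        Nat.add_sub_cancel]
      ring
    rw [h4]
    refine (abs_add_three _ _ _).trans ?_
    linarith

end LawOfLargeNumbers

end GARCH

namespace GARCH

/-! ### From a negative mean logarithm to a contracting small moment -/

section Contraction

variable {Ω : Type*} [MeasurableSpace Ω] {P : Measure Ω} {ε : ℤ → Ω → ℝ}

omit [MeasurableSpace Ω] in
lemma past_shift (ε : ℤ → Ω → ℝ) (t : ℤ) (N : ℕ) (ω : Ω) :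
    (fun i => past ε t ω (i + N)) = past ε (t - N) ω := by
  funext i
  simp only [past]
  congr 1
  push_cast
  ring

/-- Independence: f sees only the innovations 0, …, N-1 of the past and g only the later
coordinates. Working with values in [0, ∞] avoids any integrability assumption. -/
lemma lintegral_mul_shift [IsProbabilityMeasure P] (hε : IsInnovation ε P) {N : ℕ}
    {f g : (ℕ → ℝ) → ENNReal} (hf : Measurable f)
    (hdep : ∀ x y : ℕ → ℝ, (∀ i < N, x i = y i) → f x = f y) (hg : Measurable g) :
    ∫⁻ x, f x * g (fun i => x (i + N)) ∂(pastLaw ε P)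
      = (∫⁻ x, f x ∂(pastLaw ε P)) * ∫⁻ x, g x ∂(pastLaw ε P) := by
  have hshift : Measurable fun (x : ℕ → ℝ) (i : ℕ) => x (i + N) :=
    measurable_pi_iff.2 fun _ => measurable_pi_apply _
  have hm := hε.measurePreserving_past
  rw [← (hm 0).lintegral_comp (f := fun x => f x * g fun i => x (i + N))
      (hf.mul (hg.comp hshift)), ← (hm 0).lintegral_comp hf,
    ← (hm (0 - N)).lintegral_comp hg]
  let ext : (Fin N → ℝ) → ℕ → ℝ := fun y i => if h : i < N then y ⟨i, h⟩ else 0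
  have hext : Measurable ext := by
    refine measurable_pi_iff.2 fun i => ?_
    by_cases h : i < N
    · simpa [ext, h] using measurable_pi_apply (⟨i, h⟩ : Fin N)
    · simp [ext, h]
  have hfe : ∀ x, f x = f (ext fun i => x i) := fun x =>
    hdep _ _ fun i hi => by simp [ext, hi]
  have hind := (hε.indepFun_block_past N 0).comp (hf.comp hext) hg
  have := lintegral_mul_eq_lintegral_mul_lintegral_of_indepFun''
    ((hf.comp hext).comp (measurable_pi_iff.2 fun i : Fin N =>
      (measurable_pi_apply (i : ℕ)).comp (hε.measurable_past 0))).aemeasurable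
    (hg.comp (hε.measurable_past (0 - N))).aemeasurable hind
  refine Eq.trans ?_ (this.trans ?_)
  · refine lintegral_congr fun ω => ?_
    rw [past_shift, hfe (past ε 0 ω)]
    rfl
  · congr 1
    exact lintegral_congr fun ω => (hfe _).symm

/-- A nonnegative random variable with `E log Z < 0` contracts in the sense of a small moment. -/
lemma exists_lintegral_rpow_lt_one {α : Type*} [MeasurableSpace α] {μ : Measure α}
    [IsProbabilityMeasure μ] {Z : α → ℝ} (hZ : Measurable Z) (hZ0 : ∀ x, 0 ≤ Z x)
    (hint : Integrable Z μ) (hlog : ∫ x, Real.log (Z x) ∂μ < 0) :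
    ∃ s : ℝ, 0 < s ∧ s ≤ 1 ∧ ∫⁻ x, ENNReal.ofReal (Z x ^ s) ∂μ < 1 := by
  -- The integral of a non-integrable function is 0 by convention, so a negative value certifies
  -- integrability.
  have hL : Integrable (fun x => Real.log (Z x)) μ := by
    by_contra h
    rw [integral_undef h] at hlog
    exact lt_irrefl _ hlog
  -- At Z = 0 the convention log 0 = 0 makes the left side 1; this explains the summand 1.
  have hexp : ∀ x, Real.exp (Real.log (Z x)) ≤ Z x + 1 := by
    intro x
    rcases (hZ0 x).eq_or_lt with h | h
    · simp [← h]
    · rw [Real.exp_log h]; linarith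
  let s : ℕ → ℝ := fun n => 1 / ((n : ℝ) + 1)
  have hs0 : ∀ n, 0 < s n := fun n => by positivity
  have hs1 : ∀ n, s n ≤ 1 := fun n => by
    simp only [s]
    rw [div_le_one (by positivity)]
    have : (0 : ℝ) ≤ n := Nat.cast_nonneg n
    linarith
  have hupper : ∀ n x, Real.exp (s n * Real.log (Z x))
      ≤ 1 + s n * (Real.exp (Real.log (Z x)) - 1) := by
    intro n x
    have h := rpow_one_add_le_one_add_mul_self (s := Real.exp (Real.log (Z x)) - 1)
      (by have := Real.exp_pos (Real.log (Z x)); linarith) (hs0 n).le (hs1 n)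
    rwa [add_sub_cancel, ← Real.exp_mul, mul_comm (Real.log (Z x))] at h
  -- The difference quotient at 0 of s ↦ E exp(s log Z) tends to E log Z < 0, so the moment is below
  -- 1 for small s. The quotients are dominated from below by log Z (convexity of exp) and from
  -- above through Bernoulli's inequality for exponents in [0, 1].
  have hlim : Tendsto (fun n => ∫ x, (Real.exp (s n * Real.log (Z x)) - 1) / s n ∂μ) atTop
      (𝓝 (∫ x, Real.log (Z x) ∂μ)) := by
    refine tendsto_integral_of_dominated_convergence (fun x => |Real.log (Z x)| + (Z x + 2))
      ?_ (hL.abs.add (hint.add (integrable_const _))) ?_ ?_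
    · intro n
      exact ((((Real.measurable_log.comp hZ).const_mul _).exp.sub_const _).div_const
        _).aestronglyMeasurable
    · intro n
      refine ae_of_all _ fun x => ?_
      rw [Real.norm_eq_abs, abs_le]
      constructor
      · rw [le_div_iff₀ (hs0 n)]
        have h1 := Real.add_one_le_exp (s n * Real.log (Z x))
        have h2 := neg_abs_le (Real.log (Z x))
        have h3 := hZ0 x
        nlinarith [hs0 n]
      · rw [div_le_iff₀ (hs0 n)]
        have h1 := hupper n x
        have h2 := hexp x
        have h3 := abs_nonneg (Real.log (Z x))
        nlinarith [hs0 n]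
    · refine ae_of_all _ fun x => ?_
      have hd : HasDerivAt (fun r : ℝ => Real.exp (r * Real.log (Z x))) (Real.log (Z x)) 0 := by
        have := ((hasDerivAt_id (0 : ℝ)).mul_const (Real.log (Z x))).exp
        simpa using this
      have h1 := hd.tendsto_slope_zero_right
      have h2 : Tendsto s atTop (𝓝[>] 0) :=
        tendsto_nhdsWithin_iff.2 ⟨tendsto_one_div_add_atTop_nhds_zero_nat,
          Eventually.of_forall hs0⟩
      refine (h1.comp h2).congr fun n => ?_
      simp [div_eq_inv_mul]
  obtain ⟨n, hn⟩ := (hlim.eventually (gt_mem_nhds hlog)).exists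
  refine ⟨s n, hs0 n, hs1 n, ?_⟩
  have hE : Integrable (fun x => Real.exp (s n * Real.log (Z x))) μ := by
    refine Integrable.mono' ((integrable_const (1 : ℝ)).add (hint.const_mul (s n)))
      (((Real.measurable_log.comp hZ).const_mul _).exp).aestronglyMeasurable
      (ae_of_all _ fun x => ?_)
    rw [Real.norm_eq_abs, abs_of_pos (Real.exp_pos _)]
    have h1 := hupper n x
    have h2 := hexp x
    simp only [Pi.add_apply]
    nlinarith [hs0 n]
  have h1 : ∫ x, Real.exp (s n * Real.log (Z x)) ∂μ < 1 := by
    rw [integral_div, integral_sub hE (integrable_const _)] at hn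
    simp only [integral_const, probReal_univ, smul_eq_mul, mul_one] at hn
    rw [div_lt_iff₀ (hs0 n), zero_mul] at hn
    linarith
  calc ∫⁻ x, ENNReal.ofReal (Z x ^ s n) ∂μ
      ≤ ∫⁻ x, ENNReal.ofReal (Real.exp (s n * Real.log (Z x))) ∂μ := by
        refine lintegral_mono fun x => ENNReal.ofReal_le_ofReal ?_
        rcases (hZ0 x).eq_or_lt with h | h
        · rw [← h, Real.zero_rpow (hs0 n).ne']
          exact (Real.exp_pos _).le
        · rw [Real.rpow_def_of_pos h, mul_comm]
    _ = ENNReal.ofReal (∫ x, Real.exp (s n * Real.log (Z x)) ∂μ) :=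
        (ofReal_integral_eq_lintegral_ofReal hE (ae_of_all _ fun x => (Real.exp_pos _).le)).symm
    _ < 1 := by rwa [ENNReal.ofReal_lt_one]

end Contraction

/-! ### Iterating the Markov representation -/

section Markov

attribute [local instance] Matrix.linftyOpNormedAddCommGroup

variable {p q : ℕ} (θ : Param p q)

/-- The product `A(x_0) ⋯ A(x_{n-1})` of transition matrices. -/
def blockProd : ℕ → (ℕ → ℝ) → Matrix (Fin q ⊕ Fin p) (Fin q ⊕ Fin p) ℝ
  | 0, _ => 1
  | n + 1, x => transitionMatrix θ (x 0) * blockProd n fun i => x (i + 1)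

/-- The inhomogeneous term `b(e)` of the Markov representation. -/
def noise (e : ℝ) : Fin q ⊕ Fin p → ℝ :=
  Sum.elim (fun j => if (j : ℕ) = 0 then θ (Sum.inl 0) else 0)
    (fun i => if (i : ℕ) = 0 then e ^ 2 * θ (Sum.inl 0) else 0)

/-- The state reached after `n` steps of the Markov representation started at `0`, as a function
of the innovations in reversed time. -/
def approxState : ℕ → (ℕ → ℝ) → Fin q ⊕ Fin p → ℝ
  | 0, _ => 0
  | n + 1, x => noise θ (x 0) + (transitionMatrix θ (x 0)).mulVec
      (approxState n fun i => x (i + 1))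

lemma blockProd_eq_list_prod (n : ℕ) (x : ℕ → ℝ) :
    blockProd θ n x = ((List.range n).map fun i => transitionMatrix θ (x i)).prod := by
  induction n generalizing x with
  | zero => simp [blockProd]
  | succ n ih =>
    rw [blockProd, ih, List.range_succ_eq_map]
    simp [Function.comp_def]

lemma blockProd_add (N n : ℕ) (x : ℕ → ℝ) :
    blockProd θ (N + n) x = blockProd θ N x * blockProd θ n fun i => x (i + N) := by
  induction N generalizing x with
  | zero => simp [blockProd]
  | succ N ih =>
    rw [Nat.succ_add, blockProd, ih, blockProd, Matrix.mul_assoc]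
    simp only [add_assoc]

lemma approxState_add (N n : ℕ) (x : ℕ → ℝ) :
    approxState θ (N + n) x = approxState θ N x
      + (blockProd θ N x).mulVec (approxState θ n fun i => x (i + N)) := by
  induction N generalizing x with
  | zero => simp [blockProd, approxState]
  | succ N ih =>
    rw [Nat.succ_add, approxState, ih, blockProd, approxState, Matrix.mulVec_add,
      Matrix.mulVec_mulVec, add_assoc]
    simp only [add_assoc]

lemma blockProd_congr {N : ℕ} {x y : ℕ → ℝ} (h : ∀ i < N, x i = y i) :
    blockProd θ N x = blockProd θ N y := by
  rw [blockProd_eq_list_prod, blockProd_eq_list_prod]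
  congr 1
  refine List.map_congr_left fun i hi => ?_
  rw [h i (List.mem_range.1 hi)]

lemma measurable_transitionMatrix_apply (r c : Fin q ⊕ Fin p) :
    Measurable fun e => transitionMatrix θ e r c := by
  rcases r with j | i <;> simp only [transitionMatrix, Matrix.of_apply] <;> split_ifs
  · exact measurable_const
  · exact measurable_const
  · exact (measurable_id.pow_const 2).mul_const _
  · exact measurable_const

lemma measurable_shift (N : ℕ) : Measurable fun (x : ℕ → ℝ) (i : ℕ) => x (i + N) :=
  measurable_pi_iff.2 fun _ => measurable_pi_apply _

lemma measurable_blockProd_apply (n : ℕ) (r c : Fin q ⊕ Fin p) :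
    Measurable fun x => blockProd θ n x r c := by
  induction n generalizing r c with
  | zero => exact measurable_const
  | succ n ih =>
    simp only [blockProd, Matrix.mul_apply]
    exact Finset.measurable_sum _ fun k _ =>
      ((measurable_transitionMatrix_apply θ r k).comp (measurable_pi_apply 0)).mul
        ((ih k c).comp (measurable_shift 1))

lemma measurable_noise : Measurable (noise θ) := by
  refine measurable_pi_iff.2 fun r => ?_
  rcases r with j | i <;> simp only [noise, Sum.elim_inl, Sum.elim_inr] <;> split_ifs
  · exact measurable_const
  · exact measurable_const
  · exact (measurable_id.pow_const 2).mul_const _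
  · exact measurable_const

lemma measurable_approxState (n : ℕ) : Measurable (approxState θ n) := by
  induction n with
  | zero => exact measurable_const
  | succ n ih =>
    refine measurable_pi_iff.2 fun r => ?_
    simp only [approxState, Pi.add_apply, Matrix.mulVec, dotProduct]
    exact (((measurable_pi_apply r).comp ((measurable_noise θ).comp (measurable_pi_apply 0)))).add
      (Finset.measurable_sum _ fun k _ =>
        ((measurable_transitionMatrix_apply θ r k).comp (measurable_pi_apply 0)).mul
          ((measurable_pi_apply k).comp (ih.comp (measurable_shift 1))))

lemma measurable_norm_matrix {α : Type*} [MeasurableSpace α]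
    {M : α → Matrix (Fin q ⊕ Fin p) (Fin q ⊕ Fin p) ℝ}
    (hM : ∀ r c, Measurable fun x => M x r c) : Measurable fun x => ‖M x‖ := by
  simp_rw [Matrix.linfty_opNorm_def]
  refine measurable_coe_nnreal_real.comp ?_
  have : ∀ s : Finset (Fin q ⊕ Fin p),
      Measurable fun x => s.sup fun i => ∑ j, ‖M x i j‖₊ := by
    intro s
    induction s using Finset.cons_induction with
    | empty => simp
    | cons a s ha ih =>
      simp only [Finset.sup_cons]
      exact (Finset.measurable_sum _ fun j _ => (hM a j).nnnorm).sup ih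
  exact this _

lemma measurable_norm_blockProd (n : ℕ) : Measurable fun x => ‖blockProd θ n x‖ :=
  measurable_norm_matrix (measurable_blockProd_apply θ n)

lemma exists_norm_transitionMatrix_le :
    ∃ C : ℝ, 0 ≤ C ∧ ∀ e, ‖transitionMatrix θ e‖ ≤ C * (1 + e ^ 2) := by
  obtain ⟨C, hC0, hC⟩ : ∃ C : ℝ, 0 ≤ C ∧ ∀ e r c,
      |transitionMatrix θ e r c| ≤ C * (1 + e ^ 2) := by
    refine ⟨1 + ‖θ‖, by positivity, fun e r c => ?_⟩
    have h0 : (0 : ℝ) ≤ e ^ 2 := sq_nonneg e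
    have h1 : |Sum.elim (fun j : Fin q => θ (Sum.inr j)) (fun i : Fin p => θ (Sum.inl i.succ)) c|
        ≤ ‖θ‖ := by
      rcases c with j | i
      · exact norm_le_pi_norm θ (Sum.inr j)
      · exact norm_le_pi_norm θ (Sum.inl i.succ)
    have hθ : 0 ≤ ‖θ‖ := norm_nonneg θ
    have h2 : (1 : ℝ) ≤ (1 + ‖θ‖) * (1 + e ^ 2) := by nlinarith [mul_nonneg hθ h0]
    rcases r with j | i <;> simp only [transitionMatrix, Matrix.of_apply] <;> split_ifs
    · nlinarith [mul_nonneg hθ h0]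
    · rcases c with j' | i'
      · simp only [Sum.elim_inl]
        split_ifs
        · simpa using h2
        · simp; positivity
      · simp; positivity
    · rw [abs_mul, abs_of_nonneg h0]
      nlinarith [mul_nonneg hθ h0, mul_le_mul_of_nonneg_left h1 h0]
    · rcases c with j' | i'
      · simp; positivity
      · simp only [Sum.elim_inr]
        split_ifs
        · simpa using h2
        · simp; positivity
  refine ⟨Fintype.card (Fin q ⊕ Fin p) * C, by positivity, fun e => ?_⟩
  have h1 : (0 : ℝ) ≤ Fintype.card (Fin q ⊕ Fin p) * C * (1 + e ^ 2) := by positivity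
  rw [Matrix.linfty_opNorm_def]
  have h2 : (Finset.univ.sup fun i => ∑ j, ‖transitionMatrix θ e i j‖₊)
      ≤ Real.toNNReal (Fintype.card (Fin q ⊕ Fin p) * C * (1 + e ^ 2)) := by
    refine Finset.sup_le fun i _ => ?_
    rw [← NNReal.coe_le_coe, Real.coe_toNNReal _ h1]
    push_cast
    calc ∑ j, ‖transitionMatrix θ e i j‖ ≤ ∑ _j : Fin q ⊕ Fin p, C * (1 + e ^ 2) :=
          Finset.sum_le_sum fun j _ => hC e i j
      _ = _ := by
          rw [Finset.sum_const, Finset.card_univ, nsmul_eq_mul, mul_assoc]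
  calc _ ≤ ((Real.toNNReal (Fintype.card (Fin q ⊕ Fin p) * C * (1 + e ^ 2)) : NNReal) : ℝ) :=
        NNReal.coe_le_coe.2 h2
    _ = _ := Real.coe_toNNReal _ h1

lemma norm_noise_le (e : ℝ) : ‖noise θ e‖ ≤ ‖θ‖ * (1 + e ^ 2) := by
  have h0 : (0 : ℝ) ≤ e ^ 2 := sq_nonneg e
  have hθ : 0 ≤ ‖θ‖ := norm_nonneg θ
  have h1 : |θ (Sum.inl 0)| ≤ ‖θ‖ := norm_le_pi_norm θ (Sum.inl 0)
  refine (pi_norm_le_iff_of_nonneg (by positivity)).2 fun r => ?_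
  rw [Real.norm_eq_abs]
  rcases r with j | i <;> simp only [noise, Sum.elim_inl, Sum.elim_inr] <;> split_ifs
  · nlinarith [mul_nonneg hθ h0]
  · simp; positivity
  · rw [abs_mul, abs_of_nonneg h0]
    nlinarith [mul_le_mul_of_nonneg_left h1 h0]
  · simp; positivity

end Markov

end GARCH

namespace GARCH

/-! ### The stationary state as a function of the past innovations -/

section Causality

attribute [local instance] Matrix.linftyOpNormedAddCommGroup

variable {Ω : Type*} [MeasurableSpace Ω] {P : Measure Ω} {ε : ℤ → Ω → ℝ}
  {p q : ℕ} {θ : Param p q}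

lemma IsInnovation.lintegral_pastLaw_eval [IsProbabilityMeasure P] (hε : IsInnovation ε P)
    {f : ℝ → ENNReal} (hf : Measurable f) :
    ∫⁻ x, f (x 0) ∂(pastLaw ε P) = ∫⁻ ω, f (ε 0 ω) ∂P := by
  rw [← (hε.measurePreserving_past 0).lintegral_comp (f := fun x => f (x 0))
    (hf.comp (measurable_pi_apply 0))]
  simp [past]

lemma IsInnovation.lintegral_sq_lt_top [IsProbabilityMeasure P] (hε : IsInnovation ε P)
    {C : ℝ} (hC : 0 ≤ C) :
    ∫⁻ x, ENNReal.ofReal (C * (1 + x 0 ^ 2)) ∂(pastLaw ε P) < ⊤ := by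
  rw [hε.lintegral_pastLaw_eval (f := fun y => ENNReal.ofReal (C * (1 + y ^ 2)))
    (by fun_prop)]
  have h : Integrable (fun ω => C * (1 + ε 0 ω ^ 2)) P :=
    ((integrable_const 1).add hε.memLp_two.integrable_sq).const_mul C
  rw [← ofReal_integral_eq_lintegral_ofReal h (ae_of_all _ fun ω => by positivity)]
  exact ENNReal.ofReal_lt_top

/-- The norm is submultiplicative, the factors are independent, and one factor is O(1 + ε²), which
has a mean by the second moment of ε. This is the integrability required by
`exists_lintegral_rpow_lt_one`. -/
lemma lintegral_norm_blockProd_lt_top [IsProbabilityMeasure P] (hε : IsInnovation ε P) (n : ℕ) :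
    ∫⁻ x, ENNReal.ofReal ‖blockProd θ n x‖ ∂(pastLaw ε P) < ⊤ := by
  have := hε.isProbabilityMeasure_pastLaw
  induction n with
  | zero => simp [blockProd]
  | succ n ih =>
    obtain ⟨C, hC0, hC⟩ := exists_norm_transitionMatrix_le θ
    calc ∫⁻ x, ENNReal.ofReal ‖blockProd θ (n + 1) x‖ ∂(pastLaw ε P)
        ≤ ∫⁻ x, ENNReal.ofReal (C * (1 + x 0 ^ 2))
            * ENNReal.ofReal ‖blockProd θ n fun i => x (i + 1)‖ ∂(pastLaw ε P) := by
          refine lintegral_mono fun x => ?_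
          rw [← ENNReal.ofReal_mul (by positivity)]
          refine ENNReal.ofReal_le_ofReal ((Matrix.linfty_opNorm_mul _ _).trans ?_)
          exact mul_le_mul_of_nonneg_right (hC _) (norm_nonneg _)
      _ = _ := lintegral_mul_shift hε (N := 1)
          (f := fun x => ENNReal.ofReal (C * (1 + x 0 ^ 2)))
          (g := fun x => ENNReal.ofReal ‖blockProd θ n x‖) (by fun_prop)
          (fun x y h => by rw [h 0 one_pos])
          (measurable_norm_blockProd θ n).ennreal_ofReal
      _ < ⊤ := ENNReal.mul_lt_top (hε.lintegral_sq_lt_top hC0) ih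

lemma lintegral_norm_approxState_lt_top [IsProbabilityMeasure P] (hε : IsInnovation ε P)
    (n : ℕ) : ∫⁻ x, ENNReal.ofReal ‖approxState θ n x‖ ∂(pastLaw ε P) < ⊤ := by
  induction n with
  | zero => simp [approxState]
  | succ n ih =>
    obtain ⟨C, hC0, hC⟩ := exists_norm_transitionMatrix_le θ
    calc ∫⁻ x, ENNReal.ofReal ‖approxState θ (n + 1) x‖ ∂(pastLaw ε P)
        ≤ ∫⁻ x, (ENNReal.ofReal (‖θ‖ * (1 + x 0 ^ 2)) + ENNReal.ofReal (C * (1 + x 0 ^ 2))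
            * ENNReal.ofReal ‖approxState θ n fun i => x (i + 1)‖) ∂(pastLaw ε P) := by
          refine lintegral_mono fun x => ?_
          rw [← ENNReal.ofReal_mul (by positivity),
            ← ENNReal.ofReal_add (by positivity) (by positivity)]
          refine ENNReal.ofReal_le_ofReal ((norm_add_le _ _).trans ?_)
          refine add_le_add (norm_noise_le θ _) ((Matrix.linfty_opNorm_mulVec _ _).trans ?_)
          exact mul_le_mul_of_nonneg_right (hC _) (norm_nonneg _)
      _ = _ := lintegral_add_left (by fun_prop) _
      _ < ⊤ := by
          rw [lintegral_mul_shift hε (N := 1)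
            (f := fun x => ENNReal.ofReal (C * (1 + x 0 ^ 2)))
            (g := fun x => ENNReal.ofReal ‖approxState θ n x‖) (by fun_prop)
            (fun x y h => by rw [h 0 one_pos])
            (measurable_approxState θ n).norm.ennreal_ofReal]
          exact ENNReal.add_lt_top.2 ⟨hε.lintegral_sq_lt_top (norm_nonneg θ),
            ENNReal.mul_lt_top (hε.lintegral_sq_lt_top hC0) ih⟩

/-- A negative top Lyapunov exponent gives a contraction in the sense of a small moment. -/
lemma exists_contraction [IsProbabilityMeasure P] (hε : IsInnovation ε P)
    (hγ : topLyapunov θ ε P < 0) : ∃ (N : ℕ) (s : ℝ), 0 < s ∧ s ≤ 1 ∧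
      ∫⁻ x, ENNReal.ofReal (‖blockProd θ N x‖ ^ s) ∂(pastLaw ε P) < 1 := by
  have := hε.isProbabilityMeasure_pastLaw
  obtain ⟨n, hn⟩ := iInf_lt_iff.1 hγ
  rw [EReal.coe_neg'] at hn
  refine ⟨n + 1, exists_lintegral_rpow_lt_one (measurable_norm_blockProd θ (n + 1))
    (fun x => norm_nonneg _) ?_ ?_⟩
  · refine ⟨(measurable_norm_blockProd θ (n + 1)).aestronglyMeasurable, ?_⟩
    rw [hasFiniteIntegral_iff_ofReal (ae_of_all _ fun x => norm_nonneg _)]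
    exact lintegral_norm_blockProd_lt_top hε (n + 1)
  · rw [pastLaw, integral_map (f := fun x => Real.log ‖blockProd θ (n + 1) x‖)
      (hε.measurable_past 0).aemeasurable
      (Real.measurable_log.comp (measurable_norm_blockProd θ (n + 1))).aestronglyMeasurable]
    have h1 : ∀ ω, blockProd θ (n + 1) (past ε 0 ω)
        = ((List.range (n + 1)).map fun i => transitionMatrix θ (ε (-(i : ℤ)) ω)).prod := by
      intro ω
      rw [blockProd_eq_list_prod]
      simp [past, ← List.map_eq_flatMap, Function.comp_def]
    simp_rw [h1]
    by_contra hcon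
    have h2 := mul_nonneg (show (0 : ℝ) ≤ ((n : ℝ) + 1)⁻¹ by positivity) (not_lt.1 hcon)
    exact absurd hn (not_lt.2 h2)

lemma ofReal_rpow_le_mul {a b c s : ℝ} (ha : 0 ≤ a) (hb : 0 ≤ b) (h : c ≤ a * b) (hc : 0 ≤ c)
    (hs : 0 ≤ s) : ENNReal.ofReal (c ^ s) ≤ ENNReal.ofReal (a ^ s) * ENNReal.ofReal (b ^ s) := by
  rw [← ENNReal.ofReal_mul (by positivity), ← Real.mul_rpow ha hb]
  exact ENNReal.ofReal_le_ofReal (Real.rpow_le_rpow hc h hs)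

/-- Blocks of length N are independent, so s-th moments multiply. The constant ‖1‖^s is the case j =
0; the norm of the identity is left unevaluated because it is 0 when the index type is empty. -/
lemma lintegral_blockProd_mul_le [IsProbabilityMeasure P] (hε : IsInnovation ε P) {N : ℕ}
    {s : ℝ} (hs : 0 ≤ s) (j : ℕ) :
    ∫⁻ x, ENNReal.ofReal (‖blockProd θ (j * N) x‖ ^ s) ∂(pastLaw ε P)
      ≤ ENNReal.ofReal (‖(1 : Matrix (Fin q ⊕ Fin p) (Fin q ⊕ Fin p) ℝ)‖ ^ s)
        * (∫⁻ x, ENNReal.ofReal (‖blockProd θ N x‖ ^ s) ∂(pastLaw ε P)) ^ j := by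
  have := hε.isProbabilityMeasure_pastLaw
  induction j with
  | zero => simp [blockProd]
  | succ j ih =>
    rw [Nat.succ_mul, add_comm (j * N) N]
    calc ∫⁻ x, ENNReal.ofReal (‖blockProd θ (N + j * N) x‖ ^ s) ∂(pastLaw ε P)
        ≤ ∫⁻ x, ENNReal.ofReal (‖blockProd θ N x‖ ^ s)
            * ENNReal.ofReal (‖blockProd θ (j * N) fun i => x (i + N)‖ ^ s) ∂(pastLaw ε P) := by
          refine lintegral_mono fun x => ?_
          refine ofReal_rpow_le_mul (norm_nonneg _) (norm_nonneg _) ?_ (norm_nonneg _) hs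
          rw [blockProd_add]
          exact Matrix.linfty_opNorm_mul _ _
      _ = _ := lintegral_mul_shift hε (N := N)
          (f := fun x => ENNReal.ofReal (‖blockProd θ N x‖ ^ s))
          (g := fun x => ENNReal.ofReal (‖blockProd θ (j * N) x‖ ^ s))
          ((measurable_norm_blockProd θ N).pow_const s).ennreal_ofReal
          (fun x y h => by rw [blockProd_congr θ h])
          ((measurable_norm_blockProd θ (j * N)).pow_const s).ennreal_ofReal
      _ ≤ _ := mul_le_mul_right ih _
      _ = _ := by rw [pow_succ]; ring

/-- For s ≤ 1 the power is subadditive, so each further block adds one term of a geometric series to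
the s-th moment. -/
lemma lintegral_approxState_mul_le [IsProbabilityMeasure P] (hε : IsInnovation ε P) {N : ℕ}
    {s : ℝ} (hs : 0 < s) (hs1 : s ≤ 1) (j : ℕ) :
    ∫⁻ x, ENNReal.ofReal (‖approxState θ (j * N) x‖ ^ s) ∂(pastLaw ε P)
      ≤ (∫⁻ x, ENNReal.ofReal (‖approxState θ N x‖ ^ s) ∂(pastLaw ε P))
        * ∑ i ∈ Finset.range j,
          (∫⁻ x, ENNReal.ofReal (‖blockProd θ N x‖ ^ s) ∂(pastLaw ε P)) ^ i := by
  induction j with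
  | zero => simp [approxState, Real.zero_rpow hs.ne']
  | succ j ih =>
    rw [Nat.succ_mul, add_comm (j * N) N]
    calc ∫⁻ x, ENNReal.ofReal (‖approxState θ (N + j * N) x‖ ^ s) ∂(pastLaw ε P)
        ≤ ∫⁻ x, (ENNReal.ofReal (‖approxState θ N x‖ ^ s) + ENNReal.ofReal (‖blockProd θ N x‖ ^ s)
            * ENNReal.ofReal (‖approxState θ (j * N) fun i => x (i + N)‖ ^ s))
            ∂(pastLaw ε P) := by
          refine lintegral_mono fun x => ?_
          rw [approxState_add]
          refine le_trans ?_ (add_le_add le_rfl (ofReal_rpow_le_mul (norm_nonneg _) (norm_nonneg _)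
            (Matrix.linfty_opNorm_mulVec (blockProd θ N x) _) (norm_nonneg _) hs.le))
          rw [← ENNReal.ofReal_add (by positivity) (by positivity)]
          refine ENNReal.ofReal_le_ofReal (le_trans ?_ (Real.rpow_add_le_add_rpow (norm_nonneg _)
            (norm_nonneg _) hs.le hs1))
          exact Real.rpow_le_rpow (norm_nonneg _) (norm_add_le _ _) hs.le
      _ = _ := lintegral_add_left
          ((measurable_approxState θ N).norm.pow_const s).ennreal_ofReal _
      _ = _ := by
          rw [lintegral_mul_shift hε (N := N)
            (f := fun x => ENNReal.ofReal (‖blockProd θ N x‖ ^ s))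
            (g := fun x => ENNReal.ofReal (‖approxState θ (j * N) x‖ ^ s))
            ((measurable_norm_blockProd θ N).pow_const s).ennreal_ofReal
            (fun x y h => by rw [blockProd_congr θ h])
            ((measurable_approxState θ (j * N)).norm.pow_const s).ennreal_ofReal]
      _ ≤ _ := add_le_add le_rfl (mul_le_mul_right ih _)
      _ = _ := by rw [geom_sum_succ]; ring

/-- The state `(σ_t², …, σ_{t-q+1}²; X_t², …, X_{t-p+1}²)` of the Markov representation. -/
def state (p q : ℕ) (X σ : ℤ → Ω → ℝ) (t : ℤ) (ω : Ω) : Fin q ⊕ Fin p → ℝ :=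
  Sum.elim (fun j => σ (t - (j : ℕ)) ω ^ 2) (fun i => X (t - (i : ℕ)) ω ^ 2)

variable {X σ : ℤ → Ω → ℝ}

lemma IsStationarySolution.state_eq (hX : IsStationarySolution θ ε X σ P) (t : ℤ) :
    ∀ᵐ ω ∂P, state p q X σ t ω = noise θ (ε t ω)
      + (transitionMatrix θ (ε t ω)).mulVec (state p q X σ (t - 1) ω) := by
  filter_upwards [hX.volatility t, hX.observation t] with ω hv ho
  have hrow : σ t ω ^ 2 = θ (Sum.inl 0)
      + ((∑ j : Fin q, θ (Sum.inr j) * σ (t - 1 - (j : ℕ)) ω ^ 2)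
        + ∑ i : Fin p, θ (Sum.inl i.succ) * X (t - 1 - (i : ℕ)) ω ^ 2) := by
    rw [hv]
    have e : ∀ a : ℕ, t - ((a : ℤ) + 1) = t - 1 - a := fun a => by ring
    simp_rw [e]
    ring
  funext r
  simp only [Pi.add_apply, Matrix.mulVec, dotProduct, Fintype.sum_sum_type]
  rcases r with j | i
  · simp only [state, Sum.elim_inl, Sum.elim_inr, noise, transitionMatrix, Matrix.of_apply]
    by_cases hj : (j : ℕ) = 0
    · simp only [hj, if_true]
      simpa using hrow
    · simp only [hj, if_false, zero_add, zero_mul, Finset.sum_const_zero, add_zero]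
      rw [Finset.sum_eq_single (⟨(j : ℕ) - 1, by omega⟩ : Fin q)]
      · have h1 : (j : ℕ) - 1 + 1 = j := by omega
        simp only [h1, if_true, one_mul]
        congr 2
        have : (((j : ℕ) - 1 : ℕ) : ℤ) = (j : ℤ) - 1 := by omega
        rw [this]; ring
      · intro b _ hb
        rw [if_neg, zero_mul]
        intro hc
        exact hb (Fin.ext (by simp only; omega))
      · simp
  · simp only [state, Sum.elim_inl, Sum.elim_inr, noise, transitionMatrix, Matrix.of_apply]
    by_cases hi : (i : ℕ) = 0
    · simp only [hi, if_true]
      simp only [mul_assoc, ← Finset.mul_sum, ← mul_add]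
      rw [← hrow]
      simp only [Nat.cast_zero, sub_zero, ho]
      ring
    · simp only [hi, if_false, zero_add, zero_mul, Finset.sum_const_zero]
      rw [Finset.sum_eq_single (⟨(i : ℕ) - 1, by omega⟩ : Fin p)]
      · have h1 : (i : ℕ) - 1 + 1 = i := by omega
        simp only [h1, if_true, one_mul]
        congr 2
        have : (((i : ℕ) - 1 : ℕ) : ℤ) = (i : ℤ) - 1 := by omega
        rw [this]; ring
      · intro b _ hb
        rw [if_neg, zero_mul]
        intro hc
        exact hb (Fin.ext (by simp only; omega))
      · simp

lemma IsStationarySolution.state_iterate (hX : IsStationarySolution θ ε X σ P) (n : ℕ) (t : ℤ) :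
    ∀ᵐ ω ∂P, state p q X σ t ω = approxState θ n (past ε t ω)
      + (blockProd θ n (past ε t ω)).mulVec (state p q X σ (t - n) ω) := by
  induction n generalizing t with
  | zero => simp [approxState, blockProd]
  | succ n ih =>
    filter_upwards [hX.state_eq t, ih (t - 1)] with ω h1 h2
    have h3 : (fun i => past ε t ω (i + 1)) = past ε (t - 1) ω := by
      simpa using past_shift ε t 1 ω
    have h4 : past ε t ω 0 = ε t ω := by simp [past]
    rw [h1, h2, approxState, blockProd, h3, h4, Matrix.mulVec_add, Matrix.mulVec_mulVec, add_assoc,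
      show t - 1 - (n : ℤ) = t - ((n + 1 : ℕ) : ℤ) by push_cast; ring]

lemma IsStationarySolution.measurable_state (hX : IsStationarySolution θ ε X σ P) (t : ℤ) :
    Measurable (state p q X σ t) := by
  refine measurable_pi_iff.2 fun r => ?_
  rcases r with j | i
  · exact (hX.measurable_σ _).pow_const 2
  · exact (hX.measurable_X _).pow_const 2

lemma IsStationarySolution.identDistrib_state (hX : IsStationarySolution θ ε X σ P) (t : ℤ) :
    IdentDistrib (state p q X σ t) (state p q X σ 0) P P := by
  let G : (ℤ → ℝ × ℝ) → Fin q ⊕ Fin p → ℝ := fun y =>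
    Sum.elim (fun j => (y (-(j : ℕ))).2 ^ 2) (fun i => (y (-(i : ℕ))).1 ^ 2)
  have hG : Measurable G := by
    refine measurable_pi_iff.2 fun r => ?_
    rcases r with j | i
    · exact (measurable_snd.comp (measurable_pi_apply _)).pow_const 2
    · exact (measurable_fst.comp (measurable_pi_apply _)).pow_const 2
  have h := (hX.stationary t).comp hG
  have e1 : (G ∘ fun ω (s : ℤ) => (X (s + t) ω, σ (s + t) ω)) = state p q X σ t := by
    funext ω r
    rcases r with j | i <;> simp [G, state, neg_add_eq_sub]
  have e2 : (G ∘ fun ω (s : ℤ) => (X s ω, σ s ω)) = state p q X σ 0 := by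
    funext ω r
    rcases r with j | i <;> simp [G, state]
  rwa [e1, e2] at h

/-- The error is the block product of length jN applied to the state at time t - jN. By stationarity
these states have one common law, hence are tight without any moment assumption, and the block
product tends to 0 in the s-th moment. -/
lemma IsStationarySolution.tendstoInMeasure_approxState [IsProbabilityMeasure P]
    (hε : IsInnovation ε P) (hX : IsStationarySolution θ ε X σ P) {N : ℕ} {s : ℝ} (hs : 0 < s)
    (hN : ∫⁻ x, ENNReal.ofReal (‖blockProd θ N x‖ ^ s) ∂(pastLaw ε P) < 1) (t : ℤ) :
    TendstoInMeasure P (fun j ω => approxState θ (j * N) (past ε t ω)) atTop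
      (state p q X σ t) := by
  rw [tendstoInMeasure_iff_norm]
  intro δ hδ
  refine ENNReal.tendsto_atTop_zero.2 fun η hη => ?_
  obtain ⟨η', hη'0, hη'⟩ : ∃ η' : ℝ, 0 < η' ∧ ENNReal.ofReal η' ≤ η / 2 := by
    rcases eq_or_ne η ⊤ with h | h
    · exact ⟨1, one_pos, by simp [h, ENNReal.top_div]⟩
    · refine ⟨(η / 2).toReal, ENNReal.toReal_pos ?_ ?_, ENNReal.ofReal_toReal_le⟩
      · simpa using hη.ne'
      · exact (ENNReal.div_lt_top h (by simp)).ne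
  obtain ⟨K, hK⟩ := exists_measure_lt_abs_le (P := P) (hX.measurable_state 0).norm hη'0
  obtain ⟨K, hK0, hK⟩ : ∃ K : ℝ, 0 < K ∧ P {ω | K < ‖state p q X σ 0 ω‖} ≤ η / 2 := by
    refine ⟨max K 1, by positivity, le_trans (measure_mono fun ω hω => ?_) (hK.trans hη')⟩
    have h1 : max K 1 < ‖state p q X σ 0 ω‖ := hω
    change K < |‖state p q X σ 0 ω‖|
    rw [abs_norm]
    exact (le_max_left _ _).trans_lt h1
  set lam := ∫⁻ x, ENNReal.ofReal (‖blockProd θ N x‖ ^ s) ∂(pastLaw ε P) with hlam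
  set C := ENNReal.ofReal (‖(1 : Matrix (Fin q ⊕ Fin p) (Fin q ⊕ Fin p) ℝ)‖ ^ s) with hC
  set a : ENNReal := ENNReal.ofReal ((δ / K) ^ s) with ha
  have ha0 : a ≠ 0 := by
    rw [ha]
    simp only [ne_eq, ENNReal.ofReal_eq_zero, not_le]
    positivity
  have hlim : Tendsto (fun j : ℕ => C * lam ^ j / a) atTop (𝓝 0) := by
    have h1 := ENNReal.Tendsto.const_mul (a := C)
      (ENNReal.tendsto_pow_atTop_nhds_zero_of_lt_one hN) (Or.inr (by simp [hC]))
    have h2 := ENNReal.Tendsto.div_const h1 (b := a) (Or.inr ha0)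
    simpa using h2
  obtain ⟨j0, hj0⟩ := ENNReal.tendsto_atTop_zero.1 hlim (η / 2) (by simpa using hη.ne')
  refine ⟨j0, fun j hj => ?_⟩
  have hdet : {ω | δ ≤ ‖approxState θ (j * N) (past ε t ω) - state p q X σ t ω‖}
      ≤ᵐ[P] ({ω | K < ‖state p q X σ (t - (j * N : ℕ)) ω‖}
        ∪ {ω | δ / K ≤ ‖blockProd θ (j * N) (past ε t ω)‖} : Set Ω) := by
    filter_upwards [hX.state_iterate (j * N) t] with ω h1 (h2 : δ ≤ _)
    rw [h1, sub_add_cancel_left, norm_neg] at h2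
    have h3 := h2.trans (Matrix.linfty_opNorm_mulVec _ _)
    by_cases h4 : K < ‖state p q X σ (t - (j * N : ℕ)) ω‖
    · exact Or.inl h4
    · refine Or.inr ?_
      change δ / K ≤ _
      rw [div_le_iff₀ hK0]
      exact h3.trans (mul_le_mul_of_nonneg_left (not_lt.1 h4) (norm_nonneg _))
  refine (measure_mono_ae hdet).trans ((measure_union_le _ _).trans ?_)
  rw [← ENNReal.add_halves η]
  refine add_le_add ?_ ?_
  · have h1 := (hX.identDistrib_state (t - (j * N : ℕ))).measure_mem_eq
      (s := {y | K < ‖y‖}) (measurableSet_lt measurable_const measurable_norm)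
    exact (le_of_eq h1).trans hK
  · have h1 : ∫⁻ ω, ENNReal.ofReal (‖blockProd θ (j * N) (past ε t ω)‖ ^ s) ∂P ≤ C * lam ^ j := by
      rw [(hε.measurePreserving_past t).lintegral_comp
        (f := fun x => ENNReal.ofReal (‖blockProd θ (j * N) x‖ ^ s))
        ((measurable_norm_blockProd θ (j * N)).pow_const s).ennreal_ofReal]
      exact lintegral_blockProd_mul_le hε hs.le j
    have h2 := meas_ge_le_lintegral_div (μ := P)
      (f := fun ω => ENNReal.ofReal (‖blockProd θ (j * N) (past ε t ω)‖ ^ s))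
      ((((measurable_norm_blockProd θ (j * N)).comp (hε.measurable_past t)).pow_const
        s).ennreal_ofReal).aemeasurable ha0 ENNReal.ofReal_ne_top
    refine le_trans (measure_mono fun ω hω => ?_)
      (h2.trans ((ENNReal.div_le_div_right h1 a).trans (hj0 j hj)))
    have h3 : δ / K ≤ ‖blockProd θ (j * N) (past ε t ω)‖ := hω
    exact ENNReal.ofReal_le_ofReal (Real.rpow_le_rpow (by positivity) h3 hs.le)

/-- Under the Bougerol–Picard condition the state is a function of the past innovations, with a
finite fractional moment. -/
theorem IsStationarySolution.exists_causal_state [IsProbabilityMeasure P]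
    (hε : IsInnovation ε P) (hγ : topLyapunov θ ε P < 0)
    (hX : IsStationarySolution θ ε X σ P) :
    ∃ G : (ℕ → ℝ) → Fin q ⊕ Fin p → ℝ, Measurable G ∧
      (∀ t, ∀ᵐ ω ∂P, state p q X σ t ω = G (past ε t ω)) ∧
      ∃ s : ℝ, 0 < s ∧ s ≤ 1 ∧ ∫⁻ x, ENNReal.ofReal (‖G x‖ ^ s) ∂(pastLaw ε P) < ⊤ := by
  obtain ⟨N, s, hs0, hs1, hN⟩ := exists_contraction hε hγ
  have hconv := hX.tendstoInMeasure_approxState hε hs0 hN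
  -- An almost surely convergent subsequence at time 0 defines G on the space of sequences. Since
  -- all pasts have the same law, the same subsequence converges to G(past_t) at every t, and
  -- uniqueness of limits in measure identifies this with the state.
  obtain ⟨ns, hns, hae⟩ := (hconv 0).exists_seq_tendsto_ae
  have hmeas : ∀ n : ℕ, Measurable (approxState θ (ns n * N)) := fun n =>
    measurable_approxState θ _
  have hex : ∀ᵐ x ∂(pastLaw ε P), ∃ l, Tendsto (fun n => approxState θ (ns n * N) x) atTop
      (𝓝 l) := by
    rw [pastLaw, ae_map_iff (hε.measurable_past 0).aemeasurable
      (measurableSet_exists_tendsto hmeas)]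
    filter_upwards [hae] with ω hω using ⟨_, hω⟩
  obtain ⟨G, hG, hlim⟩ := measurable_limit_of_tendsto_metrizable_ae
    (fun n => (hmeas n).aemeasurable) hex
  refine ⟨G, hG, fun t => ?_, s, hs0, hs1, ?_⟩
  · have h1 := (hconv t).comp hns.tendsto_atTop
    have h2 : TendstoInMeasure P ((fun j ω => approxState θ (j * N) (past ε t ω)) ∘ ns) atTop
        (fun ω => G (past ε t ω)) := by
      refine tendstoInMeasure_of_tendsto_ae (fun n => ?_) ?_
      · exact ((hmeas n).comp (hε.measurable_past t)).aestronglyMeasurable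
      · exact (hε.measurePreserving_past t).quasiMeasurePreserving.ae hlim
    exact tendstoInMeasure_ae_unique h1 h2
  · set b := ∫⁻ x, ENNReal.ofReal (‖approxState θ N x‖ ^ s) ∂(pastLaw ε P) with hb
    set lam := ∫⁻ x, ENNReal.ofReal (‖blockProd θ N x‖ ^ s) ∂(pastLaw ε P) with hlam
    have := hε.isProbabilityMeasure_pastLaw
    have hbfin : b < ⊤ := by
      refine lt_of_le_of_lt (lintegral_mono (g := fun x => 1 + ENNReal.ofReal ‖approxState θ N x‖)
        fun x => ?_) ?_
      · beta_reduce
        rw [← ENNReal.ofReal_one, ← ENNReal.ofReal_add zero_le_one (norm_nonneg _)]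
        refine ENNReal.ofReal_le_ofReal ?_
        have h := rpow_one_add_le_one_add_mul_self (s := ‖approxState θ N x‖)
          (by linarith [norm_nonneg (approxState θ N x)]) hs0.le hs1
        have h' : ‖approxState θ N x‖ ^ s ≤ (1 + ‖approxState θ N x‖) ^ s :=
          Real.rpow_le_rpow (norm_nonneg _) (by linarith) hs0.le
        nlinarith [norm_nonneg (approxState θ N x)]
      · rw [lintegral_add_left measurable_const]
        simpa using lintegral_norm_approxState_lt_top hε N
    have hbound : ∀ n, ∫⁻ x, ENNReal.ofReal (‖approxState θ (ns n * N) x‖ ^ s) ∂(pastLaw ε P)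
        ≤ b * (1 - lam)⁻¹ := by
      intro n
      refine (lintegral_approxState_mul_le hε hs0 hs1 (ns n)).trans (mul_le_mul_right ?_ _)
      rw [← ENNReal.tsum_geometric]
      exact ENNReal.sum_le_tsum _
    -- Fatou's lemma: the approximations have s-th moments bounded by a full geometric series.
    have hfat : ∫⁻ x, ENNReal.ofReal (‖G x‖ ^ s) ∂(pastLaw ε P) ≤ b * (1 - lam)⁻¹ := by
      calc ∫⁻ x, ENNReal.ofReal (‖G x‖ ^ s) ∂(pastLaw ε P)
          = ∫⁻ x, liminf (fun n => ENNReal.ofReal (‖approxState θ (ns n * N) x‖ ^ s)) atTop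
              ∂(pastLaw ε P) := by
            refine lintegral_congr_ae ?_
            filter_upwards [hlim] with x hx
            refine (Tendsto.liminf_eq ?_).symm
            exact ENNReal.tendsto_ofReal (hx.norm.rpow_const (Or.inr hs0.le))
        _ ≤ liminf (fun n => ∫⁻ x, ENNReal.ofReal (‖approxState θ (ns n * N) x‖ ^ s)
              ∂(pastLaw ε P)) atTop :=
            lintegral_liminf_le fun n => ((hmeas n).norm.pow_const s).ennreal_ofReal
        _ ≤ liminf (fun _ : ℕ => b * (1 - lam)⁻¹) atTop :=
            liminf_le_liminf (Eventually.of_forall hbound)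
        _ = b * (1 - lam)⁻¹ := by simp
    refine lt_of_le_of_lt hfat (ENNReal.mul_lt_top hbfin ?_)
    rw [ENNReal.inv_lt_top]
    exact tsub_pos_of_lt hN

end Causality

end GARCH

namespace GARCH

/-! ### Size and Taylor expansion of the coefficients c_i -/

section Coefficients

variable {p q : ℕ}

lemma coeff_zero (u : Param p q) :
    coeff u 0 = u (Sum.inl 0) / (1 - ∑ j : Fin q, u (Sum.inr j)) := by
  rw [coeff]

lemma coeff_succ (u : Param p q) (i : ℕ) :
    coeff u (i + 1) = (if h : i + 1 < p + 1 then u (Sum.inl ⟨i + 1, h⟩) else 0) +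
      ∑ j : Fin q, if (j : ℕ) < i then u (Sum.inr j) * coeff u (i - j) else 0 := by
  rw [coeff]
  simp

/-- The derivative of `u ↦ c_i(u)` at `θ` in the direction `d`. -/
noncomputable def coeffDeriv (θ d : Param p q) : ℕ → ℝ
  | 0 => d (Sum.inl 0) / (1 - ∑ j : Fin q, θ (Sum.inr j))
      + θ (Sum.inl 0) * (∑ j : Fin q, d (Sum.inr j)) / (1 - ∑ j : Fin q, θ (Sum.inr j)) ^ 2
  | i + 1 =>
      (if h : i + 1 < p + 1 then d (Sum.inl ⟨i + 1, h⟩) else 0) +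
        ∑ j : Fin q, if _h : (j : ℕ) < i then
          d (Sum.inr j) * coeff θ (i - j) + θ (Sum.inr j) * coeffDeriv θ d (i - j) else 0
termination_by i => i
decreasing_by omega

lemma coeffDeriv_zero (θ d : Param p q) :
    coeffDeriv θ d 0 = d (Sum.inl 0) / (1 - ∑ j : Fin q, θ (Sum.inr j))
      + θ (Sum.inl 0) * (∑ j : Fin q, d (Sum.inr j))
        / (1 - ∑ j : Fin q, θ (Sum.inr j)) ^ 2 := by
  rw [coeffDeriv]

lemma coeffDeriv_succ (θ d : Param p q) (i : ℕ) :
    coeffDeriv θ d (i + 1) = (if h : i + 1 < p + 1 then d (Sum.inl ⟨i + 1, h⟩) else 0) +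
      ∑ j : Fin q, if (j : ℕ) < i then
        d (Sum.inr j) * coeff θ (i - j) + θ (Sum.inr j) * coeffDeriv θ d (i - j) else 0 := by
  rw [coeffDeriv]
  simp

lemma coeffDeriv_add (θ d d' : Param p q) (i : ℕ) :
    coeffDeriv θ (d + d') i = coeffDeriv θ d i + coeffDeriv θ d' i := by
  induction i using Nat.strong_induction_on with
  | _ i ih =>
    rcases i with _ | i
    · simp only [coeffDeriv_zero, Pi.add_apply, Finset.sum_add_distrib]
      ring
    · simp only [coeffDeriv_succ, Pi.add_apply]
      rw [add_add_add_comm, ← Finset.sum_add_distrib]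
      congr 1
      · split_ifs <;> simp
      · refine Finset.sum_congr rfl fun j _ => ?_
        split_ifs with h
        · rw [ih (i - j) (by omega)]
          ring
        · simp

lemma coeffDeriv_smul (θ : Param p q) (a : ℝ) (d : Param p q) (i : ℕ) :
    coeffDeriv θ (a • d) i = a * coeffDeriv θ d i := by
  induction i using Nat.strong_induction_on with
  | _ i ih =>
    rcases i with _ | i
    · simp only [coeffDeriv_zero, Pi.smul_apply, smul_eq_mul, ← Finset.mul_sum]
      ring
    · simp only [coeffDeriv_succ, Pi.smul_apply, smul_eq_mul]
      rw [mul_add, Finset.mul_sum]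
      congr 1
      · split_ifs <;> simp
      · refine Finset.sum_congr rfl fun j _ => ?_
        split_ifs with h
        · rw [ih (i - j) (by omega)]
          ring
        · simp

/-- Linearity in d. It separates the random increment Δ from the coordinate derivatives, which
depend only on θ and hence lead to stationary functionals. -/
lemma coeffDeriv_eq_sum (θ d : Param p q) (i : ℕ) :
    coeffDeriv θ d i = ∑ l, d l * coeffDeriv θ (Pi.single l 1) i := by
  let L : Param p q →ₗ[ℝ] ℝ :=
    { toFun := fun d => coeffDeriv θ d i
      map_add' := fun d d' => coeffDeriv_add θ d d' i
      map_smul' := fun a d => coeffDeriv_smul θ a d i }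
  have h := L.pi_apply_eq_sum_univ d
  simp only [L, LinearMap.coe_mk, AddHom.coe_mk, smul_eq_mul] at h
  rw [h]
  refine Finset.sum_congr rfl fun l _ => ?_
  congr 2
  funext j
  simp [Pi.single_apply, eq_comm]

variable {θ : Param p q}

lemma coeff_succ_nonneg (hθ : ∀ l, 0 ≤ θ l) (i : ℕ) : 0 ≤ coeff θ (i + 1) := by
  induction i using Nat.strong_induction_on with
  | _ i ih =>
    rw [coeff_succ]
    refine add_nonneg ?_ (Finset.sum_nonneg fun j _ => ?_)
    · split_ifs
      · exact hθ _
      · exact le_rfl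
    · split_ifs with h
      · have := ih (i - j - 1) (by omega)
        rw [show i - j - 1 + 1 = i - (j : ℕ) by omega] at this
        exact mul_nonneg (hθ _) this
      · exact le_rfl

/-- If each coordinate of the increment is at most `κ` times that of `θ`, then the increments of
the coefficients and of their first order Taylor expansions are controlled. -/
lemma coeff_taylor (hθ : ∀ l, 0 ≤ θ l) {d : Param p q} {κ : ℝ} (hκ : 0 ≤ κ)
    (hd : ∀ l, |d l| ≤ κ * θ l) (i : ℕ) :
    |coeff (θ + d) (i + 1) - coeff θ (i + 1)|
        ≤ (i + 1 : ℕ) * κ * (1 + κ) ^ (i + 1) * coeff θ (i + 1) ∧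
    |coeffDeriv θ d (i + 1)| ≤ (i + 1 : ℕ) * κ * coeff θ (i + 1) ∧
    |coeff (θ + d) (i + 1) - coeff θ (i + 1) - coeffDeriv θ d (i + 1)|
        ≤ ((i + 1 : ℕ) * κ) ^ 2 * (1 + κ) ^ (i + 1) * coeff θ (i + 1) := by
  induction i using Nat.strong_induction_on with
  | _ i ih =>
    have hc := coeff_succ_nonneg hθ
    have h1κ : (1 : ℝ) ≤ 1 + κ := by linarith
    have hi1 : (1 : ℝ) ≤ (i + 1 : ℕ) := by exact_mod_cast Nat.succ_le_succ (Nat.zero_le i)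
    have hpow1 : (1 : ℝ) ≤ (1 + κ) ^ (i + 1) := one_le_pow₀ h1κ
    set s : ℝ := if h : i + 1 < p + 1 then θ (Sum.inl ⟨i + 1, h⟩) else 0 with hs
    set ds : ℝ := if h : i + 1 < p + 1 then d (Sum.inl ⟨i + 1, h⟩) else 0 with hds
    have hs0 : 0 ≤ s := by rw [hs]; split_ifs; exacts [hθ _, le_rfl]
    have hdss : |ds| ≤ κ * s := by
      rw [hs, hds]
      split_ifs
      · exact hd _
      · simp
    have hsum : (if h : i + 1 < p + 1 then (θ + d) (Sum.inl ⟨i + 1, h⟩) else 0) = s + ds := by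
      rw [hs, hds]
      split_ifs <;> simp
    set T : Fin q → ℝ := fun j => if (j : ℕ) < i then θ (Sum.inr j) * coeff θ (i - j) else 0
      with hT
    have hT0 : ∀ j, 0 ≤ T j := by
      intro j
      simp only [hT]
      split_ifs with h
      · have := hc (i - j - 1)
        rw [show i - j - 1 + 1 = i - (j : ℕ) by omega] at this
        exact mul_nonneg (hθ _) this
      · exact le_rfl
    have hcoef : coeff θ (i + 1) = s + ∑ j, T j := coeff_succ θ i
    -- All lags i - j are at most i, one less than the index being treated. The unit gained, from i
    -- to i + 1 in the prefactor and in the exponent of 1 + κ, pays for perturbing the factor t_j.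
    have hih : ∀ j : Fin q, (j : ℕ) < i → 0 ≤ coeff θ (i - j) ∧
        |coeff (θ + d) (i - j) - coeff θ (i - j)|
          ≤ (i : ℝ) * κ * (1 + κ) ^ i * coeff θ (i - j) ∧
        |coeffDeriv θ d (i - j)| ≤ (i : ℝ) * κ * coeff θ (i - j) ∧
        |coeff (θ + d) (i - j) - coeff θ (i - j) - coeffDeriv θ d (i - j)|
          ≤ ((i : ℝ) * κ) ^ 2 * (1 + κ) ^ i * coeff θ (i - j) := by
      intro j hj
      obtain ⟨h1, h2, h3⟩ := ih (i - j - 1) (by omega)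
      have h0 := hc (i - j - 1)
      rw [show i - j - 1 + 1 = i - (j : ℕ) by omega] at h0 h1 h2 h3
      have hle : ((i - (j : ℕ) : ℕ) : ℝ) ≤ i := by exact_mod_cast Nat.sub_le _ _
      have hpow : (1 + κ) ^ (i - (j : ℕ)) ≤ (1 + κ) ^ i :=
        pow_le_pow_right₀ h1κ (Nat.sub_le _ _)
      refine ⟨h0, h1.trans ?_, h2.trans ?_, h3.trans ?_⟩
      · gcongr
      · gcongr
      · gcongr
    refine ⟨?_, ?_, ?_⟩
    · rw [coeff_succ (θ + d), hsum, hcoef, add_sub_add_comm, ← Finset.sum_sub_distrib,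
        add_sub_cancel_left, mul_add]
      refine (abs_add_le _ _).trans (add_le_add ?_ ((Finset.abs_sum_le_sum_abs _ _).trans ?_))
      · calc |ds| ≤ 1 * κ * 1 * s := by linarith
          _ ≤ _ := by gcongr
      · rw [Finset.mul_sum]
        refine Finset.sum_le_sum fun j _ => ?_
        simp only [hT]
        split_ifs with h
        · obtain ⟨h0, h1, -, -⟩ := hih j h
          have e : (θ + d) (Sum.inr j) * coeff (θ + d) (i - j) - θ (Sum.inr j) * coeff θ (i - j)
              = d (Sum.inr j) * coeff θ (i - j)
                + (θ (Sum.inr j) + d (Sum.inr j))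
                  * (coeff (θ + d) (i - j) - coeff θ (i - j)) := by
            simp only [Pi.add_apply]; ring
          have hu : |θ (Sum.inr j) + d (Sum.inr j)| ≤ (1 + κ) * θ (Sum.inr j) := by
            refine (abs_add_le _ _).trans ?_
            rw [abs_of_nonneg (hθ _)]
            linarith [hd (Sum.inr j)]
          rw [e]
          calc _ ≤ |d (Sum.inr j) * coeff θ (i - j)| + |(θ (Sum.inr j) + d (Sum.inr j))
                  * (coeff (θ + d) (i - j) - coeff θ (i - j))| := abs_add_le _ _
            _ ≤ κ * θ (Sum.inr j) * coeff θ (i - j) + ((1 + κ) * θ (Sum.inr j))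
                  * ((i : ℝ) * κ * (1 + κ) ^ i * coeff θ (i - j)) := by
                rw [abs_mul, abs_mul, abs_of_nonneg h0]
                have := hθ (Sum.inr j)
                exact add_le_add (mul_le_mul_of_nonneg_right (hd _) h0)
                  (mul_le_mul hu h1 (abs_nonneg _) (by positivity))
            _ = (1 + (i : ℝ) * (1 + κ) ^ (i + 1)) * (κ * (θ (Sum.inr j) * coeff θ (i - j))) := by
                ring
            _ ≤ ((1 + κ) ^ (i + 1) + (i : ℝ) * (1 + κ) ^ (i + 1))
                  * (κ * (θ (Sum.inr j) * coeff θ (i - j))) := by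
                have := mul_nonneg hκ (mul_nonneg (hθ (Sum.inr j)) h0)
                gcongr
            _ = _ := by push_cast; ring
        · simp
    · rw [coeffDeriv_succ, hcoef, ← hds, mul_add]
      refine (abs_add_le _ _).trans (add_le_add ?_ ((Finset.abs_sum_le_sum_abs _ _).trans ?_))
      · calc |ds| ≤ 1 * κ * s := by linarith
          _ ≤ _ := by gcongr
      · rw [Finset.mul_sum]
        refine Finset.sum_le_sum fun j _ => ?_
        simp only [hT]
        split_ifs with h
        · obtain ⟨h0, -, h2, -⟩ := hih j h
          refine (abs_add_le _ _).trans ?_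
          rw [abs_mul, abs_mul, abs_of_nonneg h0, abs_of_nonneg (hθ _)]
          have h3 := mul_le_mul_of_nonneg_right (hd (Sum.inr j)) h0
          have h4 := mul_le_mul_of_nonneg_left h2 (hθ (Sum.inr j))
          push_cast
          nlinarith
        · simp
    · rw [coeff_succ (θ + d), hsum, coeffDeriv_succ, ← hds, hcoef]
      have e1 : s + ds + (∑ j : Fin q, if (j : ℕ) < i then
            (θ + d) (Sum.inr j) * coeff (θ + d) (i - j) else 0) - (s + ∑ j, T j)
          - (ds + ∑ j : Fin q, if (j : ℕ) < i then
            d (Sum.inr j) * coeff θ (i - j) + θ (Sum.inr j) * coeffDeriv θ d (i - j) else 0)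
          = ∑ j : Fin q, ((if (j : ℕ) < i then
            (θ + d) (Sum.inr j) * coeff (θ + d) (i - j) else 0) - T j
            - if (j : ℕ) < i then
            d (Sum.inr j) * coeff θ (i - j) + θ (Sum.inr j) * coeffDeriv θ d (i - j) else 0) := by
        rw [Finset.sum_sub_distrib, Finset.sum_sub_distrib]
        ring
      rw [e1, mul_add, Finset.mul_sum]
      refine le_trans ((Finset.abs_sum_le_sum_abs _ _).trans (Finset.sum_le_sum fun j _ => ?_))
        (le_add_of_nonneg_left (by positivity))
      simp only [hT]
      split_ifs with h
      · obtain ⟨h0, h1, -, h3⟩ := hih j h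
        have e : (θ + d) (Sum.inr j) * coeff (θ + d) (i - j) - θ (Sum.inr j) * coeff θ (i - j)
            - (d (Sum.inr j) * coeff θ (i - j) + θ (Sum.inr j) * coeffDeriv θ d (i - j))
            = θ (Sum.inr j) * (coeff (θ + d) (i - j) - coeff θ (i - j) - coeffDeriv θ d (i - j))
              + d (Sum.inr j) * (coeff (θ + d) (i - j) - coeff θ (i - j)) := by
          simp only [Pi.add_apply]; ring
        rw [e]
        have hti := hθ (Sum.inr j)
        have hA : 0 ≤ θ (Sum.inr j) * coeff θ (i - j) := mul_nonneg hti h0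
        have hi0 : (0 : ℝ) ≤ i := Nat.cast_nonneg i
        calc _ ≤ |θ (Sum.inr j)
                * (coeff (θ + d) (i - j) - coeff θ (i - j) - coeffDeriv θ d (i - j))|
              + |d (Sum.inr j) * (coeff (θ + d) (i - j) - coeff θ (i - j))| := abs_add_le _ _
          _ ≤ θ (Sum.inr j) * (((i : ℝ) * κ) ^ 2 * (1 + κ) ^ i * coeff θ (i - j))
              + (κ * θ (Sum.inr j)) * ((i : ℝ) * κ * (1 + κ) ^ i * coeff θ (i - j)) := by
              rw [abs_mul, abs_mul, abs_of_nonneg hti]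
              exact add_le_add (mul_le_mul_of_nonneg_left h3 hti)
                (mul_le_mul (hd _) h1 (abs_nonneg _) (by positivity))
          _ = ((i : ℝ) ^ 2 + i) * (κ ^ 2 * (1 + κ) ^ i * (θ (Sum.inr j) * coeff θ (i - j))) := by
              ring
          _ ≤ ((i : ℝ) + 1) ^ 2
              * (κ ^ 2 * (1 + κ) ^ (i + 1) * (θ (Sum.inr j) * coeff θ (i - j))) := by
              have : (1 + κ) ^ i ≤ (1 + κ) ^ (i + 1) := pow_le_pow_right₀ h1κ (Nat.le_succ i)
              gcongr
              nlinarith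
          _ = _ := by push_cast; ring
      · simp

/-- The coefficient c_0 is a quotient outside the recursion. The restriction κ ≤ b/2 keeps the
perturbed denominator above b/2. -/
lemma coeff_zero_taylor (hθ : ∀ l, 0 ≤ θ l) {b : ℝ} (hb : 0 < b)
    (hsum : ∑ j : Fin q, θ (Sum.inr j) = 1 - b) {d : Param p q} {κ : ℝ} (hκ : 0 ≤ κ)
    (hκb : κ ≤ b / 2) (hd : ∀ l, |d l| ≤ κ * θ l) :
    |coeff (θ + d) 0 - coeff θ 0| ≤ 4 / b * κ * coeff θ 0 ∧
    |coeffDeriv θ d 0| ≤ 4 / b * κ * coeff θ 0 ∧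
    |coeff (θ + d) 0 - coeff θ 0 - coeffDeriv θ d 0| ≤ 4 / b ^ 2 * κ ^ 2 * coeff θ 0 := by
  set s := θ (Sum.inl 0) with hs
  set e := d (Sum.inl 0) with he
  set β := ∑ j : Fin q, d (Sum.inr j) with hβ
  have hs0 : 0 ≤ s := hθ _
  have hes : |e| ≤ κ * s := hd _
  have hb1 : b ≤ 1 := by
    have : 0 ≤ ∑ j : Fin q, θ (Sum.inr j) := Finset.sum_nonneg fun j _ => hθ _
    linarith
  have hβκ : |β| ≤ κ := by
    calc |β| ≤ ∑ j : Fin q, κ * θ (Sum.inr j) :=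
          (Finset.abs_sum_le_sum_abs _ _).trans (Finset.sum_le_sum fun j _ => hd _)
      _ = κ * (1 - b) := by rw [← Finset.mul_sum, hsum]
      _ ≤ κ := by nlinarith
  have hb' : b / 2 ≤ b - β := by linarith [le_abs_self β]
  have hb'0 : 0 < b - β := by linarith
  have h1 : coeff θ 0 = s / b := by rw [coeff_zero, hsum]; congr 1; ring
  have h2 : coeff (θ + d) 0 = (s + e) / (b - β) := by
    rw [coeff_zero]
    simp only [Pi.add_apply, Finset.sum_add_distrib, hsum]
    congr 1
    rw [← hβ]
    ring
  have h3 : coeffDeriv θ d 0 = e / b + s * β / b ^ 2 := by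
    rw [coeffDeriv_zero, hsum, sub_sub_cancel]
  rw [h1, h2, h3]
  refine ⟨?_, ?_, ?_⟩
  · have h4 : (s + e) / (b - β) - s / b = (e * b + s * β) / (b * (b - β)) := by
      field_simp; ring
    rw [h4, abs_div, abs_of_pos (mul_pos hb hb'0), div_le_iff₀ (mul_pos hb hb'0)]
    have h5 : |e * b + s * β| ≤ 2 * (κ * s) := by
      refine (abs_add_le _ _).trans ?_
      rw [abs_mul, abs_mul, abs_of_nonneg hs0, abs_of_pos hb]
      nlinarith [abs_nonneg e, abs_nonneg β]
    refine h5.trans ?_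
    have h6 : 4 / b * κ * (s / b) * (b * (b - β)) = 4 * (κ * s) * ((b - β) / b) := by
      field_simp
    rw [h6]
    have h7 : 1 / 2 ≤ (b - β) / b := by rw [le_div_iff₀ hb]; linarith
    nlinarith [mul_nonneg hκ hs0]
  · have h4 : e / b + s * β / b ^ 2 = (e * b + s * β) / b ^ 2 := by field_simp
    rw [h4, abs_div, abs_of_pos (pow_pos hb 2), div_le_iff₀ (pow_pos hb 2)]
    have h5 : |e * b + s * β| ≤ 2 * (κ * s) := by
      refine (abs_add_le _ _).trans ?_
      rw [abs_mul, abs_mul, abs_of_nonneg hs0, abs_of_pos hb]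
      nlinarith [abs_nonneg e, abs_nonneg β]
    refine h5.trans ?_
    have h6 : 4 / b * κ * (s / b) * b ^ 2 = 4 * (κ * s) := by field_simp
    rw [h6]
    nlinarith [mul_nonneg hκ hs0]
  · have h4 : (s + e) / (b - β) - s / b - (e / b + s * β / b ^ 2)
        = (e * b * β + s * β ^ 2) / (b ^ 2 * (b - β)) := by
      field_simp; ring
    rw [h4, abs_div, abs_of_pos (mul_pos (pow_pos hb 2) hb'0),
      div_le_iff₀ (mul_pos (pow_pos hb 2) hb'0)]
    have h5 : |e * b * β + s * β ^ 2| ≤ 2 * (κ ^ 2 * s) := by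
      refine (abs_add_le _ _).trans ?_
      rw [abs_mul, abs_mul, abs_mul, abs_of_nonneg hs0, abs_of_pos hb, abs_pow]
      have h6 : |e| * b ≤ κ * s := by nlinarith [abs_nonneg e]
      have h7 : |e| * b * |β| ≤ κ * s * κ :=
        mul_le_mul h6 hβκ (abs_nonneg _) (mul_nonneg hκ hs0)
      have h8 : |β| ^ 2 ≤ κ ^ 2 := pow_le_pow_left₀ (abs_nonneg _) hβκ 2
      nlinarith [mul_le_mul_of_nonneg_left h8 hs0]
    refine h5.trans ?_
    have h6 : 4 / b ^ 2 * κ ^ 2 * (s / b) * (b ^ 2 * (b - β))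
        = 4 * (κ ^ 2 * s) * ((b - β) / b) := by
      field_simp
    rw [h6]
    have h7 : 1 / 2 ≤ (b - β) / b := by rw [le_div_iff₀ hb]; linarith
    nlinarith [mul_nonneg (sq_nonneg κ) hs0]

/-- Taylor expansion of the coefficients, uniformly up to an arbitrarily small exponential
factor. -/
lemma exists_coeff_taylor {lo b ψ : ℝ} (hlo : 0 < lo) (hθ : ∀ l, lo ≤ θ l) (hb : 0 < b)
    (hsum : ∑ j : Fin q, θ (Sum.inr j) = 1 - b) (hψ : 1 < ψ) :
    ∃ C κ₀ : ℝ, 0 < C ∧ 0 < κ₀ ∧ ∀ d : Param p q, ‖d‖ ≤ κ₀ → ∀ i,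
      |coeff (θ + d) i - coeff θ i| ≤ C * ‖d‖ * ψ ^ i * coeff θ i ∧
      |coeffDeriv θ d i| ≤ C * ‖d‖ * ψ ^ i * coeff θ i ∧
      |coeff (θ + d) i - coeff θ i - coeffDeriv θ d i| ≤ C * ‖d‖ ^ 2 * ψ ^ i * coeff θ i := by
  have hθ0 : ∀ l, 0 ≤ θ l := fun l => hlo.le.trans (hθ l)
  -- One factor χ^i absorbs the polynomial factor i², the other absorbs (1 + κ)^i.
  set χ := √ψ with hχ
  have hχ1 : 1 < χ := by rw [hχ]; exact Real.lt_sqrt_of_sq_lt (by simpa using hψ)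
  have hχψ : χ * χ = ψ := Real.mul_self_sqrt (by linarith)
  obtain ⟨D, hD0, hD⟩ : ∃ D : ℝ, 0 < D ∧ ∀ i : ℕ, (i : ℝ) ^ 2 ≤ D * χ ^ i := by
    have h1 := tendsto_pow_const_div_const_pow_of_one_lt 2 hχ1
    obtain ⟨D, hD⟩ := h1.bddAbove_range
    refine ⟨max D 1, by positivity, fun i => ?_⟩
    have h2 : (i : ℝ) ^ 2 / χ ^ i ≤ D := hD ⟨i, rfl⟩
    rw [div_le_iff₀ (by positivity)] at h2
    exact h2.trans (mul_le_mul_of_nonneg_right (le_max_left _ _) (by positivity))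
  set C : ℝ := max (4 / b / lo) (max (4 / b ^ 2 / lo ^ 2) (max (D / lo) (D / lo ^ 2))) with hC
  have hC1 : 4 / b / lo ≤ C := le_max_left _ _
  have hC2 : 4 / b ^ 2 / lo ^ 2 ≤ C := (le_max_left _ _).trans (le_max_right _ _)
  have hC3 : D / lo ≤ C :=
    (le_max_left _ _).trans ((le_max_right _ _).trans (le_max_right _ _))
  have hC4 : D / lo ^ 2 ≤ C :=
    (le_max_right _ _).trans ((le_max_right _ _).trans (le_max_right _ _))
  have hC0 : 0 < C := lt_of_lt_of_le (by positivity) hC1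
  refine ⟨C, lo * min (b / 2) (χ - 1), hC0, mul_pos hlo (lt_min (by positivity) (by linarith)),
    fun d hd i => ?_⟩
  -- Every coordinate of θ is at least `lo`, so an increment of norm ‖d‖ has relative size at most
  -- ‖d‖ / lo.
  set κ := ‖d‖ / lo with hκ
  have hκ0 : 0 ≤ κ := by positivity
  have hdκ : ∀ l, |d l| ≤ κ * θ l := by
    intro l
    calc |d l| ≤ ‖d‖ := norm_le_pi_norm d l
      _ = κ * lo := by rw [hκ]; field_simp
      _ ≤ κ * θ l := mul_le_mul_of_nonneg_left (hθ l) hκ0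
  have hκmin : κ ≤ min (b / 2) (χ - 1) := by
    rw [hκ, div_le_iff₀ hlo, mul_comm]
    exact hd
  have hκb : κ ≤ b / 2 := hκmin.trans (min_le_left _ _)
  have hκχ : 1 + κ ≤ χ := by linarith [hκmin.trans (min_le_right _ _)]
  rcases i with _ | i
  · obtain ⟨h1, h2, h3⟩ := coeff_zero_taylor hθ0 hb hsum hκ0 hκb hdκ
    have hc0 : 0 ≤ coeff θ 0 := by
      rw [coeff_zero, hsum, sub_sub_cancel]
      exact div_nonneg (hθ0 _) hb.le
    have e1 : 4 / b * κ ≤ C * ‖d‖ := by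
      calc 4 / b * κ = 4 / b / lo * ‖d‖ := by rw [hκ]; ring
        _ ≤ C * ‖d‖ := mul_le_mul_of_nonneg_right hC1 (norm_nonneg _)
    have e2 : 4 / b ^ 2 * κ ^ 2 ≤ C * ‖d‖ ^ 2 := by
      calc 4 / b ^ 2 * κ ^ 2 = 4 / b ^ 2 / lo ^ 2 * ‖d‖ ^ 2 := by rw [hκ]; ring
        _ ≤ C * ‖d‖ ^ 2 := mul_le_mul_of_nonneg_right hC2 (by positivity)
    simp only [pow_zero, mul_one]
    exact ⟨h1.trans (mul_le_mul_of_nonneg_right e1 hc0),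
      h2.trans (mul_le_mul_of_nonneg_right e1 hc0), h3.trans (mul_le_mul_of_nonneg_right e2 hc0)⟩
  · obtain ⟨h1, h2, h3⟩ := coeff_taylor hθ0 hκ0 hdκ i
    have hc0 := coeff_succ_nonneg hθ0 i
    have hpow : (1 + κ) ^ (i + 1) ≤ χ ^ (i + 1) := pow_le_pow_left₀ (by positivity) hκχ _
    have hψpow : χ ^ (i + 1) * χ ^ (i + 1) = ψ ^ (i + 1) := by rw [← mul_pow, hχψ]
    have hi1 : (1 : ℝ) ≤ (i + 1 : ℕ) := by exact_mod_cast Nat.succ_le_succ (Nat.zero_le i)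
    have hi2 : ((i + 1 : ℕ) : ℝ) ≤ ((i + 1 : ℕ) : ℝ) ^ 2 := by nlinarith
    have hsq := hD (i + 1)
    have e1 : ((i + 1 : ℕ) : ℝ) * κ * (1 + κ) ^ (i + 1) ≤ C * ‖d‖ * ψ ^ (i + 1) := by
      calc ((i + 1 : ℕ) : ℝ) * κ * (1 + κ) ^ (i + 1)
          ≤ (D * χ ^ (i + 1)) * κ * χ ^ (i + 1) := by
            gcongr
            exact hi2.trans hsq
        _ = D / lo * ‖d‖ * ψ ^ (i + 1) := by rw [← hψpow, hκ]; ring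
        _ ≤ _ := by gcongr
    have e2 : ((i + 1 : ℕ) : ℝ) * κ ≤ C * ‖d‖ * ψ ^ (i + 1) := by
      refine le_trans ?_ e1
      exact le_mul_of_one_le_right (by positivity) (one_le_pow₀ (by linarith))
    have e3 : (((i + 1 : ℕ) : ℝ) * κ) ^ 2 * (1 + κ) ^ (i + 1) ≤ C * ‖d‖ ^ 2 * ψ ^ (i + 1) := by
      calc (((i + 1 : ℕ) : ℝ) * κ) ^ 2 * (1 + κ) ^ (i + 1)
          = ((i + 1 : ℕ) : ℝ) ^ 2 * κ ^ 2 * (1 + κ) ^ (i + 1) := by ring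
        _ ≤ (D * χ ^ (i + 1)) * κ ^ 2 * χ ^ (i + 1) := by gcongr
        _ = D / lo ^ 2 * ‖d‖ ^ 2 * ψ ^ (i + 1) := by rw [← hψpow, hκ]; ring
        _ ≤ _ := by gcongr
    exact ⟨h1.trans (mul_le_mul_of_nonneg_right e1 hc0),
      h2.trans (mul_le_mul_of_nonneg_right e2 hc0), h3.trans (mul_le_mul_of_nonneg_right e3 hc0)⟩

/-- The coefficients decay exponentially. -/
lemma exists_coeff_le_geometric (hθ : ∀ l, 0 ≤ θ l) (hsum : ∑ j : Fin q, θ (Sum.inr j) < 1) :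
    ∃ C r : ℝ, 0 < C ∧ 0 < r ∧ r < 1 ∧ (∑ j : Fin q, θ (Sum.inr j)) < r ^ q ∧
      ∀ i, coeff θ i ≤ C * r ^ i := by
  set ρ := ∑ j : Fin q, θ (Sum.inr j) with hρ
  have hρ0 : 0 ≤ ρ := Finset.sum_nonneg fun j _ => hθ _
  -- The recursion looks back at most q steps, each step costing a factor 1/r, so its contribution
  -- is at most ρ / r^q < 1 times the claimed bound.
  obtain ⟨r, hr0, hr1, hr⟩ : ∃ r : ℝ, 0 < r ∧ r < 1 ∧ ρ < r ^ q := by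
    have h1 : Tendsto (fun r : ℝ => r ^ q) (𝓝[<] 1) (𝓝 (1 ^ q)) :=
      ((continuous_pow q).tendsto 1).mono_left nhdsWithin_le_nhds
    have h2 : ∀ᶠ r : ℝ in 𝓝[<] 1, ρ < r ^ q := h1.eventually (lt_mem_nhds (by simpa using hsum))
    have h3 : ∀ᶠ r : ℝ in 𝓝[<] 1, r ∈ Set.Ioo (0 : ℝ) 1 :=
      Ioo_mem_nhdsLT (by norm_num)
    obtain ⟨r, h4, h5⟩ := (h2.and h3).exists
    exact ⟨r, h5.1, h5.2, h4⟩
  have hrq : 0 < r ^ q := pow_pos hr0 q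
  set lam := ρ / r ^ q with hlam
  have hlam1 : lam < 1 := by rw [hlam, div_lt_one hrq]; exact hr
  have hrp : 0 < r ^ (p + 1) := pow_pos hr0 _
  -- The recursion uses the share lam of the bound. The last summand of C makes the remaining share
  -- 1 - lam large enough for the terms s_i with i ≤ p.
  set C := |coeff θ 0| + 1 + ‖θ‖ / (r ^ (p + 1) * (1 - lam)) with hC
  have h1lam : 0 < 1 - lam := by linarith
  have hC0 : 0 < C := by positivity
  refine ⟨C, r, hC0, hr0, hr1, hr, fun i => ?_⟩
  induction i using Nat.strong_induction_on with
  | _ i ih =>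
    rcases i with _ | i
    · rw [pow_zero, mul_one, hC]
      have : 0 ≤ ‖θ‖ / (r ^ (p + 1) * (1 - lam)) := by positivity
      linarith [le_abs_self (coeff θ 0)]
    · rw [coeff_succ]
      have hri : 0 < r ^ (i + 1) := pow_pos hr0 _
      have h1 : (if h : i + 1 < p + 1 then θ (Sum.inl ⟨i + 1, h⟩) else 0)
          ≤ (1 - lam) * (C * r ^ (i + 1)) := by
        split_ifs with h
        · have h2 : r ^ (p + 1) ≤ r ^ (i + 1) := pow_le_pow_of_le_one hr0.le hr1.le h.le
          have h3 : ‖θ‖ / (r ^ (p + 1) * (1 - lam)) ≤ C := by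
            rw [hC]; linarith [abs_nonneg (coeff θ 0)]
          rw [div_le_iff₀ (by positivity)] at h3
          calc θ (Sum.inl ⟨i + 1, h⟩) ≤ ‖θ‖ := (le_abs_self _).trans (norm_le_pi_norm θ _)
            _ ≤ C * (r ^ (p + 1) * (1 - lam)) := h3
            _ ≤ C * (r ^ (i + 1) * (1 - lam)) := by gcongr
            _ = _ := by ring
        · positivity
      have h2 : (∑ j : Fin q, if (j : ℕ) < i then θ (Sum.inr j) * coeff θ (i - j) else 0)
          ≤ lam * (C * r ^ (i + 1)) := by
        calc _ ≤ ∑ j : Fin q, θ (Sum.inr j) * (C * r ^ (i + 1) / r ^ q) := by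
              refine Finset.sum_le_sum fun j _ => ?_
              split_ifs with h
              · refine mul_le_mul_of_nonneg_left ((ih (i - j) (by omega)).trans ?_) (hθ _)
                rw [le_div_iff₀ hrq, mul_assoc, ← pow_add]
                exact mul_le_mul_of_nonneg_left
                  (pow_le_pow_of_le_one hr0.le hr1.le (by omega)) hC0.le
              · exact mul_nonneg (hθ _) (by positivity)
          _ = _ := by rw [← Finset.sum_mul, hlam]; ring
      linarith

end Coefficients

end GARCH

namespace GARCH

/-! ### Almost sure convergence and integrability of random series -/

section RandomSeries

variable {Ω : Type*} [MeasurableSpace Ω] {P : Measure Ω} {ε : ℤ → Ω → ℝ}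

/-- A random power series whose coefficients have a bounded fractional moment converges almost
surely. -/
lemma ae_summable_pow_mul {α : Type*} [MeasurableSpace α] {μ : Measure α} {Z : ℕ → α → ℝ}
    (hZ : ∀ i, Measurable (Z i)) (hZ0 : ∀ i, ∀ᵐ x ∂μ, 0 ≤ Z i x) {s : ℝ} (hs : 0 < s) (hs1 : s ≤ 1)
    {M : ENNReal} (hM : M < ⊤) (hZM : ∀ i, ∫⁻ x, ENNReal.ofReal (Z i x ^ s) ∂μ ≤ M) {r : ℝ}
    (hr0 : 0 < r) (hr1 : r < 1) : ∀ᵐ x ∂μ, Summable fun i => r ^ i * Z i x := by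
  have hrs0 : 0 < r ^ s := Real.rpow_pos_of_pos hr0 s
  have hrs1 : r ^ s < 1 := Real.rpow_lt_one hr0.le hr1 hs
  have hmeas : ∀ i, Measurable fun x => ENNReal.ofReal ((r ^ s) ^ i * Z i x ^ s) := fun i =>
    (((hZ i).pow_const s).const_mul _).ennreal_ofReal
  have h1 : ∫⁻ x, ∑' i, ENNReal.ofReal ((r ^ s) ^ i * Z i x ^ s) ∂μ < ⊤ := by
    rw [lintegral_tsum fun i => (hmeas i).aemeasurable]
    calc ∑' i, ∫⁻ x, ENNReal.ofReal ((r ^ s) ^ i * Z i x ^ s) ∂μ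
        ≤ ∑' i, ENNReal.ofReal (r ^ s) ^ i * M := by
          refine ENNReal.tsum_le_tsum fun i => ?_
          simp_rw [ENNReal.ofReal_mul (pow_nonneg hrs0.le i), ENNReal.ofReal_pow hrs0.le]
          rw [lintegral_const_mul _ ((hZ i).pow_const s).ennreal_ofReal]
          exact mul_le_mul_right (hZM i) _
      _ = (1 - ENNReal.ofReal (r ^ s))⁻¹ * M := by rw [ENNReal.tsum_mul_right,
          ENNReal.tsum_geometric]
      _ < ⊤ := by
          refine ENNReal.mul_lt_top ?_ hM
          rw [ENNReal.inv_lt_top]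
          exact tsub_pos_of_lt (by simpa using hrs1)
  filter_upwards [ae_lt_top (Measurable.tsum hmeas) h1.ne, ae_all_iff.2 hZ0] with x hx hx0
  have h2 : Summable fun i => (r ^ s) ^ i * Z i x ^ s := by
    have h3 := ENNReal.summable_toReal hx.ne
    refine h3.congr fun i => ENNReal.toReal_ofReal ?_
    exact mul_nonneg (pow_nonneg hrs0.le i) (Real.rpow_nonneg (hx0 i) s)
  have h4 : ∀ i, (r ^ s) ^ i * Z i x ^ s = (r ^ i * Z i x) ^ s := by
    intro i
    rw [Real.mul_rpow (pow_nonneg hr0.le i) (hx0 i), ← Real.rpow_natCast, ← Real.rpow_natCast,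
      ← Real.rpow_mul hr0.le, ← Real.rpow_mul hr0.le, mul_comm s]
  simp_rw [h4] at h2
  have h0 : ∀ i, 0 ≤ r ^ i * Z i x := fun i => mul_nonneg (pow_nonneg hr0.le i) (hx0 i)
  -- The s-th powers are summable, so the terms are eventually at most 1; there z ≤ z^s because s ≤
  -- 1.
  refine Summable.of_norm_bounded_eventually_nat h2 ?_
  filter_upwards [h2.tendsto_atTop_zero.eventually (gt_mem_nhds one_pos)] with i hi
  rw [Real.norm_eq_abs, abs_of_nonneg (h0 i)]
  have h5 : r ^ i * Z i x ≤ 1 := by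
    by_contra hc
    exact absurd (Real.one_le_rpow (not_le.1 hc).le hs.le) (not_le.2 hi)
  rcases (h0 i).eq_or_lt with h6 | h6
  · rw [← h6, Real.zero_rpow hs.ne']
  · calc r ^ i * Z i x = (r ^ i * Z i x) ^ (1 : ℝ) := (Real.rpow_one _).symm
      _ ≤ _ := Real.rpow_le_rpow_of_exponent_ge h6 h5 hs1

lemma integrable_tsum_of_lintegral {α : Type*} [MeasurableSpace α] {μ : Measure α}
    {f : ℕ → α → ℝ} (hf : ∀ i, Measurable (f i)) (hf0 : ∀ i, ∀ᵐ x ∂μ, 0 ≤ f i x)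
    (hs : ∑' i, ∫⁻ x, ENNReal.ofReal (f i x) ∂μ < ⊤) :
    (∀ᵐ x ∂μ, Summable fun i => f i x) ∧ Integrable (fun x => ∑' i, f i x) μ := by
  have hmeas : ∀ i, Measurable fun x => ENNReal.ofReal (f i x) := fun i => (hf i).ennreal_ofReal
  rw [← lintegral_tsum fun i => (hmeas i).aemeasurable] at hs
  have hsum : ∀ᵐ x ∂μ, Summable fun i => f i x := by
    filter_upwards [ae_lt_top (Measurable.tsum hmeas) hs.ne, ae_all_iff.2 hf0]
      with x hx hx0
    exact (ENNReal.summable_toReal hx.ne).congr fun i => ENNReal.toReal_ofReal (hx0 i)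
  refine ⟨hsum, (Measurable.tsum hf).aestronglyMeasurable, ?_⟩
  have hF0 : ∀ᵐ x ∂μ, 0 ≤ ∑' i, f i x := by
    filter_upwards [ae_all_iff.2 hf0] with x h2
    exact tsum_nonneg h2
  rw [hasFiniteIntegral_iff_ofReal hF0]
  refine lt_of_le_of_lt (le_of_eq (lintegral_congr_ae ?_)) hs
  filter_upwards [hsum, ae_all_iff.2 hf0] with x h2 h3
  rw [ENNReal.ofReal_tsum_of_nonneg h3 h2]

/-- A function of the current innovation times a function of the previous ones. -/
lemma IsInnovation.integrable_mul_shift [IsProbabilityMeasure P] (hε : IsInnovation ε P)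
    {f : ℝ → ℝ} (hf : Measurable f) (hfi : Integrable (fun ω => f (ε 0 ω)) P)
    {F : (ℕ → ℝ) → ℝ} (hF : Measurable F) (hFi : Integrable F (pastLaw ε P)) :
    Integrable (fun x => f (x 0) * F fun i => x (i + 1)) (pastLaw ε P) ∧
    ∫ x, f (x 0) * F (fun i => x (i + 1)) ∂(pastLaw ε P)
      = (∫ ω, f (ε 0 ω) ∂P) * ∫ x, F x ∂(pastLaw ε P) := by
  have hmeas : Measurable fun x : ℕ → ℝ => f (x 0) * F fun i => x (i + 1) :=
    (hf.comp (measurable_pi_apply 0)).mul (hF.comp (measurable_shift 1))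
  have hind : IndepFun (fun ω => f (ε 0 ω)) (fun ω => F (past ε (0 - 1) ω)) P := by
    have h := (hε.indepFun_block_past 1 0).comp (hf.comp (measurable_pi_apply (0 : Fin 1))) hF
    simpa [Function.comp_def, past] using h
  have hm := hε.measurePreserving_past
  have hFi' : Integrable (fun ω => F (past ε (0 - 1) ω)) P :=
    (hm (0 - 1)).integrable_comp_of_integrable hFi
  have he : ∀ ω, f (past ε 0 ω 0) * F (fun i => past ε 0 ω (i + 1))
      = f (ε 0 ω) * F (past ε (0 - 1) ω) := by
    intro ω
    have := past_shift ε 0 1 ω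
    rw [this]
    simp [past]
  have h1 : ∫ x, F x ∂(pastLaw ε P) = ∫ ω, F (past ε (0 - 1) ω) ∂P := by
    rw [← hε.map_past (0 - 1), integral_map (hε.measurable_past _).aemeasurable
      hF.aestronglyMeasurable]
  constructor
  · rw [pastLaw, integrable_map_measure hmeas.aestronglyMeasurable
      (hε.measurable_past 0).aemeasurable]
    refine (hind.integrable_mul hfi hFi').congr (ae_of_all _ fun ω => ?_)
    exact (he ω).symm
  · rw [h1, ← hind.integral_fun_mul_eq_mul_integral hfi.aestronglyMeasurable
      hFi'.aestronglyMeasurable, pastLaw, integral_map (hε.measurable_past 0).aemeasurable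
      hmeas.aestronglyMeasurable]
    exact integral_congr_ae (ae_of_all _ he)

end RandomSeries

/-! ### The recursion of the coefficient series, and its uniqueness -/

section Volatility

variable {p q : ℕ} {θ : Param p q}

/-- The recursion satisfied by the series `∑ c_i y_i`. -/
lemma tsum_coeff_succ_mul (y : ℕ → ℝ)
    (hy : ∀ j : ℕ, Summable fun k => coeff θ (k + 1) * y (k + j)) :
    ∑' i, coeff θ (i + 1) * y i = ∑ i : Fin p, θ (Sum.inl i.succ) * y i
      + ∑ j : Fin q, θ (Sum.inr j) * ∑' k, coeff θ (k + 1) * y (k + (j + 1)) := by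
  have h1 : HasSum (fun i => (if h : i + 1 < p + 1 then θ (Sum.inl ⟨i + 1, h⟩) else 0) * y i)
      (∑ i : Fin p, θ (Sum.inl i.succ) * y i) := by
    have h2 := hasSum_sum_of_ne_finset_zero
      (f := fun i => (if h : i + 1 < p + 1 then θ (Sum.inl ⟨i + 1, h⟩) else 0) * y i)
      (s := Finset.range p) (L := SummationFilter.unconditional ℕ) (fun i hi => by
        rw [Finset.mem_range] at hi
        simp [hi])
    rw [Finset.sum_range] at h2
    convert h2 using 1
    refine Finset.sum_congr rfl fun i _ => ?_
    rw [dif_pos (by omega)]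
    rfl
  have h3 : ∀ j : Fin q, HasSum (fun i => (if (j : ℕ) < i then
      θ (Sum.inr j) * coeff θ (i - j) else 0) * y i)
      (θ (Sum.inr j) * ∑' k, coeff θ (k + 1) * y (k + (j + 1))) := by
    intro j
    have h4 := (hy (j + 1)).hasSum.mul_left (θ (Sum.inr j))
    rw [← hasSum_nat_add_iff' ((j : ℕ) + 1)]
    have h5 : ∑ i ∈ Finset.range ((j : ℕ) + 1), (if (j : ℕ) < i then
        θ (Sum.inr j) * coeff θ (i - j) else 0) * y i = 0 := by
      refine Finset.sum_eq_zero fun i hi => ?_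
      rw [Finset.mem_range] at hi
      rw [if_neg (by omega), zero_mul]
    rw [h5, sub_zero]
    refine h4.congr_fun fun k => ?_
    rw [if_pos (by omega), show k + ((j : ℕ) + 1) - j = k + 1 by omega, mul_assoc]
  refine ((h1.add (hasSum_sum fun j (_ : j ∈ Finset.univ) => h3 j)).congr_fun fun i => ?_).tsum_eq
  rw [coeff_succ, add_mul, Finset.sum_mul]

/-- A sequence that is dominated by an average of its past, and does not grow too fast towards
the past, vanishes. -/
lemma eq_zero_of_le_past {β : Fin q → ℝ} (hβ : ∀ j, 0 ≤ β j) {r : ℝ} (hr0 : 0 < r) (hr1 : r < 1)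
    (hβr : ∑ j, β j < r ^ q) {d : ℤ → ℝ}
    (hd : ∀ t, |d t| ≤ ∑ j : Fin q, β j * |d (t - ((j : ℕ) + 1))|) {t : ℤ} {B : ℝ}
    (hB : ∀ i : ℕ, r ^ i * |d (t - i)| ≤ B) : d t = 0 := by
  have hrq : 0 < r ^ q := pow_pos hr0 q
  -- The recursion gives S ≤ (Σ β_j / r^q) S, as each lag is at most q. The factor is below 1 and S
  -- is finite by `hB`, so S = 0.
  set S := ⨆ i : ℕ, r ^ i * |d (t - i)| with hS
  have hbdd : BddAbove (Set.range fun i : ℕ => r ^ i * |d (t - i)|) := by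
    refine ⟨B, ?_⟩
    rintro _ ⟨i, rfl⟩
    exact hB i
  have hle : ∀ i : ℕ, r ^ i * |d (t - i)| ≤ S := fun i => le_ciSup hbdd i
  have hS0 : 0 ≤ S := le_trans (by positivity) (hle 0)
  have hstep : S ≤ (∑ j, β j) / r ^ q * S := by
    refine ciSup_le fun i => ?_
    rw [div_mul_eq_mul_div, le_div_iff₀ hrq]
    calc r ^ i * |d (t - i)| * r ^ q
        ≤ r ^ i * (∑ j : Fin q, β j * |d (t - i - ((j : ℕ) + 1))|) * r ^ q := by
          gcongr
          exact hd _
      _ = ∑ j : Fin q, β j * (r ^ i * r ^ q * |d (t - i - ((j : ℕ) + 1))|) := by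
          rw [Finset.mul_sum, Finset.sum_mul]
          exact Finset.sum_congr rfl fun j _ => by ring
      _ ≤ ∑ j : Fin q, β j * S := by
          refine Finset.sum_le_sum fun j _ => mul_le_mul_of_nonneg_left ?_ (hβ j)
          refine le_trans ?_ (hle (i + (j + 1)))
          rw [pow_add r i]
          have e : t - i - (((j : ℕ) : ℤ) + 1) = t - ((i + (j + 1) : ℕ) : ℤ) := by push_cast; ring
          rw [e]
          have : r ^ q ≤ r ^ ((j : ℕ) + 1) := pow_le_pow_of_le_one hr0.le hr1.le j.2
          gcongr
      _ = _ := by rw [← Finset.sum_mul]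
  have hlt : (∑ j, β j) / r ^ q < 1 := (div_lt_one hrq).2 hβr
  have hS' : S = 0 := by nlinarith
  have := hle 0
  rw [hS', pow_zero, one_mul, Nat.cast_zero, sub_zero] at this
  exact abs_eq_zero.1 (le_antisymm this (abs_nonneg _))

end Volatility

/-! ### The ARCH(∞) representation -/

section Representation

variable {p q : ℕ} {θ : Param p q}

/-- The `ARCH(∞)` representation of the conditional variance, pathwise. -/
lemma hasSum_coeff_of_recursion (hθ : ∀ l, 0 ≤ θ l) (hsum : ∑ j : Fin q, θ (Sum.inr j) < 1)
    {C r : ℝ} (hC : 0 < C) (hr0 : 0 < r) (hr1 : r < 1)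
    (hβr : ∑ j : Fin q, θ (Sum.inr j) < r ^ q) (hcoef : ∀ i, coeff θ i ≤ C * r ^ i)
    {V Y : ℤ → ℝ} (hV0 : ∀ t, 0 ≤ V t) (hY0 : ∀ t, 0 ≤ Y t)
    (hrec : ∀ t, V t = θ (Sum.inl 0) + ∑ i : Fin p, θ (Sum.inl i.succ) * Y (t - ((i : ℤ) + 1))
      + ∑ j : Fin q, θ (Sum.inr j) * V (t - ((j : ℤ) + 1)))
    (hVs : ∀ t, Summable fun i : ℕ => r ^ i * V (t - i))
    (hYs : ∀ t, Summable fun i : ℕ => r ^ i * Y (t - i)) (t : ℤ) :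
    HasSum (fun i : ℕ => coeff θ (i + 1) * Y (t - 1 - i)) (V t - coeff θ 0) := by
  have hc0 := coeff_succ_nonneg hθ
  have hle : ∀ (t : ℤ) (i : ℕ), coeff θ (i + 1) * Y (t - i) ≤ C * (r ^ i * Y (t - i)) := by
    intro t i
    rw [← mul_assoc]
    refine mul_le_mul_of_nonneg_right ((hcoef _).trans ?_) (hY0 _)
    exact mul_le_mul_of_nonneg_left (pow_le_pow_of_le_one hr0.le hr1.le (Nat.le_succ i)) hC.le
  have hs : ∀ t, Summable fun i : ℕ => coeff θ (i + 1) * Y (t - i) := fun t =>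
    Summable.of_nonneg_of_le (fun i => mul_nonneg (hc0 i) (hY0 _)) (hle t) ((hYs t).mul_left C)
  -- The series u satisfies the same equation as V, with the same observations Y. The difference
  -- therefore satisfies the homogeneous equation in the β_j alone, and `eq_zero_of_le_past`
  -- applies.
  set u : ℤ → ℝ := fun t => coeff θ 0 + ∑' i : ℕ, coeff θ (i + 1) * Y (t - 1 - i) with hu
  have hurec : ∀ t, u t = θ (Sum.inl 0)
      + ∑ i : Fin p, θ (Sum.inl i.succ) * Y (t - ((i : ℤ) + 1))
      + ∑ j : Fin q, θ (Sum.inr j) * u (t - ((j : ℤ) + 1)) := by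
    intro t
    have e : ∀ (j k : ℕ), t - 1 - ((k + j : ℕ) : ℤ) = t - 1 - j - k := fun j k => by
      push_cast; ring
    have h1 := tsum_coeff_succ_mul (θ := θ) (fun i : ℕ => Y (t - 1 - i)) (fun j => by
      simp only [e]
      exact hs _)
    have e2 : ∀ (j k : ℕ), t - 1 - ((k + (j + 1) : ℕ) : ℤ) = t - ((j : ℤ) + 1) - 1 - k :=
      fun j k => by push_cast; ring
    have e3 : ∀ i : ℕ, t - 1 - (i : ℤ) = t - ((i : ℤ) + 1) := fun i => by ring
    simp only [e2, e3] at h1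
    have h2 : coeff θ 0 = θ (Sum.inl 0) + ∑ j : Fin q, θ (Sum.inr j) * coeff θ 0 := by
      rw [← Finset.sum_mul, coeff_zero]
      have : 1 - ∑ j : Fin q, θ (Sum.inr j) ≠ 0 := by linarith
      field_simp
      ring
    have h3 : u t = coeff θ 0 + ∑' i : ℕ, coeff θ (i + 1) * Y (t - ((i : ℤ) + 1)) := by
      simp only [hu, e3]
    rw [h3, h1]
    simp only [hu, mul_add, Finset.sum_add_distrib]
    linarith
  have hd : V t - u t = 0 := by
    refine eq_zero_of_le_past (q := q) (β := fun j => θ (Sum.inr j)) (fun j => hθ _) hr0 hr1 hβr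
      (d := fun t => V t - u t) (fun t => ?_) (t := t)
      -- The weight r^i turns the series for u at time t - i into a tail of the discounted series of
      -- Y at time t, since r^i c_{k+1} ≤ C r^{k+i+1}.
      (B := ∑' i : ℕ, r ^ i * V (t - i) + (|coeff θ 0| + C * ∑' i : ℕ, r ^ i * Y (t - i)))
      (fun i => ?_)
    · have h1 : V t - u t = ∑ j : Fin q, θ (Sum.inr j)
          * (V (t - ((j : ℤ) + 1)) - u (t - ((j : ℤ) + 1))) := by
        simp only [mul_sub, Finset.sum_sub_distrib]
        linarith [hrec t, hurec t]
      rw [h1]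
      refine (Finset.abs_sum_le_sum_abs _ _).trans (Finset.sum_le_sum fun j _ => ?_)
      rw [abs_mul, abs_of_nonneg (hθ _)]
    · have h1 : r ^ i * V (t - i) ≤ ∑' i : ℕ, r ^ i * V (t - i) :=
        (hVs t).le_tsum i fun j _ => mul_nonneg (pow_nonneg hr0.le j) (hV0 _)
      have h2 : r ^ i * ∑' k : ℕ, coeff θ (k + 1) * Y (t - i - 1 - k)
          ≤ C * ∑' m : ℕ, r ^ m * Y (t - m) := by
        have h4 : Summable fun k : ℕ => r ^ (k + (i + 1)) * Y (t - ((k + (i + 1) : ℕ) : ℤ)) :=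
          (summable_nat_add_iff (f := fun m : ℕ => r ^ m * Y (t - m)) (i + 1)).2 (hYs t)
        have h5 : ∑' k : ℕ, r ^ (k + (i + 1)) * Y (t - ((k + (i + 1) : ℕ) : ℤ))
            ≤ ∑' m : ℕ, r ^ m * Y (t - m) := by
          rw [← (hYs t).sum_add_tsum_nat_add (i + 1)]
          exact le_add_of_nonneg_left (Finset.sum_nonneg fun m _ =>
            mul_nonneg (pow_nonneg hr0.le m) (hY0 _))
        refine le_trans ?_ (mul_le_mul_of_nonneg_left h5 hC.le)
        rw [← tsum_mul_left, ← tsum_mul_left]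
        refine Summable.tsum_le_tsum (fun k => ?_) ((hs (t - i - 1)).mul_left _) (h4.mul_left C)
        have e : t - i - 1 - (k : ℤ) = t - ((k + (i + 1) : ℕ) : ℤ) := by push_cast; ring
        rw [e, ← mul_assoc, ← mul_assoc]
        refine mul_le_mul_of_nonneg_right ?_ (hY0 _)
        calc r ^ i * coeff θ (k + 1) ≤ r ^ i * (C * r ^ (k + 1)) :=
              mul_le_mul_of_nonneg_left (hcoef _) (pow_nonneg hr0.le i)
          _ = C * r ^ (k + (i + 1)) := by ring
      have h3 : r ^ i * |coeff θ 0| ≤ |coeff θ 0| :=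
        mul_le_of_le_one_left (abs_nonneg _) (pow_le_one₀ hr0.le hr1.le)
      have h6 : |V (t - i) - u (t - i)| ≤ V (t - i) + (|coeff θ 0|
          + ∑' k : ℕ, coeff θ (k + 1) * Y (t - i - 1 - k)) := by
        refine (abs_sub _ _).trans (add_le_add (abs_of_nonneg (hV0 _)).le ?_)
        refine (abs_add_le _ _).trans (add_le_add le_rfl (abs_of_nonneg ?_).le)
        exact tsum_nonneg fun k => mul_nonneg (hc0 k) (hY0 _)
      calc r ^ i * |V (t - i) - u (t - i)| ≤ r ^ i * (V (t - i) + (|coeff θ 0|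
          + ∑' k : ℕ, coeff θ (k + 1) * Y (t - i - 1 - k))) :=
            mul_le_mul_of_nonneg_left h6 (pow_nonneg hr0.le i)
        _ ≤ _ := by rw [mul_add, mul_add]; linarith
  have h1 : V t - coeff θ 0 = ∑' i : ℕ, coeff θ (i + 1) * Y (t - 1 - i) := by
    have h2 : V t = u t := by linarith
    rw [h2, hu]
    ring
  rw [h1]
  exact (hs (t - 1)).hasSum

end Representation

end GARCH

namespace GARCH

/-! ### Taylor expansion and truncation of the conditional variance, on one path -/

section TaylorVariance

variable {p q : ℕ} {θ : Param p q}

/-- Jensen's inequality for the probability weights h, read off from the nonnegative variance Σ (φ_i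
- H)² h_i. -/
lemma sq_tsum_le_of_hasSum_one {h φ : ℕ → ℝ} (h0 : ∀ i, 0 ≤ h i) (h1 : HasSum h 1)
    (hφ : Summable fun i => φ i ^ 2 * h i) :
    Summable (fun i => φ i * h i) ∧ (∑' i, φ i * h i) ^ 2 ≤ ∑' i, φ i ^ 2 * h i := by
  have hs : Summable fun i => φ i * h i := by
    refine Summable.of_norm_bounded (h1.summable.add hφ) fun i => ?_
    rw [Real.norm_eq_abs, abs_mul, abs_of_nonneg (h0 i)]
    have : |φ i| ≤ 1 + φ i ^ 2 := by
      rw [← sq_abs]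
      nlinarith [sq_nonneg (|φ i| - 1)]
    nlinarith [h0 i, mul_le_mul_of_nonneg_right this (h0 i)]
  refine ⟨hs, ?_⟩
  set H := ∑' i, φ i * h i with hH
  have h2 : HasSum (fun i => φ i ^ 2 * h i - 2 * H * (φ i * h i) + H ^ 2 * h i)
      (∑' i, φ i ^ 2 * h i - 2 * H * H + H ^ 2 * 1) :=
    (hφ.hasSum.sub (hs.hasSum.mul_left (2 * H))).add (h1.mul_left (H ^ 2))
  have h3 : 0 ≤ ∑' i, φ i ^ 2 * h i - 2 * H * H + H ^ 2 * 1 := by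
    refine h2.nonneg fun i => ?_
    have : φ i ^ 2 * h i - 2 * H * (φ i * h i) + H ^ 2 * h i = (φ i - H) ^ 2 * h i := by ring
    rw [this]
    exact mul_nonneg (sq_nonneg _) (h0 i)
  nlinarith

/-- Taylor expansion of the conditional variance, as a function of the parameter, relative to its
true value `V`. The `x i` are the squared lagged observations and `x 0 = 1`. -/
lemma variance_taylor {C ψ V : ℝ} (hC : 0 ≤ C) (hψ : 1 ≤ ψ) (hV : 0 < V) {x : ℕ → ℝ}
    (hx : ∀ i, 0 ≤ x i) (hc : ∀ i, 0 ≤ coeff θ i) (hsum : HasSum (fun i => coeff θ i * x i) V)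
    (hU : Summable fun i => (ψ ^ 2) ^ i * (coeff θ i * x i / V)) {d : Param p q}
    (hd : ∀ i, |coeff (θ + d) i - coeff θ i| ≤ C * ‖d‖ * ψ ^ i * coeff θ i ∧
      |coeffDeriv θ d i| ≤ C * ‖d‖ * ψ ^ i * coeff θ i ∧
      |coeff (θ + d) i - coeff θ i - coeffDeriv θ d i| ≤ C * ‖d‖ ^ 2 * ψ ^ i * coeff θ i)
    (hg : ∀ l, Summable fun i => coeffDeriv θ (Pi.single l 1) i * x i / V) :
    Summable (fun i => coeff (θ + d) i * x i) ∧
    ((∑' i, coeff (θ + d) i * x i) / V - 1) ^ 2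
      ≤ C ^ 2 * ‖d‖ ^ 2 * ∑' i, (ψ ^ 2) ^ i * (coeff θ i * x i / V) ∧
    |(∑' i, coeff (θ + d) i * x i) / V - 1|
      ≤ C * ‖d‖ * ∑' i, (ψ ^ 2) ^ i * (coeff θ i * x i / V) ∧
    |(∑' i, coeff (θ + d) i * x i) / V - 1
        - ∑ l, d l * ∑' i, coeffDeriv θ (Pi.single l 1) i * x i / V|
      ≤ C * ‖d‖ ^ 2 * ∑' i, (ψ ^ 2) ^ i * (coeff θ i * x i / V) := by
  set h : ℕ → ℝ := fun i => coeff θ i * x i / V with hh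
  have h0 : ∀ i, 0 ≤ h i := fun i => div_nonneg (mul_nonneg (hc i) (hx i)) hV.le
  have h1 : HasSum h 1 := by
    have := hsum.div_const V
    rwa [div_self hV.ne'] at this
  have hU' : Summable fun i => (ψ ^ i) ^ 2 * h i := by
    refine hU.congr fun i => ?_
    rw [← pow_mul, ← pow_mul, mul_comm 2 i]
  -- Jensen bounds the square of Σ ψ^i h_i by the first power of Σ ψ^{2i} h_i. Hence a first moment
  -- of the majorant controls the squared relative error, and no second moment is needed.
  obtain ⟨hψs, hψle⟩ := sq_tsum_le_of_hasSum_one h0 h1 hU'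
  have hUe : ∑' i, (ψ ^ i) ^ 2 * h i = ∑' i, (ψ ^ 2) ^ i * h i := by
    refine tsum_congr fun i => ?_
    rw [← pow_mul, ← pow_mul, mul_comm 2 i]
  rw [hUe] at hψle
  have hψU : ∑' i, ψ ^ i * h i ≤ ∑' i, (ψ ^ 2) ^ i * h i := by
    refine Summable.tsum_le_tsum (fun i => mul_le_mul_of_nonneg_right ?_ (h0 i)) hψs hU
    exact pow_le_pow_left₀ (by linarith) (by nlinarith) i
  have hψ0 : 0 ≤ ∑' i, ψ ^ i * h i :=
    tsum_nonneg fun i => mul_nonneg (pow_nonneg (by linarith) i) (h0 i)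
  have hdiff : ∀ i, ‖(coeff (θ + d) i - coeff θ i) * x i / V‖ ≤ C * ‖d‖ * (ψ ^ i * h i) := by
    intro i
    rw [Real.norm_eq_abs, abs_div, abs_mul, abs_of_nonneg (hx i), abs_of_pos hV, hh]
    simp only
    calc |coeff (θ + d) i - coeff θ i| * x i / V
        ≤ C * ‖d‖ * ψ ^ i * coeff θ i * x i / V := by
          have := (hd i).1
          have := hx i
          gcongr
      _ = _ := by ring
  have hds : Summable fun i => (coeff (θ + d) i - coeff θ i) * x i / V :=
    Summable.of_norm_bounded (hψs.mul_left (C * ‖d‖)) hdiff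
  have hFs : Summable fun i => coeff (θ + d) i * x i := by
    refine (((hds.mul_left V).add hsum.summable)).congr fun i => ?_
    field_simp
    ring
  have hF : (∑' i, coeff (θ + d) i * x i) / V - 1
      = ∑' i, (coeff (θ + d) i - coeff θ i) * x i / V := by
    have h2 := (hFs.hasSum.div_const V).sub h1
    rw [← h2.tsum_eq]
    refine tsum_congr fun i => ?_
    rw [hh]
    ring
  have hAbs : |(∑' i, coeff (θ + d) i * x i) / V - 1| ≤ C * ‖d‖ * ∑' i, ψ ^ i * h i := by
    rw [hF]
    exact tsum_of_norm_bounded (hψs.hasSum.mul_left (C * ‖d‖)) hdiff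
  refine ⟨hFs, ?_, ?_, ?_⟩
  · calc ((∑' i, coeff (θ + d) i * x i) / V - 1) ^ 2
        ≤ (C * ‖d‖ * ∑' i, ψ ^ i * h i) ^ 2 := by
          rw [← sq_abs]
          exact pow_le_pow_left₀ (abs_nonneg _) hAbs 2
      _ = C ^ 2 * ‖d‖ ^ 2 * (∑' i, ψ ^ i * h i) ^ 2 := by ring
      _ ≤ _ := mul_le_mul_of_nonneg_left hψle (by positivity)
  · exact hAbs.trans (mul_le_mul_of_nonneg_left hψU (by positivity))
  · have h2 : HasSum (fun i => coeffDeriv θ d i * x i / V)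
        (∑ l, d l * ∑' i, coeffDeriv θ (Pi.single l 1) i * x i / V) := by
      refine (hasSum_sum fun l (_ : l ∈ Finset.univ) =>
        (hg l).hasSum.mul_left (d l)).congr_fun fun i => ?_
      rw [coeffDeriv_eq_sum, Finset.sum_mul, Finset.sum_div]
      exact Finset.sum_congr rfl fun l _ => by ring
    rw [hF, ← (hds.hasSum.sub h2).tsum_eq, ← Real.norm_eq_abs]
    refine (tsum_of_norm_bounded (hψs.hasSum.mul_left (C * ‖d‖ ^ 2)) fun i => ?_).trans
      (mul_le_mul_of_nonneg_left hψU (by positivity))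
    have e : (coeff (θ + d) i - coeff θ i) * x i / V - coeffDeriv θ d i * x i / V
        = (coeff (θ + d) i - coeff θ i - coeffDeriv θ d i) * x i / V := by ring
    rw [e, Real.norm_eq_abs, abs_div, abs_mul, abs_of_nonneg (hx i), abs_of_pos hV, hh]
    simp only
    calc |coeff (θ + d) i - coeff θ i - coeffDeriv θ d i| * x i / V
        ≤ C * ‖d‖ ^ 2 * ψ ^ i * coeff θ i * x i / V := by
          have := (hd i).2.2
          have := hx i
          gcongr
      _ = _ := by ring

/-- The effect of truncating the series for the conditional variance. -/
lemma abs_truncVar_sub_le {u : Param p q} {K R : ℝ} (hR0 : 0 < R)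
    (hK : 0 ≤ K) (hu : ∀ i, |coeff u i| ≤ K * R ^ i) {X : ℤ → ℝ}
    (hX : Summable fun i : ℕ => R ^ i * X (-i) ^ 2) (t : ℕ) {x : ℕ → ℝ} (hx0 : x 0 = 1)
    (hx : ∀ i : ℕ, x (i + 1) = X ((t : ℤ) - 1 - i) ^ 2)
    (hs : Summable fun i => coeff u i * x i) :
    |∑' i, coeff u i * x i - truncVar u (fun s : ℕ => X s) t|
      ≤ K * R ^ t * ∑' i : ℕ, R ^ i * X (-i) ^ 2 := by
  have h1 : truncVar u (fun s : ℕ => X s) t = ∑ i ∈ Finset.range (t + 1), coeff u i * x i := by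
    rw [Finset.sum_range_succ', hx0, truncVar, mul_one, add_comm]
    congr 1
    have e : Finset.Icc 1 t = Finset.Ico (0 + 1) (t + 1) := by
      ext i; simp only [Finset.mem_Icc, Finset.mem_Ico]; omega
    rw [e, ← Finset.sum_Ico_add' (fun i => coeff u i * X ((t - i : ℕ) : ℤ) ^ 2) 0 t 1,
      ← Finset.range_eq_Ico]
    refine Finset.sum_congr rfl fun i hi => ?_
    rw [Finset.mem_range] at hi
    rw [hx]
    congr 3
    omega
  rw [h1, ← hs.sum_add_tsum_nat_add (t + 1), add_sub_cancel_left,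
    ← Real.norm_eq_abs]
  have h2 : Summable fun i : ℕ => R ^ (i + 1) * X (-((i + 1 : ℕ) : ℤ)) ^ 2 :=
    (summable_nat_add_iff (f := fun m : ℕ => R ^ m * X (-m) ^ 2) 1).2 hX
  have h3 : ∑' i : ℕ, R ^ (i + 1) * X (-((i + 1 : ℕ) : ℤ)) ^ 2 ≤ ∑' i : ℕ, R ^ i * X (-i) ^ 2 := by
    rw [← hX.sum_add_tsum_nat_add 1]
    refine le_add_of_nonneg_left (Finset.sum_nonneg fun m _ => by positivity)
  -- The omitted terms have lag above t, so they involve observations before time 0 only. Splitting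
  -- R^{i+t+1} as R^t R^{i+1} leaves a factor that does not depend on t.
  refine (tsum_of_norm_bounded (h2.hasSum.mul_left (K * R ^ t)) fun i => ?_).trans
    (mul_le_mul_of_nonneg_left h3 (by positivity))
  rw [show i + (t + 1) = i + t + 1 by ring, hx, Real.norm_eq_abs, abs_mul,
    abs_of_nonneg (sq_nonneg (X _))]
  have e : (t : ℤ) - 1 - ((i + t : ℕ) : ℤ) = -((i + 1 : ℕ) : ℤ) := by push_cast; ring
  rw [e]
  calc |coeff u (i + t + 1)| * X (-((i + 1 : ℕ) : ℤ)) ^ 2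
      ≤ K * R ^ (i + t + 1) * X (-((i + 1 : ℕ) : ℤ)) ^ 2 :=
        mul_le_mul_of_nonneg_right (hu _) (sq_nonneg _)
    _ = _ := by ring

end TaylorVariance

end GARCH

namespace GARCH

/-! ### The expansion terms as integrable functionals of the past -/

section Functionals

variable {Ω : Type*} [MeasurableSpace Ω] {P : Measure Ω} {ε : ℤ → Ω → ℝ}
  {p q : ℕ} {θ : Param p q}

/-- The sequence `1, X_t², X_{t-1}², …` as a function of the innovations up to time `t`, when
`X_t² = g(ε_t, ε_{t-1}, …)`. -/
def lagSq (g : (ℕ → ℝ) → ℝ) (y : ℕ → ℝ) : ℕ → ℝ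
  | 0 => 1
  | i + 1 => g fun k => y (k + i)

/-- The relative weight of the `i`-th term in the `ARCH(∞)` representation. -/
noncomputable def weight (θ : Param p q) (g v : (ℕ → ℝ) → ℝ) (y : ℕ → ℝ) (i : ℕ) : ℝ :=
  coeff θ i * lagSq g y i / v y

/-- The majorant of all terms in the Taylor expansion of the conditional variance. -/
noncomputable def majorant (ψ : ℝ) (θ : Param p q) (g v : (ℕ → ℝ) → ℝ) (y : ℕ → ℝ) : ℝ :=
  ∑' i, (ψ ^ 2) ^ i * weight θ g v y i

/-- The logarithmic derivative of the conditional variance in a coordinate direction. -/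
noncomputable def logDeriv (θ : Param p q) (g v : (ℕ → ℝ) → ℝ) (l : Fin (p + 1) ⊕ Fin q)
    (y : ℕ → ℝ) : ℝ :=
  ∑' i, coeffDeriv θ (Pi.single l 1) i * lagSq g y i / v y

variable {g v : (ℕ → ℝ) → ℝ}

lemma measurable_lagSq (hg : Measurable g) (i : ℕ) : Measurable fun y => lagSq g y i := by
  cases i with
  | zero => exact measurable_const
  | succ i => exact hg.comp (measurable_shift i)

lemma measurable_weight (hg : Measurable g) (hv : Measurable v) (i : ℕ) :
    Measurable fun y => weight θ g v y i :=
  ((measurable_lagSq hg i).const_mul _).div hv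

lemma measurable_majorant {ψ : ℝ} (hg : Measurable g) (hv : Measurable v) :
    Measurable (majorant ψ θ g v) :=
  Measurable.tsum fun i => (measurable_weight hg hv i).const_mul _

lemma measurable_logDeriv (hg : Measurable g) (hv : Measurable v) (l : Fin (p + 1) ⊕ Fin q) :
    Measurable (logDeriv θ g v l) :=
  Measurable.tsum fun i => ((measurable_lagSq hg i).const_mul _).div hv

lemma IsInnovation.measurePreserving_shift [IsProbabilityMeasure P] (hε : IsInnovation ε P)
    (N : ℕ) : MeasurePreserving (fun (x : ℕ → ℝ) (i : ℕ) => x (i + N)) (pastLaw ε P)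
      (pastLaw ε P) := by
  refine ⟨measurable_shift N, ?_⟩
  rw [pastLaw, Measure.map_map (measurable_shift N) (hε.measurable_past 0)]
  have : (fun (x : ℕ → ℝ) (i : ℕ) => x (i + N)) ∘ past ε 0 = past ε (0 - N) := by
    funext ω
    exact past_shift ε 0 N ω
  rw [this, hε.map_past]
  rfl

/-- The ratio is at most min(1, z/c), hence at most any power of z/c with exponent in (0, 1]. In
this way a fractional moment of the squared observations yields a full moment of the relative
weights. -/
lemma div_add_le_rpow {z c s : ℝ} (hz : 0 ≤ z) (hc : 0 < c) (hs : 0 < s) (hs1 : s ≤ 1) {v : ℝ}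
    (hv : c + z ≤ v) : z / v ≤ (z / c) ^ s := by
  have hv0 : 0 < v := by linarith
  rcases le_total z c with h | h
  · have h1 : z / c ≤ 1 := (div_le_one hc).2 h
    have h2 : z / v ≤ z / c := div_le_div_of_nonneg_left hz hc (by linarith)
    refine h2.trans ?_
    rcases (div_nonneg hz hc.le).eq_or_lt with h3 | h3
    · rw [← h3, Real.zero_rpow hs.ne']
    · calc z / c = (z / c) ^ (1 : ℝ) := (Real.rpow_one _).symm
        _ ≤ _ := Real.rpow_le_rpow_of_exponent_ge h3 h1 hs1
  · have h1 : z / v ≤ 1 := (div_le_one hv0).2 (by linarith)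
    exact h1.trans (Real.one_le_rpow ((one_le_div hc).2 h) hs.le)

/-- The majorant has a finite mean. -/
lemma integrable_majorant [IsProbabilityMeasure P] (hε : IsInnovation ε P)
    (hg : Measurable g) (hv : Measurable v) (hθ : ∀ i, 0 ≤ coeff θ i) (hc0 : 0 < coeff θ 0)
    {C r s ψ : ℝ} (hC : 0 < C) (hr0 : 0 < r) (hcoef : ∀ i, coeff θ i ≤ C * r ^ i) (hs : 0 < s)
    (hs1 : s ≤ 1) (hψ1 : 1 ≤ ψ) (hψ : ψ ^ 2 * r ^ s < 1)
    (hgv : ∀ᵐ y ∂(pastLaw ε P), 0 ≤ g y)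
    (hvg : ∀ i : ℕ, ∀ᵐ y ∂(pastLaw ε P), coeff θ 0 + coeff θ (i + 1) * g (fun k => y (k + i)) ≤ v y)
    (hgm : ∫⁻ y, ENNReal.ofReal (g y ^ s) ∂(pastLaw ε P) < ⊤) :
    (∀ᵐ y ∂(pastLaw ε P), Summable fun i => (ψ ^ 2) ^ i * weight θ g v y i) ∧
      Integrable (majorant ψ θ g v) (pastLaw ε P) := by
  have := hε.isProbabilityMeasure_pastLaw
  set R := ψ ^ 2 * r ^ s with hR
  have hrs : 0 < r ^ s := Real.rpow_pos_of_pos hr0 s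
  have hψ0 : 0 < ψ := by linarith
  have hR0 : 0 < R := by positivity
  have hshift : ∀ i : ℕ, ∀ᵐ y ∂(pastLaw ε P), 0 ≤ g fun k => y (k + i) := fun i =>
    (hε.measurePreserving_shift i).quasiMeasurePreserving.ae hgv
  have hvpos : ∀ᵐ y ∂(pastLaw ε P), coeff θ 0 ≤ v y := by
    filter_upwards [hvg 0, hshift 0] with y h1 h2
    have := mul_nonneg (hθ 1) h2
    linarith
  set M := ∫⁻ y, ENNReal.ofReal (g y ^ s) ∂(pastLaw ε P) with hM
  -- The entry 1 covers the weight of index 0, which is only known to be at most 1; the other entry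
  -- is the constant of the bounds for the remaining indices, which are geometric with ratio R = ψ²
  -- r^s < 1.
  set K := max 1 ((C / coeff θ 0) ^ s) with hK
  have hK1 : 1 ≤ K := le_max_left _ _
  refine integrable_tsum_of_lintegral
    (fun i => (measurable_weight hg hv i).const_mul _) (fun i => ?_) ?_
  · filter_upwards [hvpos, hshift (i - 1)] with y h1 h2
    refine mul_nonneg (by positivity) (div_nonneg (mul_nonneg (hθ i) ?_) (hc0.le.trans h1))
    cases i with
    | zero => exact zero_le_one
    | succ i => exact h2
  have hbound : ∀ i, ∫⁻ y, ENNReal.ofReal ((ψ ^ 2) ^ i * weight θ g v y i) ∂(pastLaw ε P)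
      ≤ ENNReal.ofReal K * ENNReal.ofReal R ^ i * (1 + M) := by
    intro i
    cases i with
    | zero =>
      calc ∫⁻ y, ENNReal.ofReal ((ψ ^ 2) ^ 0 * weight θ g v y 0) ∂(pastLaw ε P)
          ≤ ∫⁻ _, 1 ∂(pastLaw ε P) := by
            refine lintegral_mono_ae ?_
            filter_upwards [hvpos] with y h1
            rw [pow_zero, one_mul, weight, lagSq, mul_one]
            refine ENNReal.ofReal_le_one.2 ?_
            rw [div_le_one (hc0.trans_le h1)]
            exact h1
        _ = 1 := by simp
        _ ≤ _ := by
            rw [pow_zero, mul_one]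
            calc (1 : ENNReal) = 1 * 1 := (one_mul 1).symm
              _ ≤ _ := mul_le_mul' (by simpa using hK1) le_self_add
    | succ i =>
      have hpt : ∀ᵐ y ∂(pastLaw ε P), ENNReal.ofReal ((ψ ^ 2) ^ (i + 1) * weight θ g v y (i + 1))
          ≤ ENNReal.ofReal (K * R ^ (i + 1)) * ENNReal.ofReal (g (fun k => y (k + i)) ^ s) := by
        filter_upwards [hvg i, hshift i] with y h1 h2
        have hG0 : 0 ≤ g (fun k => y (k + i)) ^ s := Real.rpow_nonneg h2 s
        rw [← ENNReal.ofReal_mul (by positivity)]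
        refine ENNReal.ofReal_le_ofReal ?_
        have hz : 0 ≤ coeff θ (i + 1) * g fun k => y (k + i) := mul_nonneg (hθ _) h2
        calc (ψ ^ 2) ^ (i + 1) * weight θ g v y (i + 1)
            ≤ (ψ ^ 2) ^ (i + 1) * ((coeff θ (i + 1) * g fun k => y (k + i)) / coeff θ 0) ^ s :=
              mul_le_mul_of_nonneg_left (div_add_le_rpow hz hc0 hs hs1 h1) (by positivity)
          _ ≤ (ψ ^ 2) ^ (i + 1)
              * (C / coeff θ 0 * r ^ (i + 1) * g fun k => y (k + i)) ^ s := by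
              refine mul_le_mul_of_nonneg_left (Real.rpow_le_rpow (by positivity) ?_ hs.le)
                (by positivity)
              calc (coeff θ (i + 1) * g fun k => y (k + i)) / coeff θ 0
                  ≤ (C * r ^ (i + 1) * g fun k => y (k + i)) / coeff θ 0 := by
                    have := hcoef (i + 1)
                    gcongr
                _ = _ := by ring
          _ = (C / coeff θ 0) ^ s * R ^ (i + 1) * g (fun k => y (k + i)) ^ s := by
              rw [Real.mul_rpow (by positivity) h2, Real.mul_rpow (by positivity) (by positivity),
                hR, mul_pow]
              have : (r ^ (i + 1)) ^ s = (r ^ s) ^ (i + 1) := by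
                rw [← Real.rpow_natCast, ← Real.rpow_natCast, ← Real.rpow_mul hr0.le,
                  ← Real.rpow_mul hr0.le, mul_comm s]
              rw [this]
              ring
          _ ≤ _ := by
              have : (C / coeff θ 0) ^ s ≤ K := le_max_right _ _
              gcongr
      calc ∫⁻ y, ENNReal.ofReal ((ψ ^ 2) ^ (i + 1) * weight θ g v y (i + 1)) ∂(pastLaw ε P)
          ≤ ∫⁻ y, ENNReal.ofReal (K * R ^ (i + 1))
              * ENNReal.ofReal (g (fun k => y (k + i)) ^ s) ∂(pastLaw ε P) := lintegral_mono_ae hpt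
        _ = ENNReal.ofReal (K * R ^ (i + 1)) * M := by
            rw [lintegral_const_mul (f := fun y : ℕ → ℝ => ENNReal.ofReal (g (fun k => y (k + i)) ^ s)) _
              ((hg.comp (measurable_shift i)).pow_const s).ennreal_ofReal,
              hM, ← (hε.measurePreserving_shift i).lintegral_comp
                (f := fun y => ENNReal.ofReal (g y ^ s)) (hg.pow_const s).ennreal_ofReal]
        _ ≤ _ := by
            rw [ENNReal.ofReal_mul (by positivity), ENNReal.ofReal_pow hR0.le]
            exact mul_le_mul_right le_add_self _
  refine lt_of_le_of_lt (ENNReal.tsum_le_tsum hbound) ?_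
  rw [ENNReal.tsum_mul_right, ENNReal.tsum_mul_left, ENNReal.tsum_geometric]
  refine ENNReal.mul_lt_top (ENNReal.mul_lt_top ENNReal.ofReal_lt_top ?_)
    (ENNReal.add_lt_top.2 ⟨ENNReal.one_lt_top, hgm⟩)
  rw [ENNReal.inv_lt_top]
  exact tsub_pos_of_lt (by simpa using hψ)

/-- The logarithmic derivatives are dominated by the majorant. -/
lemma abs_logDeriv_le {ψ C : ℝ} (hC : 0 ≤ C) (hψ : 1 ≤ ψ) {y : ℕ → ℝ}
    (hx : ∀ i, 0 ≤ lagSq g y i) (hv : 0 < v y) (hc : ∀ i, 0 ≤ coeff θ i)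
    (hs : Summable fun i => (ψ ^ 2) ^ i * weight θ g v y i) (l : Fin (p + 1) ⊕ Fin q)
    (hd : ∀ i, |coeffDeriv θ (Pi.single l 1) i| ≤ C * ψ ^ i * coeff θ i) :
    Summable (fun i => coeffDeriv θ (Pi.single l 1) i * lagSq g y i / v y) ∧
      |logDeriv θ g v l y| ≤ C * majorant ψ θ g v y := by
  have h1 : ∀ i, ‖coeffDeriv θ (Pi.single l 1) i * lagSq g y i / v y‖
      ≤ C * ((ψ ^ 2) ^ i * weight θ g v y i) := by
    intro i
    rw [Real.norm_eq_abs, abs_div, abs_mul, abs_of_nonneg (hx i), abs_of_pos hv, weight]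
    have h2 : ψ ^ i ≤ (ψ ^ 2) ^ i := pow_le_pow_left₀ (by linarith) (by nlinarith) i
    have h3 := hx i
    have h4 := hc i
    calc |coeffDeriv θ (Pi.single l 1) i| * lagSq g y i / v y
        ≤ C * ψ ^ i * coeff θ i * lagSq g y i / v y := by
          have := hd i
          gcongr
      _ ≤ C * (ψ ^ 2) ^ i * coeff θ i * lagSq g y i / v y := by gcongr
      _ = _ := by ring
  refine ⟨Summable.of_norm_bounded (hs.mul_left C) h1, ?_⟩
  rw [← Real.norm_eq_abs]
  exact tsum_of_norm_bounded (hs.hasSum.mul_left C) h1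

end Functionals

end GARCH

namespace GARCH

/-! ### The GARCH model in terms of its causal state -/

section Model

variable {Ω : Type*} [MeasurableSpace Ω] {P : Measure Ω} {ε X σ : ℤ → Ω → ℝ}
  {p q : ℕ} {θ : Param p q}

/-- The squared observation as a function of the innovations, read off the causal state. -/
def obsSq (hp : 0 < p) (G : (ℕ → ℝ) → Fin q ⊕ Fin p → ℝ) (y : ℕ → ℝ) : ℝ :=
  G y (Sum.inr ⟨0, hp⟩)

/-- The next conditional variance as a function of the innovations, read off the causal state. -/
def nextVar (θ : Param p q) (G : (ℕ → ℝ) → Fin q ⊕ Fin p → ℝ) (y : ℕ → ℝ) : ℝ :=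
  θ (Sum.inl 0) + ∑ i : Fin p, θ (Sum.inl i.succ) * G y (Sum.inr i)
    + ∑ j : Fin q, θ (Sum.inr j) * G y (Sum.inl j)

lemma measurable_obsSq (hp : 0 < p) {G : (ℕ → ℝ) → Fin q ⊕ Fin p → ℝ} (hG : Measurable G) :
    Measurable (obsSq hp G) :=
  (measurable_pi_apply _).comp hG

lemma measurable_nextVar {G : (ℕ → ℝ) → Fin q ⊕ Fin p → ℝ} (hG : Measurable G) :
    Measurable (nextVar θ G) := by
  have h : ∀ r, Measurable fun y => G y r := fun r => (measurable_pi_apply r).comp hG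
  exact (measurable_const.add (Finset.measurable_fun_sum _ fun i _ => (h _).const_mul _)).add
    (Finset.measurable_fun_sum _ fun j _ => (h _).const_mul _)

section Causal

variable {G : (ℕ → ℝ) → Fin q ⊕ Fin p → ℝ}

lemma IsStationarySolution.sq_eq_obsSq (hp : 0 < p)
    (hG : ∀ t, ∀ᵐ ω ∂P, state p q X σ t ω = G (past ε t ω)) (t : ℤ) :
    ∀ᵐ ω ∂P, X t ω ^ 2 = obsSq hp G (past ε t ω) := by
  filter_upwards [hG t] with ω h
  rw [obsSq, ← h]
  simp [state]

lemma IsStationarySolution.sq_eq_nextVar (hX : IsStationarySolution θ ε X σ P)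
    (hG : ∀ t, ∀ᵐ ω ∂P, state p q X σ t ω = G (past ε t ω)) (t : ℤ) :
    ∀ᵐ ω ∂P, σ t ω ^ 2 = nextVar θ G (past ε (t - 1) ω) := by
  filter_upwards [hG (t - 1), hX.volatility t] with ω h hv
  have e : ∀ a : ℕ, t - ((a : ℤ) + 1) = t - 1 - a := fun a => by ring
  rw [hv, nextVar, ← h]
  simp only [state, Sum.elim_inl, Sum.elim_inr, e]

lemma IsStationarySolution.ae_summable_state [IsProbabilityMeasure P]
    (hε : IsInnovation ε P) (hX : IsStationarySolution θ ε X σ P) (hGm : Measurable G)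
    (hG : ∀ t, ∀ᵐ ω ∂P, state p q X σ t ω = G (past ε t ω)) {s : ℝ} (hs : 0 < s) (hs1 : s ≤ 1)
    (hGs : ∫⁻ x, ENNReal.ofReal (‖G x‖ ^ s) ∂(pastLaw ε P) < ⊤) {r : ℝ} (hr0 : 0 < r) (hr1 : r < 1)
    (a : Fin q ⊕ Fin p) (t : ℤ) :
    ∀ᵐ ω ∂P, Summable fun i : ℕ => r ^ i * state p q X σ (t - i) ω a := by
  refine ae_summable_pow_mul (Z := fun i ω => state p q X σ (t - i) ω a)
    (fun i => (measurable_pi_apply a).comp (hX.measurable_state _))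
    (fun i => ae_of_all _ fun ω => ?_) hs hs1 hGs (fun i => ?_) hr0 hr1
  · rcases a with j | j
    · exact sq_nonneg _
    · exact sq_nonneg _
  · rw [← (hε.measurePreserving_past (t - i)).lintegral_comp (hGm.norm.pow_const s).ennreal_ofReal]
    refine lintegral_mono_ae ?_
    filter_upwards [hG (t - i)] with ω h
    have h0 : 0 ≤ state p q X σ (t - i) ω a := by
      rcases a with j | j
      · exact sq_nonneg _
      · exact sq_nonneg _
    refine ENNReal.ofReal_le_ofReal (Real.rpow_le_rpow h0 ?_ hs.le)
    rw [← h]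
    exact (le_abs_self _).trans (norm_le_pi_norm (state p q X σ (t - i) ω) a)

lemma IsStationarySolution.ae_summable_sq [IsProbabilityMeasure P]
    (hε : IsInnovation ε P) (hX : IsStationarySolution θ ε X σ P) (hp : 0 < p) (hGm : Measurable G)
    (hG : ∀ t, ∀ᵐ ω ∂P, state p q X σ t ω = G (past ε t ω)) {s : ℝ} (hs : 0 < s) (hs1 : s ≤ 1)
    (hGs : ∫⁻ x, ENNReal.ofReal (‖G x‖ ^ s) ∂(pastLaw ε P) < ⊤) {r : ℝ} (hr0 : 0 < r)
    (hr1 : r < 1) :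
    ∀ᵐ ω ∂P, ∀ t : ℤ, (Summable fun i : ℕ => r ^ i * X (t - i) ω ^ 2) ∧
      Summable fun i : ℕ => r ^ i * σ (t - i) ω ^ 2 := by
  have hY : ∀ᵐ ω ∂P, ∀ t : ℤ, Summable fun i : ℕ => r ^ i * X (t - i) ω ^ 2 := by
    refine ae_all_iff.2 fun t => ?_
    filter_upwards [hX.ae_summable_state hε hGm hG hs hs1 hGs hr0 hr1 (Sum.inr ⟨0, hp⟩) t] with ω h
    simpa [state] using h
  have hV : ∀ᵐ ω ∂P, ∀ t : ℤ, Summable fun i : ℕ => r ^ i * σ (t - i) ω ^ 2 := by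
    -- For q = 0 the state has no component σ², and summability is read off from the volatility
    -- equation instead.
    rcases Nat.eq_zero_or_pos q with rfl | hq
    · filter_upwards [hY, ae_all_iff.2 hX.volatility] with ω h1 h2 t
      have h3 : Summable fun i : ℕ => r ^ i * θ (Sum.inl 0) + ∑ k : Fin p,
          θ (Sum.inl k.succ) * (r ^ i * X (t - ((k : ℤ) + 1) - i) ω ^ 2) :=
        ((summable_geometric_of_lt_one hr0.le hr1).mul_right _).add
          (summable_sum fun k _ => (h1 _).mul_left _)
      refine h3.congr fun i => ?_
      rw [h2, Finset.univ_eq_empty (α := Fin 0), Finset.sum_empty, add_zero, mul_add,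
        Finset.mul_sum]
      congr 1
      refine Finset.sum_congr rfl fun k _ => ?_
      rw [show t - ((k : ℤ) + 1) - i = t - i - ((k : ℤ) + 1) by ring]
      ring
    · refine ae_all_iff.2 fun t => ?_
      filter_upwards [hX.ae_summable_state hε hGm hG hs hs1 hGs hr0 hr1 (Sum.inl ⟨0, hq⟩) t]
        with ω h
      simpa [state] using h
  filter_upwards [hY, hV] with ω h1 h2 t
  exact ⟨h1 t, h2 t⟩

end Causal

lemma exists_one_lt_sq_mul_rpow_lt_one {r s : ℝ} (hr0 : 0 < r) (hr1 : r < 1) (hs : 0 < s) :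
    ∃ ψ : ℝ, 1 < ψ ∧ ψ ^ 2 * r ^ s < 1 := by
  -- With this choice ψ² r^s = r^{s/2}.
  refine ⟨r ^ (-(s / 4)), Real.one_lt_rpow_of_pos_of_lt_one_of_neg hr0 hr1 (by linarith), ?_⟩
  rw [← Real.rpow_natCast, ← Real.rpow_mul hr0.le, ← Real.rpow_add hr0]
  refine Real.rpow_lt_one hr0.le hr1 ?_
  push_cast
  linarith

lemma coeff_zero_le_truncVar {u : Param p q} (hu : ∀ l, 0 ≤ u l) (x : ℕ → ℝ) (t : ℕ) :
    coeff u 0 ≤ truncVar u x t := by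
  refine le_add_of_nonneg_right (Finset.sum_nonneg fun i hi => ?_)
  obtain ⟨j, rfl⟩ : ∃ j, i = j + 1 := ⟨i - 1, by have := (Finset.mem_Icc.1 hi).1; omega⟩
  exact mul_nonneg (coeff_succ_nonneg hu j) (sq_nonneg _)

/-- The Taylor bounds are available only for increments of norm at most κ₀; the derivative is
homogeneous in d, so scaling transfers its bound to the unit vectors. -/
lemma abs_coeffDeriv_single_le {C κ₀ ψ : ℝ} (hC : 0 < C) (hκ₀ : 0 < κ₀) (hψ : 1 < ψ)
    (hc : ∀ i, 0 ≤ coeff θ i)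
    (hd : ∀ d : Param p q, ‖d‖ ≤ κ₀ → ∀ i, |coeffDeriv θ d i| ≤ C * ‖d‖ * ψ ^ i * coeff θ i)
    (l : Fin (p + 1) ⊕ Fin q) (i : ℕ) :
    |coeffDeriv θ (Pi.single l 1) i| ≤ C * ψ ^ i * coeff θ i := by
  have hn : ‖κ₀ • (Pi.single l 1 : Param p q)‖ ≤ κ₀ := by
    refine (pi_norm_le_iff_of_nonneg hκ₀.le).2 fun a => ?_
    rw [Pi.smul_apply, smul_eq_mul, norm_mul, Real.norm_of_nonneg hκ₀.le]
    refine mul_le_of_le_one_right hκ₀.le ?_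
    by_cases h : a = l
    · subst h; simp
    · simp [h]
  have h1 := hd _ hn i
  rw [coeffDeriv_smul, abs_mul, abs_of_pos hκ₀] at h1
  have h2 : κ₀ * |coeffDeriv θ (Pi.single l 1) i| ≤ κ₀ * (C * ψ ^ i * coeff θ i) := by
    refine h1.trans ?_
    have h3 := hc i
    calc C * ‖κ₀ • (Pi.single l 1 : Param p q)‖ * ψ ^ i * coeff θ i
        ≤ C * κ₀ * ψ ^ i * coeff θ i := by gcongr
      _ = _ := by ring
  exact le_of_mul_le_mul_left h2 hκ₀

end Model

end GARCH

namespace GARCH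

/-! ### Expansion of the truncated conditional variance -/

section Expansion

variable {Ω : Type*} [MeasurableSpace Ω] {P : Measure Ω} {ε X σ : ℤ → Ω → ℝ}
  {p q : ℕ} {θ : Param p q}

/-- The relative error of the truncated conditional variance at the parameter `θ + d`, up to time
`t`, on one path: `A` is the effect of the parameter, `B` the effect of the truncation. -/
structure HasVarExpansion (θ d : Param p q) (x : ℕ → ℝ) (t : ℕ) (V U : ℝ)
    (g : Fin (p + 1) ⊕ Fin q → ℝ) (C R ξ A B : ℝ) : Prop where
  le_truncVar : C⁻¹ ≤ truncVar (θ + d) x t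
  eq_add : truncVar (θ + d) x t / V - 1 = A + B
  sq_le : A ^ 2 ≤ C * ‖d‖ ^ 2 * U
  abs_le : |A| ≤ C * ‖d‖ * U
  abs_sub_le : |A - ∑ l, d l * g l| ≤ C * ‖d‖ ^ 2 * U
  abs_trunc_le : |B| ≤ C * R ^ t * ξ
  abs_trunc_mul_le : |B| * V ≤ C * R ^ t * ξ

/-- The causal state, the ARCH(∞) series and the Taylor bounds are combined here. Two features of
the form matter. The functionals U and g_l are evaluated at the past up to t - 1, hence are
independent of ε_t. The exceptional null set does not depend on d, so that d may later be the random
increment θhat_n - θ. -/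
theorem IsStationarySolution.exists_varExpansion [IsProbabilityMeasure P]
    (hε : IsInnovation ε P) (hγ : topLyapunov θ ε P < 0)
    (hX : IsStationarySolution θ ε X σ P) (hp : 0 < p) {lo : ℝ} (hlo : 0 < lo)
    (hθlo : ∀ l, lo ≤ θ l) (hsum : ∑ j : Fin q, θ (Sum.inr j) < 1) :
    ∃ (U : (ℕ → ℝ) → ℝ) (g : Fin (p + 1) ⊕ Fin q → (ℕ → ℝ) → ℝ) (ξ : Ω → ℝ) (C κ R : ℝ),
      Measurable U ∧ Integrable U (pastLaw ε P) ∧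
      (∀ l, Measurable (g l) ∧ Integrable (g l) (pastLaw ε P)) ∧ Measurable ξ ∧
      0 < C ∧ 0 < κ ∧ 0 < R ∧ R < 1 ∧
      ∀ᵐ ω ∂P, 0 ≤ ξ ω ∧ ∀ t : ℕ, 0 ≤ U (past ε (t - 1) ω) ∧ 0 < σ t ω ∧
        X t ω = σ t ω * ε t ω ∧ ∀ d : Param p q, ‖d‖ ≤ κ →
          ∃ A B, HasVarExpansion θ d (fun s : ℕ => X s ω) t (σ t ω ^ 2) (U (past ε (t - 1) ω))
            (fun l => g l (past ε (t - 1) ω)) C R (ξ ω) A B := by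
  obtain ⟨G, hGm, hG, s, hs, hs1, hGs⟩ := hX.exists_causal_state hε hγ
  have hθ0 : ∀ l, 0 ≤ θ l := fun l => hlo.le.trans (hθlo l)
  obtain ⟨C₀, r, hC₀, hr0, hr1, hβr, hgeo⟩ := exists_coeff_le_geometric hθ0 hsum
  obtain ⟨ψ, hψ1, hψr⟩ := exists_one_lt_sq_mul_rpow_lt_one hr0 hr1 hs
  obtain ⟨C₁, κ₀, hC₁, hκ₀, htaylor⟩ := exists_coeff_taylor hlo hθlo
    (b := 1 - ∑ j : Fin q, θ (Sum.inr j)) (by linarith) (by ring) hψ1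
  have hψ0 : 0 < ψ := by linarith
  have hc0 : 0 < coeff θ 0 := by
    rw [coeff_zero]
    exact div_pos (hlo.trans_le (hθlo _)) (by linarith)
  have hc : ∀ i, 0 ≤ coeff θ i := by
    rintro (_ | i)
    exacts [hc0.le, coeff_succ_nonneg hθ0 i]
  have hsingle := abs_coeffDeriv_single_le hC₁ hκ₀ hψ1 hc fun d hd i => (htaylor d hd i).2.1
  set f := obsSq hp G with hf
  set v := nextVar θ G with hv
  have hfm : Measurable f := measurable_obsSq hp hGm
  have hvm : Measurable v := measurable_nextVar hGm
  set R := ψ * r with hR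
  have hR0 : 0 < R := by positivity
  have hR1 : R < 1 := by
    have h1 : r ≤ r ^ s := by
      calc r = r ^ (1 : ℝ) := (Real.rpow_one r).symm
        _ ≤ _ := Real.rpow_le_rpow_of_exponent_ge hr0 hr1.le hs1
    have h2 : ψ ≤ ψ ^ 2 := by nlinarith
    calc R ≤ ψ ^ 2 * r ^ s := by rw [hR]; gcongr
      _ < 1 := hψr
  have hY : ∀ᵐ ω ∂P, ∀ t, X t ω ^ 2 = f (past ε t ω) :=
    ae_all_iff.2 (IsStationarySolution.sq_eq_obsSq hp hG)
  have hV : ∀ᵐ ω ∂P, ∀ t, σ t ω ^ 2 = v (past ε (t - 1) ω) :=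
    ae_all_iff.2 (hX.sq_eq_nextVar hG)
  have hsumm := hX.ae_summable_sq hε hp hGm hG hs hs1 hGs hr0 hr1
  have harch : ∀ᵐ ω ∂P, ∀ t : ℤ,
      HasSum (fun i : ℕ => coeff θ (i + 1) * X (t - 1 - i) ω ^ 2) (σ t ω ^ 2 - coeff θ 0) := by
    filter_upwards [hsumm, ae_all_iff.2 hX.volatility] with ω h1 h2 t
    exact hasSum_coeff_of_recursion hθ0 hsum hC₀ hr0 hr1 hβr hgeo
      (V := fun t => σ t ω ^ 2) (Y := fun t => X t ω ^ 2) (fun _ => sq_nonneg _)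
      (fun _ => sq_nonneg _) h2 (fun t => (h1 t).2) (fun t => (h1 t).1) t
  have hfn : ∀ᵐ y ∂(pastLaw ε P), 0 ≤ f y := by
    rw [pastLaw, ae_map_iff (hε.measurable_past 0).aemeasurable
      (measurableSet_le measurable_const hfm)]
    filter_upwards [hY] with ω h
    rw [← h]
    exact sq_nonneg _
  have hvf : ∀ i : ℕ, ∀ᵐ y ∂(pastLaw ε P),
      coeff θ 0 + coeff θ (i + 1) * f (fun k => y (k + i)) ≤ v y := by
    intro i
    have hfi : Measurable fun y : ℕ → ℝ => f fun k => y (k + i) := hfm.comp (measurable_shift i)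
    rw [pastLaw, ae_map_iff (hε.measurable_past 0).aemeasurable
      (measurableSet_le ((hfi.const_mul _).const_add _) hvm)]
    filter_upwards [hY, hV, harch] with ω h1 h2 h3
    -- At t = 1 the past that determines σ_t² is `past ε 0`, whose law is `pastLaw` by definition.
    have h4 := h2 1
    rw [sub_self] at h4
    have h5 := (h3 1).summable.le_tsum i fun j _ =>
      mul_nonneg (coeff_succ_nonneg hθ0 j) (sq_nonneg _)
    rw [(h3 1).tsum_eq, h1, sub_self] at h5
    rw [past_shift ε 0 i ω, ← h4]
    linarith
  have hfs : ∫⁻ y, ENNReal.ofReal (f y ^ s) ∂(pastLaw ε P) < ⊤ := by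
    refine lt_of_le_of_lt (lintegral_mono_ae ?_) hGs
    filter_upwards [hfn] with y h
    exact ENNReal.ofReal_le_ofReal (Real.rpow_le_rpow h
      ((le_abs_self _).trans (norm_le_pi_norm (G y) _)) hs.le)
  obtain ⟨hUs, hUi⟩ := integrable_majorant hε hfm hvm hc hc0 hC₀ hr0 hgeo hs hs1 hψ1.le hψr
    hfn hvf hfs
  have hfn' : ∀ᵐ y ∂(pastLaw ε P), ∀ i, 0 ≤ lagSq f y i := by
    refine ae_all_iff.2 fun i => ?_
    cases i with
    | zero => exact ae_of_all _ fun _ => zero_le_one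
    | succ i => exact (hε.measurePreserving_shift i).quasiMeasurePreserving.ae hfn
  have hv0 : ∀ᵐ y ∂(pastLaw ε P), 0 < v y := by
    filter_upwards [hvf 0, hfn] with y h1 h2
    have := mul_nonneg (hc 1) h2
    exact lt_of_lt_of_le (by simpa using (by positivity : 0 < coeff θ 0 + coeff θ 1 * f y)) h1
  have hgl : ∀ᵐ y ∂(pastLaw ε P), ∀ l,
      Summable (fun i => coeffDeriv θ (Pi.single l 1) i * lagSq f y i / v y) ∧
        |logDeriv θ f v l y| ≤ C₁ * majorant ψ θ f v y := by
    filter_upwards [hfn', hv0, hUs] with y h1 h2 h3 l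
    exact abs_logDeriv_le hC₁.le hψ1.le h1 h2 hc h3 l (hsingle l)
  have hglm := measurable_logDeriv (θ := θ) hfm hvm
  have hgli : ∀ l, Integrable (logDeriv θ f v l) (pastLaw ε P) := by
    intro l
    refine (hUi.const_mul C₁).mono' (hglm l).aestronglyMeasurable ?_
    filter_upwards [hgl] with y h
    exact (h l).2
  -- The three bounds serve the Taylor expansion, the nonnegativity of θ + d, and the inequality
  -- c_0(θ + d) ≥ c_0(θ)/2, which keeps the truncated variance away from 0.
  set κ := min κ₀ (min lo (1 / (2 * C₁))) with hκ
  set K := C₀ * (1 + C₁ * κ) with hK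
  have hκ0 : 0 < κ := lt_min hκ₀ (lt_min hlo (by positivity))
  have hK0 : 0 < K := by positivity
  have hpast : ∀ {Q : (ℕ → ℝ) → Prop}, (∀ᵐ y ∂(pastLaw ε P), Q y) →
      ∀ᵐ ω ∂P, ∀ t : ℕ, Q (past ε ((t : ℤ) - 1) ω) := fun h => ae_all_iff.2 fun t =>
    (hε.measurePreserving_past _).quasiMeasurePreserving.ae h
  refine ⟨majorant ψ θ f v, logDeriv θ f v, fun ω => ∑' i : ℕ, R ^ i * X (-i) ω ^ 2,
    2 / coeff θ 0 + C₁ + C₁ ^ 2 + K + K / coeff θ 0, κ, R, measurable_majorant hfm hvm, hUi,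
    fun l => ⟨hglm l, hgli l⟩,
    Measurable.tsum fun i => ((hX.measurable_X _).pow_const 2).const_mul _, by positivity, hκ0,
    hR0, hR1, ?_⟩
  have hsummR := hX.ae_summable_sq hε hp hGm hG hs hs1 hGs hR0 hR1
  filter_upwards [hY, hV, harch, hsummR, hpast hUs, hpast hfn', hpast hgl, ae_all_iff.2 hX.nonneg,
    ae_all_iff.2 hX.observation] with ω hY hV harch hsR hU hf0 hgl hσ0 hobs
  have hξ0 : 0 ≤ ∑' i : ℕ, R ^ i * X (-i) ω ^ 2 := tsum_nonneg fun i => by positivity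
  have hVc : ∀ t : ℤ, coeff θ 0 ≤ σ t ω ^ 2 := by
    intro t
    have := (harch t).nonneg fun i => mul_nonneg (coeff_succ_nonneg hθ0 i) (sq_nonneg _)
    linarith
  refine ⟨hξ0, fun t => ?_⟩
  have hV0 : 0 < σ t ω ^ 2 := hc0.trans_le (hVc t)
  have hσ : 0 < σ t ω := by
    rcases (hσ0 t).eq_or_lt with h | h
    · rw [← h] at hV0; simp at hV0
    · exact h
  set y := past ε ((t : ℤ) - 1) ω with hy
  have hlag : ∀ i : ℕ, lagSq f y (i + 1) = X ((t : ℤ) - 1 - i) ω ^ 2 := by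
    intro i
    rw [hY, lagSq, hy, past_shift]
  have hU0 : 0 ≤ majorant ψ θ f v y := by
    refine tsum_nonneg fun i => mul_nonneg (by positivity) (div_nonneg
      (mul_nonneg (hc i) (hf0 t i)) ?_)
    rw [← hV t]
    exact hV0.le
  refine ⟨hU0, hσ, hobs t, fun d hd => ?_⟩
  have hd1 : ‖d‖ ≤ κ₀ := hd.trans (min_le_left _ _)
  have hd2 : ‖d‖ ≤ lo := hd.trans ((min_le_right _ _).trans (min_le_left _ _))
  have hd3 : ‖d‖ ≤ 1 / (2 * C₁) := hd.trans ((min_le_right _ _).trans (min_le_right _ _))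
  have hθd : ∀ l, 0 ≤ (θ + d) l := by
    intro l
    have h1 := (abs_le.1 (norm_le_pi_norm d l)).1
    have h2 := hθlo l
    rw [Pi.add_apply]
    linarith
  have hsum0 : HasSum (fun i => coeff θ i * lagSq f y i) (v y) := by
    rw [← hasSum_nat_add_iff' 1, Finset.sum_range_one, ← hV t]
    simp only [hlag]
    simpa [lagSq] using harch t
  obtain ⟨hFs, hF1, hF2, hF3⟩ := variance_taylor hC₁.le hψ1.le (by rw [← hV t]; exact hV0) (hf0 t)
    hc hsum0 (hU t) (htaylor d hd1) fun l => (hgl t l).1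
  have hcoefR : ∀ i, |coeff (θ + d) i| ≤ K * R ^ i := by
    intro i
    have h1 := (htaylor d hd1 i).1
    have h2 : 1 ≤ ψ ^ i := one_le_pow₀ hψ1.le
    have h3 := hc i
    calc |coeff (θ + d) i| ≤ |coeff θ i| + |coeff (θ + d) i - coeff θ i| := by
          have := abs_add_le (coeff θ i) (coeff (θ + d) i - coeff θ i)
          rwa [add_sub_cancel] at this
      _ ≤ ψ ^ i * coeff θ i + C₁ * κ * ψ ^ i * coeff θ i := by
          rw [abs_of_nonneg h3]
          refine add_le_add (le_mul_of_one_le_left h3 h2) (h1.trans ?_)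
          gcongr
      _ = ψ ^ i * (1 + C₁ * κ) * coeff θ i := by ring
      _ ≤ ψ ^ i * (1 + C₁ * κ) * (C₀ * r ^ i) := by
          have := hgeo i
          gcongr
      _ = K * R ^ i := by rw [hK, hR, mul_pow]; ring
  have htrunc := abs_truncVar_sub_le (X := fun t => X t ω) hR0 hK0.le hcoefR
    (by simpa using (hsR 0).1) t (x := lagSq f y) rfl hlag hFs
  set F := ∑' i, coeff (θ + d) i * lagSq f y i with hF
  set T := truncVar (θ + d) (fun s : ℕ => X s ω) t with hT
  set ξ := ∑' i : ℕ, R ^ i * X (-i) ω ^ 2 with hξ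
  have hM : ∑' i, (ψ ^ 2) ^ i * (coeff θ i * lagSq f y i / v y) = majorant ψ θ f v y := rfl
  change |F / v y - 1 - ∑ l, d l * logDeriv θ f v l y| ≤ _ at hF3
  rw [hM, ← hV t] at hF1 hF2 hF3
  clear_value K
  have hRt : 0 ≤ R ^ t * ξ := by positivity
  have hBV : |(T - F) / σ t ω ^ 2| * σ t ω ^ 2 ≤ K * R ^ t * ξ := by
    rw [abs_div, abs_of_pos hV0, div_mul_cancel₀ _ hV0.ne', abs_sub_comm]
    exact htrunc
  have hKC : 0 ≤ K / coeff θ 0 := by positivity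
  have hcc : 0 < 2 / coeff θ 0 := by positivity
  -- The constant is the sum of all constants needed below, so each estimate holds with one of its
  -- summands.
  have hmono : ∀ a b : ℝ, 0 ≤ b → a ≤ 2 / coeff θ 0 + C₁ + C₁ ^ 2 + K + K / coeff θ 0 →
      a * b ≤ (2 / coeff θ 0 + C₁ + C₁ ^ 2 + K + K / coeff θ 0) * b := fun a b h1 h2 =>
    mul_le_mul_of_nonneg_right h2 h1
  refine ⟨F / σ t ω ^ 2 - 1, (T - F) / σ t ω ^ 2, ?_, ?_, ?_, ?_, ?_, ?_, ?_⟩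
  · have h1 := (htaylor d hd1 0).1
    have h2 : coeff θ 0 / 2 ≤ coeff (θ + d) 0 := by
      have h3 := (abs_le.1 h1).1
      have h4 : C₁ * ‖d‖ ≤ 1 / 2 := by
        rw [le_div_iff₀ (by positivity)] at hd3
        linarith
      rw [pow_zero, mul_one] at h3
      nlinarith
    refine le_trans ?_ (h2.trans (coeff_zero_le_truncVar hθd _ t))
    rw [inv_le_comm₀ (by positivity) (by positivity)]
    rw [inv_div]
    linarith [sq_nonneg C₁]
  · ring
  · refine hF1.trans ?_
    rw [mul_assoc, mul_assoc]
    exact hmono _ _ (by positivity) (by linarith)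
  · refine hF2.trans ?_
    rw [mul_assoc, mul_assoc]
    exact hmono _ _ (by positivity) (by linarith [sq_nonneg C₁])
  · refine hF3.trans ?_
    rw [mul_assoc, mul_assoc]
    exact hmono _ _ (by positivity) (by linarith [sq_nonneg C₁])
  · rw [mul_assoc]
    have h1 : |(T - F) / σ t ω ^ 2| ≤ K / coeff θ 0 * (R ^ t * ξ) := by
      rw [div_mul_eq_mul_div, le_div_iff₀ hc0, ← mul_assoc]
      exact (mul_le_mul_of_nonneg_left (hVc t) (abs_nonneg _)).trans hBV
    exact h1.trans (hmono _ _ hRt (by linarith [sq_nonneg C₁]))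
  · refine hBV.trans ?_
    rw [mul_assoc, mul_assoc]
    exact hmono _ _ hRt (by linarith [sq_nonneg C₁])

end Expansion

end GARCH

namespace GARCH

/-! ### Elementary remainder estimates -/

section Powers

/-- Induction on k, multiplying the remainder by x + d. For k ≤ 1 the left side is 0, so the
truncated exponents are harmless. -/
lemma abs_add_pow_sub_pow_sub_le (k : ℕ) (x d : ℝ) :
    |(x + d) ^ k - x ^ k - k * x ^ (k - 1) * d| ≤ k ^ 2 * d ^ 2 * (|x| + |d|) ^ (k - 2) := by
  rcases k with _ | _ | k
  · simp only [pow_zero, CharP.cast_eq_zero, zero_mul, sub_self, abs_zero]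
    positivity
  · simp [sq_nonneg]
  have e1 : k + 1 + 1 - 1 = k + 1 := rfl
  have e2 : k + 1 + 1 - 2 = k := rfl
  rw [e1, e2]
  set B := |x| + |d| with hB
  have hB0 : 0 ≤ B := by positivity
  have hx : |x| ≤ B := le_add_of_nonneg_right (abs_nonneg d)
  have hxd : |x + d| ≤ B := abs_add_le x d
  induction k with
  | zero =>
    have : (x + d) ^ (0 + 1 + 1) - x ^ (0 + 1 + 1) - ((0 + 1 + 1 : ℕ) : ℝ) * x ^ (0 + 1) * d
        = d ^ 2 := by push_cast; ring
    rw [this, abs_of_nonneg (sq_nonneg d)]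
    push_cast
    nlinarith [sq_nonneg d]
  | succ k ih =>
    specialize ih rfl rfl
    have h1 : (x + d) ^ (k + 1 + 1 + 1) - x ^ (k + 1 + 1 + 1)
        - ((k + 1 + 1 + 1 : ℕ) : ℝ) * x ^ (k + 1 + 1) * d
        = (x + d) * ((x + d) ^ (k + 1 + 1) - x ^ (k + 1 + 1)
          - ((k + 1 + 1 : ℕ) : ℝ) * x ^ (k + 1) * d)
          + ((k + 1 + 1 : ℕ) : ℝ) * x ^ (k + 1) * d ^ 2 := by
      push_cast
      ring
    rw [h1]
    refine (abs_add_le _ _).trans ?_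
    rw [abs_mul, abs_mul, abs_mul, abs_of_nonneg (sq_nonneg d), abs_pow, Nat.abs_cast]
    calc |x + d| * |(x + d) ^ (k + 1 + 1) - x ^ (k + 1 + 1)
          - ((k + 1 + 1 : ℕ) : ℝ) * x ^ (k + 1) * d|
          + ((k + 1 + 1 : ℕ) : ℝ) * |x| ^ (k + 1) * d ^ 2
        ≤ B * (((k + 1 + 1 : ℕ) : ℝ) ^ 2 * d ^ 2 * B ^ k)
          + ((k + 1 + 1 : ℕ) : ℝ) * B ^ (k + 1) * d ^ 2 := by gcongr
      _ = (((k + 1 + 1 : ℕ) : ℝ) ^ 2 + ((k + 1 + 1 : ℕ) : ℝ)) * (d ^ 2 * B ^ (k + 1)) := by ring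
      _ ≤ ((k + 1 + 1 + 1 : ℕ) : ℝ) ^ 2 * (d ^ 2 * B ^ (k + 1)) := by
          refine mul_le_mul_of_nonneg_right ?_ (by positivity)
          push_cast
          nlinarith [(Nat.cast_nonneg k : (0 : ℝ) ≤ k)]
      _ = _ := by ring

/-- With y = √(1 + a) both bounds are polynomial inequalities in y. The factor y⁻¹ stays because a
may come close to -1; in the application it is the weight w, which is bounded separately. -/
lemma abs_inv_sqrt_one_add_sub {a : ℝ} (ha : -1 < a) :
    |(√(1 + a))⁻¹ - 1| ≤ |a| * (√(1 + a))⁻¹ ∧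
      |(√(1 + a))⁻¹ - 1 + a / 2| ≤ a ^ 2 * (√(1 + a))⁻¹ := by
  set y := √(1 + a) with hy
  have hy0 : 0 < y := Real.sqrt_pos.2 (by linarith)
  have hya : a = y ^ 2 - 1 := by rw [hy, Real.sq_sqrt (by linarith)]; ring
  have hyi : 0 < y⁻¹ := inv_pos.2 hy0
  constructor
  · have : y⁻¹ - 1 = (1 - y) * y⁻¹ := by field_simp
    rw [this, abs_mul, abs_of_pos hyi]
    refine mul_le_mul_of_nonneg_right ?_ hyi.le
    rw [hya, show y ^ 2 - 1 = (1 - y) * (-(y + 1)) by ring, abs_mul, abs_neg]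
    refine le_mul_of_one_le_right (abs_nonneg _) ?_
    rw [abs_of_pos (by linarith)]
    linarith
  · have : y⁻¹ - 1 + a / 2 = (y - 1) ^ 2 * (y + 2) / 2 * y⁻¹ := by
      rw [hya]
      field_simp
      ring
    rw [this, abs_of_nonneg (by positivity)]
    refine mul_le_mul_of_nonneg_right ?_ hyi.le
    rw [hya]
    have h : 0 ≤ (y - 1) ^ 2 := sq_nonneg _
    nlinarith [mul_nonneg h (by nlinarith : 0 ≤ (y + 1) ^ 2 - (y + 2) / 2)]

end Powers

/-! ### Self-normalized power sums of a perturbed array -/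

section Perturbation

open Asymptotics Finset

variable {ι : Type*} {l : Filter ι} {n : ι → ℕ}

lemma isLittleO_sum_of_abs_le {z y : ι → ℕ → ℝ} {m : ι → ℕ} {f : ι → ℝ} (hm : ∀ x, m x ≤ n x)
    (h : ∀ᶠ x in l, ∀ t ∈ Icc 1 (n x), |z x t| ≤ y x t)
    (hy : (fun x => ∑ t ∈ Icc 1 (n x), y x t) =o[l] f) :
    (fun x => ∑ t ∈ Icc 1 (m x), z x t) =o[l] f := by
  refine IsBigO.trans_isLittleO (IsBigO.of_bound 1 ?_) hy
  filter_upwards [h] with x hx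
  rw [one_mul, Real.norm_eq_abs, Real.norm_eq_abs]
  have hsub : Icc 1 (m x) ⊆ Icc 1 (n x) := Icc_subset_Icc le_rfl (hm x)
  calc |∑ t ∈ Icc 1 (m x), z x t| ≤ ∑ t ∈ Icc 1 (m x), |z x t| := abs_sum_le_sum_abs _ _
    _ ≤ ∑ t ∈ Icc 1 (n x), |z x t| := sum_le_sum_of_subset_of_nonneg hsub fun _ _ _ => abs_nonneg _
    _ ≤ ∑ t ∈ Icc 1 (n x), y x t := sum_le_sum hx
    _ ≤ _ := le_abs_self _

/-- An array of residuals `e w`, where the weights `w` are perturbations of `1`, to the first order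
`1 - a / 2`, and the `a` have the same averages as a sequence of mean `lam` independent of `e`;
`mom` are the moments of `e`. -/
structure IsPerturbation (l : Filter ι) (n : ι → ℕ) (e w a : ι → ℕ → ℝ) (lam : ι → ℝ)
    (mom : ℕ → ℝ) (K : ℕ) (M : ℝ) : Prop where
  tendsto : Tendsto n l atTop
  bound : ∀ᶠ x in l, ∀ t ∈ Icc 1 (n x), 0 ≤ w x t ∧ w x t ≤ M ∧
    |w x t - 1| ≤ |a x t| * w x t ∧ |w x t - 1 + a x t / 2| ≤ a x t ^ 2 * w x t
  sum_sq : (fun x => ∑ t ∈ Icc 1 (n x), (1 + |e x t|) ^ K * a x t ^ 2) =o[l] fun x => √(n x)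
  sum_abs : (fun x => ∑ t ∈ Icc 1 (n x), (1 + |e x t|) ^ K * |a x t|) =O[l] fun x => √(n x)
  sum_pow : (fun x => ∑ t ∈ Icc 1 (n x), (1 + |e x t|) ^ K) =O[l] fun x => (n x : ℝ)
  lam_bound : lam =O[l] fun x => (√(n x))⁻¹
  linear : ∀ j, 1 ≤ j → j ≤ K → ∀ m : ι → ℕ, (∀ x, m x ≤ n x) →
    (fun x => ∑ t ∈ Icc 1 (m x), e x t ^ j * a x t - m x * mom j * lam x) =o[l] fun x => √(n x)
  moment : ∀ j, 1 ≤ j → j ≤ K → ∀ m : ι → ℕ, (∀ x, m x ≤ n x) →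
    (fun x => ∑ t ∈ Icc 1 (m x), e x t ^ j - m x * mom j) =o[l] fun x => (n x : ℝ)
  mom_one : mom 1 = 0
  mom_two : mom 2 = 1

namespace IsPerturbation

variable {e w a : ι → ℕ → ℝ} {lam : ι → ℝ} {mom : ℕ → ℝ} {K : ℕ} {M : ℝ}

lemma tendsto_sqrt (h : IsPerturbation l n e w a lam mom K M) :
    Tendsto (fun x => √(n x : ℝ)) l atTop :=
  Real.tendsto_sqrt_atTop.comp (tendsto_natCast_atTop_atTop.comp h.tendsto)

lemma abs_pow_le_pow {r : ℝ} {j : ℕ} (hj : j ≤ K) : |r| ^ j ≤ (1 + |r|) ^ K := by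
  have h0 := abs_nonneg r
  exact (pow_le_pow_left₀ h0 (by linarith) j).trans (pow_le_pow_right₀ (by linarith) hj)

/-- Replacing w - 1 by -a/2 costs at most a² w, which is negligible by `sum_sq`. The linear term is
then evaluated by `linear`. -/
lemma sum_pow_mul_sub (h : IsPerturbation l n e w a lam mom K M) {j : ℕ} (hj : 1 ≤ j)
    (hjK : j ≤ K) {m : ι → ℕ} (hm : ∀ x, m x ≤ n x) :
    (fun x => ∑ t ∈ Icc 1 (m x), e x t ^ (j - 1) * (e x t * w x t - e x t)
      + m x * mom j * lam x / 2) =o[l] fun x => √(n x) := by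
  have h1 : (fun x => ∑ t ∈ Icc 1 (m x), e x t ^ j * (w x t - 1 + a x t / 2))
      =o[l] fun x => √(n x) := by
    refine isLittleO_sum_of_abs_le hm (y := fun x t => M * ((1 + |e x t|) ^ K * a x t ^ 2)) ?_ ?_
    · filter_upwards [h.bound] with x hx t ht
      obtain ⟨hw0, hw, -, h2⟩ := hx t ht
      rw [abs_mul, abs_pow]
      calc |e x t| ^ j * |w x t - 1 + a x t / 2| ≤ (1 + |e x t|) ^ K * (a x t ^ 2 * M) := by
            have h3 : a x t ^ 2 * w x t ≤ a x t ^ 2 * M :=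
              mul_le_mul_of_nonneg_left hw (sq_nonneg _)
            exact mul_le_mul (abs_pow_le_pow hjK) (h2.trans h3) (abs_nonneg _) (by positivity)
        _ = _ := by ring
    · simp_rw [← mul_sum]
      exact h.sum_sq.const_mul_left M
  refine (h1.sub ((h.linear j hj hjK m hm).const_mul_left (1 / 2))).congr_left fun x => ?_
  have h2 : ∑ t ∈ Icc 1 (m x), e x t ^ j * (w x t - 1 + a x t / 2)
      = ∑ t ∈ Icc 1 (m x), e x t ^ (j - 1) * (e x t * w x t - e x t)
        + 1 / 2 * ∑ t ∈ Icc 1 (m x), e x t ^ j * a x t := by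
    rw [mul_sum, ← sum_add_distrib]
    refine sum_congr rfl fun t _ => ?_
    obtain ⟨i, rfl⟩ : ∃ i, j = i + 1 := ⟨j - 1, by omega⟩
    rw [Nat.add_sub_cancel]
    ring
  rw [h2]
  ring

/-- The perturbation of the sample mean. -/
lemma sampleMean_sub (h : IsPerturbation l n e w a lam mom K M) (hK : 1 ≤ K) :
    (fun x => sampleMean (fun t => e x t * w x t) (n x) - sampleMean (e x) (n x))
      =o[l] fun x => (√(n x))⁻¹ := by
  have h1 := h.sum_pow_mul_sub le_rfl hK fun x => le_refl (n x)
  have h2 := h1.mul_isBigO (isBigO_refl (fun x => (n x : ℝ)⁻¹) l)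
  refine h2.congr (fun x => ?_) fun x => ?_
  · simp only [h.mom_one, sampleMean, Nat.sub_self, pow_zero, one_mul, sum_sub_distrib]
    ring
  · rw [← div_eq_mul_inv, Real.sqrt_div_self]

lemma tendsto_sampleMean (h : IsPerturbation l n e w a lam mom K M) (hK : 1 ≤ K) :
    Tendsto (fun x => sampleMean (e x) (n x)) l (𝓝 0) := by
  have h1 := (h.moment 1 le_rfl hK n fun x => le_rfl).tendsto_div_nhds_zero
  refine h1.congr fun x => ?_
  simp [sampleMean, h.mom_one]

lemma abs_pow_sub_pow_le_pow {r μ : ℝ} (hμ : |μ| ≤ 1) (j : ℕ) :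
    |(r - μ) ^ j - r ^ j| ≤ j * |μ| * (1 + |r|) ^ (j - 1) := by
  refine (abs_pow_sub_pow_le (r - μ) r j).trans ?_
  have h1 : |r - μ| ≤ 1 + |r| := (abs_sub _ _).trans (by linarith)
  rw [sub_sub_cancel_left, abs_neg, mul_comm |μ|]
  have : max |r - μ| |r| ≤ 1 + |r| := max_le h1 (by linarith)
  gcongr

/-- The centered sums of the unperturbed array. -/
lemma sum_centered_pow (h : IsPerturbation l n e w a lam mom K M) {j : ℕ} (hj : 1 ≤ j)
    (hjK : j ≤ K) {m : ι → ℕ} (hm : ∀ x, m x ≤ n x) :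
    (fun x => ∑ t ∈ Icc 1 (m x), (e x t - sampleMean (e x) (n x)) ^ j - m x * mom j)
      =o[l] fun x => (n x : ℝ) := by
  have hμ := h.tendsto_sampleMean (hj.trans hjK)
  have h1 : (fun x => ∑ t ∈ Icc 1 (m x), ((e x t - sampleMean (e x) (n x)) ^ j - e x t ^ j))
      =o[l] fun x => (n x : ℝ) := by
    refine isLittleO_sum_of_abs_le hm
      (y := fun x t => j * |sampleMean (e x) (n x)| * (1 + |e x t|) ^ K) ?_ ?_
    · filter_upwards [hμ.abs.eventually_le_const (u := 1) (by simp)] with x hx t _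
      refine (abs_pow_sub_pow_le_pow hx j).trans ?_
      have : (1 + |e x t|) ^ (j - 1) ≤ (1 + |e x t|) ^ K :=
        pow_le_pow_right₀ (by linarith [abs_nonneg (e x t)]) (by omega)
      gcongr
    · simp_rw [← mul_sum]
      have h2 : (fun x => j * |sampleMean (e x) (n x)|) =o[l] fun _ => (1 : ℝ) := by
        rw [isLittleO_one_iff]
        simpa using hμ.abs.const_mul (j : ℝ)
      simpa using h2.mul_isBigO h.sum_pow
  refine (h1.add (h.moment j hj hjK m hm)).congr_left fun x => ?_
  rw [sum_sub_distrib]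
  ring

lemma one_add_abs_pow_le {r : ℝ} {i : ℕ} (hi : i ≤ K) : (1 + |r|) ^ i ≤ (1 + |r|) ^ K :=
  pow_le_pow_right₀ (by linarith [abs_nonneg r]) hi

/-- The perturbation of the centered sums. -/
lemma sum_centered_pow_sub (h : IsPerturbation l n e w a lam mom K M) (hM : 0 ≤ M) (hK : 2 ≤ K)
    {j : ℕ} (hj : 1 ≤ j) (hjK : j ≤ K) {m : ι → ℕ} (hm : ∀ x, m x ≤ n x) :
    (fun x => ∑ t ∈ Icc 1 (m x),
        (e x t * w x t - sampleMean (fun t => e x t * w x t) (n x)) ^ j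
      - ∑ t ∈ Icc 1 (m x), (e x t - sampleMean (e x) (n x)) ^ j
      + j / 2 * (m x * mom j * lam x)) =o[l] fun x => √(n x) := by
  have hK1 : 1 ≤ K := by omega
  set μ : ι → ℝ := fun x => sampleMean (e x) (n x) with hμdef
  -- The shift of the sample mean. It is o(n^(-1/2)) because the first moment vanishes, so ν times
  -- any sum of size O(n) is negligible.
  set ν : ι → ℝ := fun x => sampleMean (fun t => e x t * w x t) (n x) - μ x with hνdef
  have hμ : Tendsto μ l (𝓝 0) := h.tendsto_sampleMean hK1
  have hν : ν =o[l] fun x => (√(n x))⁻¹ := h.sampleMean_sub hK1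
  have hS : Tendsto (fun x => (√(n x : ℝ))⁻¹) l (𝓝 0) := tendsto_inv_atTop_zero.comp h.tendsto_sqrt
  have hν0 : Tendsto ν l (𝓝 0) := hν.isBigO.trans_tendsto hS
  have hνD : (fun x => |ν x| * ∑ t ∈ Icc 1 (n x), (1 + |e x t|) ^ K) =o[l] fun x => √(n x) := by
    refine (hν.abs_left.mul_isBigO h.sum_pow).congr_right fun x => ?_
    rw [inv_mul_eq_div, Real.div_sqrt]
  have hν2D : (fun x => ν x ^ 2 * ∑ t ∈ Icc 1 (n x), (1 + |e x t|) ^ K)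
      =o[l] fun x => √(n x) := by
    have h1 : (fun x => |ν x|) =o[l] fun _ => (1 : ℝ) := by
      rw [isLittleO_one_iff]
      simpa using hν0.abs
    refine (h1.mul hνD).congr (fun x => ?_) fun x => one_mul _
    rw [← mul_assoc, ← sq, sq_abs]
  have hev : ∀ᶠ x in l, |μ x| ≤ 1 ∧ |ν x| ≤ 1 :=
    (hμ.abs.eventually_le_const (u := 1) (by simp)).and
      (hν0.abs.eventually_le_const (u := 1) (by simp))
  have hδ : ∀ᶠ x in l, ∀ t ∈ Icc 1 (n x),
      |e x t * w x t - e x t| ≤ M * (|e x t| * |a x t|) := by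
    filter_upwards [h.bound] with x hx t ht
    obtain ⟨hw0, hw, h1, -⟩ := hx t ht
    have h2 : |w x t - 1| ≤ |a x t| * M := h1.trans (mul_le_mul_of_nonneg_left hw (abs_nonneg _))
    rw [show e x t * w x t - e x t = e x t * (w x t - 1) by ring, abs_mul]
    calc |e x t| * |w x t - 1| ≤ |e x t| * (|a x t| * M) := by gcongr
      _ = _ := by ring
  -- The perturbed centered term is (e - μ) + δ. Its j-th power is expanded in δ: `hrem` bounds the
  -- quadratic remainder, `hcross` replaces (e - μ)^(j-1) by e^(j-1) in the linear term, and `hmean`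
  -- removes ν. What remains is the sum treated in `sum_pow_mul_sub`.
  set δ : ι → ℕ → ℝ := fun x t => e x t * w x t - e x t - ν x with hδdef
  have hrem : (fun x => ∑ t ∈ Icc 1 (m x), ((e x t - μ x + δ x t) ^ j - (e x t - μ x) ^ j
      - j * (e x t - μ x) ^ (j - 1) * δ x t)) =o[l] fun x => √(n x) := by
    refine isLittleO_sum_of_abs_le hm (y := fun x t => j ^ 2 * (2 * (4 + M) ^ (j - 2))
      * (M ^ 2 * ((1 + |e x t|) ^ K * a x t ^ 2) + ν x ^ 2 * (1 + |e x t|) ^ K)) ?_ ?_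
    · filter_upwards [hδ, hev, h.bound] with x hx1 ⟨hx2, hx3⟩ hx4 t ht
      obtain ⟨hw0, hw, -, -⟩ := hx4 t ht
      have he := abs_nonneg (e x t)
      refine (abs_add_pow_sub_pow_sub_le j _ _).trans ?_
      have hB : |e x t - μ x| + |δ x t| ≤ (4 + M) * (1 + |e x t|) := by
        have h1 : |e x t - μ x| ≤ |e x t| + 1 := (abs_sub _ _).trans (by linarith)
        have h2 : |δ x t| ≤ |e x t| * M + |e x t| + 1 := by
          refine (abs_sub _ _).trans (add_le_add ((abs_sub _ _).trans (add_le_add ?_ le_rfl)) hx3)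
          rw [abs_mul, abs_of_nonneg hw0]
          gcongr
        nlinarith
      have hδ2 : δ x t ^ 2 ≤ 2 * (M ^ 2 * (|e x t| ^ 2 * a x t ^ 2) + ν x ^ 2) := by
        have h1 := hx1 t ht
        have h2 : (e x t * w x t - e x t) ^ 2 ≤ M ^ 2 * (|e x t| ^ 2 * a x t ^ 2) := by
          rw [← sq_abs]
          refine (pow_le_pow_left₀ (abs_nonneg _) h1 2).trans (le_of_eq ?_)
          rw [mul_pow, mul_pow, sq_abs (a x t)]
        have h3 : δ x t ^ 2 ≤ 2 * (e x t * w x t - e x t) ^ 2 + 2 * ν x ^ 2 := by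
          rw [hδdef]
          nlinarith [sq_nonneg (e x t * w x t - e x t + ν x)]
        linarith
      have hp1 : (1 + |e x t|) ^ (j - 2) ≤ (1 + |e x t|) ^ K := one_add_abs_pow_le (by omega)
      have hp2 : |e x t| ^ 2 * (1 + |e x t|) ^ (j - 2) ≤ (1 + |e x t|) ^ K := by
        calc |e x t| ^ 2 * (1 + |e x t|) ^ (j - 2)
            ≤ (1 + |e x t|) ^ 2 * (1 + |e x t|) ^ (j - 2) := by gcongr; linarith
          _ = (1 + |e x t|) ^ (2 + (j - 2)) := (pow_add _ _ _).symm
          _ ≤ _ := one_add_abs_pow_le (by omega)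
      calc (j : ℝ) ^ 2 * δ x t ^ 2 * (|e x t - μ x| + |δ x t|) ^ (j - 2)
          ≤ (j : ℝ) ^ 2 * (2 * (M ^ 2 * (|e x t| ^ 2 * a x t ^ 2) + ν x ^ 2))
            * ((4 + M) * (1 + |e x t|)) ^ (j - 2) := by gcongr
        _ = j ^ 2 * (2 * (4 + M) ^ (j - 2)) * (M ^ 2 * ((|e x t| ^ 2
            * (1 + |e x t|) ^ (j - 2)) * a x t ^ 2) + ν x ^ 2 * (1 + |e x t|) ^ (j - 2)) := by
            rw [mul_pow]; ring
        _ ≤ _ := by gcongr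
    · simp_rw [← mul_sum, sum_add_distrib, ← mul_sum]
      exact ((h.sum_sq.const_mul_left _).add hν2D).const_mul_left _
  have hcross : (fun x => ∑ t ∈ Icc 1 (m x), ((e x t - μ x) ^ (j - 1) - e x t ^ (j - 1)) * δ x t)
      =o[l] fun x => √(n x) := by
    refine isLittleO_sum_of_abs_le hm (y := fun x t => (j - 1 : ℕ) * |μ x|
      * (M * ((1 + |e x t|) ^ K * |a x t|) + |ν x| * (1 + |e x t|) ^ K)) ?_ ?_
    · filter_upwards [hδ, hev] with x hx1 ⟨hx2, hx3⟩ t ht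
      have h1 := abs_pow_sub_pow_le_pow (r := e x t) hx2 (j - 1)
      have h2 : |δ x t| ≤ M * (|e x t| * |a x t|) + |ν x| :=
        (abs_sub _ _).trans (add_le_add (hx1 t ht) le_rfl)
      have hp1 : (1 + |e x t|) ^ (j - 1 - 1) ≤ (1 + |e x t|) ^ K := one_add_abs_pow_le (by omega)
      have hp2 : |e x t| * (1 + |e x t|) ^ (j - 1 - 1) ≤ (1 + |e x t|) ^ K := by
        calc |e x t| * (1 + |e x t|) ^ (j - 1 - 1)
            ≤ (1 + |e x t|) * (1 + |e x t|) ^ (j - 1 - 1) := by gcongr; linarith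
          _ = (1 + |e x t|) ^ (j - 1 - 1 + 1) := (pow_succ' _ _).symm
          _ ≤ _ := one_add_abs_pow_le (by omega)
      rw [abs_mul]
      calc |(e x t - μ x) ^ (j - 1) - e x t ^ (j - 1)| * |δ x t|
          ≤ ((j - 1 : ℕ) * |μ x| * (1 + |e x t|) ^ (j - 1 - 1))
            * (M * (|e x t| * |a x t|) + |ν x|) := by gcongr
        _ = (j - 1 : ℕ) * |μ x| * (M * ((|e x t| * (1 + |e x t|) ^ (j - 1 - 1)) * |a x t|)
            + |ν x| * (1 + |e x t|) ^ (j - 1 - 1)) := by ring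
        _ ≤ _ := by gcongr
    · simp_rw [← mul_sum, sum_add_distrib, ← mul_sum]
      have h1 : (fun x => ((j - 1 : ℕ) : ℝ) * |μ x|) =o[l] fun _ => (1 : ℝ) := by
        rw [isLittleO_one_iff]
        simpa using hμ.abs.const_mul ((j - 1 : ℕ) : ℝ)
      simpa using h1.mul_isBigO ((h.sum_abs.const_mul_left M).add hνD.isBigO)
  have hmean : (fun x => ν x * ∑ t ∈ Icc 1 (m x), e x t ^ (j - 1)) =o[l] fun x => √(n x) := by
    simp_rw [mul_sum]
    refine isLittleO_sum_of_abs_le hm (y := fun x t => |ν x| * (1 + |e x t|) ^ K) ?_ ?_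
    · refine Eventually.of_forall fun x t _ => ?_
      rw [abs_mul, abs_pow]
      exact mul_le_mul_of_nonneg_left (abs_pow_le_pow (by omega)) (abs_nonneg _)
    · simp_rw [← mul_sum]
      exact hνD
  have hmain := h.sum_pow_mul_sub hj hjK hm
  refine (hrem.add (((hcross.add hmain).sub hmean).const_mul_left (j : ℝ))).congr_left fun x => ?_
  have h1 : ∀ t, e x t * w x t - sampleMean (fun t => e x t * w x t) (n x)
      = e x t - μ x + δ x t := fun t => by simp only [hδdef, hνdef]; ring
  simp_rw [h1]
  have h2 : ∑ t ∈ Icc 1 (m x), ((e x t - μ x) ^ (j - 1) - e x t ^ (j - 1)) * δ x t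
      + ∑ t ∈ Icc 1 (m x), e x t ^ (j - 1) * (e x t * w x t - e x t)
      - ν x * ∑ t ∈ Icc 1 (m x), e x t ^ (j - 1)
      = ∑ t ∈ Icc 1 (m x), (e x t - μ x) ^ (j - 1) * δ x t := by
    rw [mul_sum, ← sum_add_distrib, ← sum_sub_distrib]
    refine sum_congr rfl fun t _ => ?_
    simp only [hδdef]
    ring
  have h3 : ∑ t ∈ Icc 1 (m x), ((e x t - μ x + δ x t) ^ j - (e x t - μ x) ^ j
      - j * (e x t - μ x) ^ (j - 1) * δ x t)
      = ∑ t ∈ Icc 1 (m x), (e x t - μ x + δ x t) ^ j - ∑ t ∈ Icc 1 (m x), (e x t - μ x) ^ j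
        - j * ∑ t ∈ Icc 1 (m x), (e x t - μ x) ^ (j - 1) * δ x t := by
    rw [sum_sub_distrib, sum_sub_distrib, mul_sum]
    simp only [mul_assoc]
  rw [h3, ← h2]
  ring

lemma sampleStd_eq (f : ℕ → ℝ) (N : ℕ) :
    sampleStd f N = √((∑ t ∈ Icc 1 N, (f t - sampleMean f N) ^ 2) / N) := by
  simp [sampleStd, centeredSum]

/-- The derivative of y^(-k/2) at 1. It has to be strict, as it is applied to the difference of two
sample variances that both move with n. -/
lemma hasStrictDerivAt_inv_sqrt_pow (k : ℕ) :
    HasStrictDerivAt (fun y : ℝ => (√y ^ k)⁻¹) (-(k / 2 : ℝ)) 1 := by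
  have h := (hasStrictDerivAt_inv (x := √1 ^ k) (by simp)).comp 1
    ((Real.hasStrictDerivAt_sqrt one_ne_zero).fun_pow k)
  refine h.congr_deriv ?_
  simp
  ring

/-- The self-normalized sums of the perturbed array differ from those of the unperturbed one by a
negligible amount. -/
theorem sum_selfNormalized_sub (h : IsPerturbation l n e w a lam mom K M) (hM : 0 ≤ M)
    (hK : 2 ≤ K) {k : ℕ} (hk : 1 ≤ k) (hkK : k ≤ K) {m : ι → ℕ} (hm : ∀ x, m x ≤ n x) :
    (fun x => (∑ t ∈ Icc 1 (m x),
        (e x t * w x t - sampleMean (fun t => e x t * w x t) (n x)) ^ k)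
          / sampleStd (fun t => e x t * w x t) (n x) ^ k
      - (∑ t ∈ Icc 1 (m x), (e x t - sampleMean (e x) (n x)) ^ k) / sampleStd (e x) (n x) ^ k)
      =o[l] fun x => √(n x) := by
  set φ : ℝ → ℝ := fun y => (√y ^ k)⁻¹ with hφ
  set Q : ℕ → (ι → ℕ) → ι → ℝ := fun j m x =>
    ∑ t ∈ Icc 1 (m x), (e x t - sampleMean (e x) (n x)) ^ j with hQ
  set Qh : ℕ → (ι → ℕ) → ι → ℝ := fun j m x =>
    ∑ t ∈ Icc 1 (m x), (e x t * w x t - sampleMean (fun t => e x t * w x t) (n x)) ^ j with hQh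
  set v : ι → ℝ := fun x => Q 2 n x / n x with hv
  set vh : ι → ℝ := fun x => Qh 2 n x / n x with hvh
  have hS := h.tendsto_sqrt
  have hS0 : Tendsto (fun x => (√(n x : ℝ))⁻¹) l (𝓝 0) := tendsto_inv_atTop_zero.comp hS
  have hpos : ∀ᶠ x in l, (n x : ℝ) ≠ 0 := by
    filter_upwards [h.tendsto.eventually_gt_atTop 0] with x hx
    exact_mod_cast hx.ne'
  have hmO : ∀ c : ℝ, (fun x => (m x : ℝ) * c) =O[l] fun x => (n x : ℝ) := by
    intro c
    refine IsBigO.of_bound |c| (Eventually.of_forall fun x => ?_)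
    rw [norm_mul, Real.norm_natCast, Real.norm_natCast, Real.norm_eq_abs, mul_comm]
    have : (m x : ℝ) ≤ n x := by exact_mod_cast hm x
    gcongr
  have hmlam : (fun x => (m x : ℝ) * mom k * lam x) =O[l] fun x => √(n x) := by
    refine ((hmO (mom k)).mul h.lam_bound).congr_right fun x => ?_
    rw [← div_eq_mul_inv, Real.div_sqrt]
  have hvlim : Tendsto v l (𝓝 1) := by
    have h1 := (h.sum_centered_pow one_le_two hK fun x => le_refl (n x)).tendsto_div_nhds_zero
    have h2 := h1.add_const 1
    rw [zero_add] at h2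
    refine h2.congr' ?_
    filter_upwards [hpos] with x hx
    rw [h.mom_two, mul_one, sub_div, div_self hx, sub_add_cancel]
  -- The case j = 2 of `sum_centered_pow_sub`, divided by n: the sample variance changes by -λ.
  have hdiff : (fun x => vh x - v x + lam x) =o[l] fun x => (√(n x))⁻¹ := by
    have h1 := h.sum_centered_pow_sub hM hK one_le_two hK fun x => le_refl (n x)
    have h2 := h1.mul_isBigO (isBigO_refl (fun x => (n x : ℝ)⁻¹) l)
    refine h2.congr' ?_ (Eventually.of_forall fun x => ?_)
    · filter_upwards [hpos] with x hx
      simp only [hvh, hv, hQh, hQ, h.mom_two]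
      field_simp
      ring
    · change √(n x : ℝ) * (n x : ℝ)⁻¹ = _
      rw [← div_eq_mul_inv, Real.sqrt_div_self]
  have hvhO : (fun x => vh x - v x) =O[l] fun x => (√(n x))⁻¹ :=
    (hdiff.isBigO.sub h.lam_bound).congr_left fun x => by ring
  have hvhlim : Tendsto vh l (𝓝 1) := by
    have h1 := (hvhO.trans_tendsto hS0).add hvlim
    simpa using h1
  have hφd : (fun x => φ (vh x) - φ (v x) - k / 2 * lam x) =o[l] fun x => (√(n x))⁻¹ := by
    have h1 := (hasStrictDerivAt_inv_sqrt_pow k).isLittleO.comp_tendsto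
      (show Tendsto (fun x => (vh x, v x)) l (𝓝 (1, 1)) from hvhlim.prodMk_nhds hvlim)
    have h2 := (h1.trans_isBigO hvhO).sub (hdiff.const_mul_left (k / 2))
    refine h2.congr_left fun x => ?_
    simp [hφ]
    ring
  have hφ1 : Tendsto (fun x => φ (vh x)) l (𝓝 1) := by
    have h1 := (hasStrictDerivAt_inv_sqrt_pow k).hasDerivAt.continuousAt.tendsto.comp hvhlim
    simpa [Function.comp_def, hφ] using h1
  have hφ0 : (fun x => φ (vh x) - 1) =o[l] fun _ => (1 : ℝ) := by
    rw [isLittleO_one_iff]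
    simpa using hφ1.sub_const 1
  have hA := h.sum_centered_pow_sub hM hK hk hkK hm
  have hB := h.sum_centered_pow hk hkK hm
  have hBO : Q k m =O[l] fun x => (n x : ℝ) :=
    (hB.isBigO.add (hmO (mom k))).congr_left fun x => by simp only [hQ]; ring
  have hSinv : ∀ x, (n x : ℝ) * (√(n x))⁻¹ = √(n x) := fun x => by
    rw [← div_eq_mul_inv, Real.div_sqrt]
  -- With normalizers φ̂, φ and μ_k = `mom k`, the identity used is Q̂φ̂ - Qφ = (Q̂ - Q + (k/2) m
  -- μ_k λ) φ̂ - (k/2) m μ_k λ (φ̂ - 1) + Q (φ̂ - φ - (k/2) λ) + (k/2) λ (Q - m μ_k). The four terms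
  -- are all o(√n); the first-order change of the numerator is compensated by that of the
  -- normalizer.
  have t1 := (hA.mul_isBigO (hφ1.isBigO_one ℝ)).congr_right fun x => mul_one _
  have t2 := (hmlam.mul_isLittleO hφ0).congr_right fun x => mul_one _
  have t3 := (hBO.mul_isLittleO hφd).congr_right hSinv
  have t4 := (hB.mul_isBigO h.lam_bound).congr_right hSinv
  refine ((t1.sub (t2.const_mul_left (k / 2))).add (t3.add (t4.const_mul_left (k / 2)))).congr_left
    fun x => ?_
  rw [sampleStd_eq, sampleStd_eq, div_eq_mul_inv, div_eq_mul_inv _ (√_ ^ k)]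
  simp only [hφ, hvh, hv, hQ, hQh]
  ring

end IsPerturbation

end Perturbation

end GARCH

namespace GARCH

/-! ### GARCH residuals as a perturbation of the innovations -/

section Residuals

open Asymptotics Finset

variable {ι : Type*} {l : Filter ι} {n : ι → ℕ} {p q : ℕ} {θ : Param p q}

lemma isBigO_sum_of_abs_le {z y : ι → ℕ → ℝ} {f : ι → ℝ}
    (h : ∀ᶠ x in l, ∀ t ∈ Icc 1 (n x), |z x t| ≤ y x t)
    (hy : (fun x => ∑ t ∈ Icc 1 (n x), y x t) =O[l] f) :
    (fun x => ∑ t ∈ Icc 1 (n x), z x t) =O[l] f := by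
  refine IsBigO.trans (IsBigO.of_bound 1 ?_) hy
  filter_upwards [h] with x hx
  rw [one_mul, Real.norm_eq_abs, Real.norm_eq_abs]
  exact (abs_sum_le_sum_abs _ _).trans ((sum_le_sum hx).trans (le_abs_self _))

/-- The truncation error B need not be small for small t. But V(1 + A) ≥ V/2, and |B| V ≤ Cξ is at
most C²ξ times the truncated variance, which is at least 1/C. -/
lemma HasVarExpansion.div_le {d : Param p q} {x : ℕ → ℝ} {t : ℕ} {V U : ℝ}
    {g : Fin (p + 1) ⊕ Fin q → ℝ} {C R ξ A B : ℝ}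
    (h : HasVarExpansion θ d x t V U g C R ξ A B) (hC : 0 < C) (hR0 : 0 < R) (hR1 : R < 1)
    (hξ : 0 ≤ ξ) (hV : 0 < V) (hA : |A| ≤ 1 / 2) :
    V / truncVar (θ + d) x t ≤ 2 * (1 + C ^ 2 * ξ) := by
  have hT : 0 < truncVar (θ + d) x t := (inv_pos.2 hC).trans_le h.le_truncVar
  have hTC : 1 ≤ C * truncVar (θ + d) x t := by
    have := mul_le_mul_of_nonneg_left h.le_truncVar hC.le
    rwa [mul_inv_cancel₀ hC.ne'] at this
  rw [div_le_iff₀ hT]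
  have h1 : truncVar (θ + d) x t = V * (1 + A + B) := by
    have := h.eq_add
    field_simp at this
    linarith
  have h2 := h.abs_trunc_mul_le
  have h3 : |B| * V ≤ C * ξ := by
    refine h2.trans ?_
    have : R ^ t ≤ 1 := pow_le_one₀ hR0.le hR1.le
    have h4 : 0 ≤ C * ξ := by positivity
    nlinarith
  have h5 := neg_abs_le B
  have h6 := (_root_.abs_le.1 hA).1
  have h7 : C * ξ ≤ C * ξ * (C * truncVar (θ + d) x t) :=
    le_mul_of_one_le_right (by positivity) hTC
  nlinarith

/-- The residuals of a GARCH model are a perturbation of the innovations. -/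
theorem isPerturbation_of_hasVarExpansion {e U V : ι → ℕ → ℝ} {obs : ι → ℕ → ℝ}
    {g : ι → ℕ → Fin (p + 1) ⊕ Fin q → ℝ} {Δ : ι → Param p q} {ξ : ι → ℝ} {C R K₀ : ℝ}
    {mom : ℕ → ℝ} {γ : Fin (p + 1) ⊕ Fin q → ℝ} {K : ℕ} (hn : Tendsto n l atTop)
    (hC : 0 < C) (hR0 : 0 < R) (hR1 : R < 1)
    (hΔ : Δ =O[l] fun x => (√(n x))⁻¹) (hξ : ∀ᶠ x in l, 0 ≤ ξ x ∧ ξ x ≤ K₀)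
    (hexp : ∀ᶠ x in l, ∀ t ∈ Icc 1 (n x), 0 ≤ U x t ∧ 0 < V x t ∧
      ∃ A B, HasVarExpansion θ (Δ x) (obs x) t (V x t) (U x t) (g x t) C R (ξ x) A B)
    (hgeo : (fun x => ∑ t ∈ Icc 1 (n x), (1 + |e x t|) ^ K * R ^ t) =O[l] fun _ => (1 : ℝ))
    (hU : (fun x => ∑ t ∈ Icc 1 (n x), (1 + |e x t|) ^ K * U x t) =O[l] fun x => (n x : ℝ))
    (hUmax : ∀ δ : ℝ, 0 < δ → ∀ᶠ x in l, ∀ t ∈ Icc 1 (n x), U x t ≤ δ * n x)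
    (hpow : (fun x => ∑ t ∈ Icc 1 (n x), (1 + |e x t|) ^ K) =O[l] fun x => (n x : ℝ))
    (hg : ∀ i j, 1 ≤ j → j ≤ K → ∀ m : ι → ℕ, (∀ x, m x ≤ n x) →
      (fun x => ∑ t ∈ Icc 1 (m x), e x t ^ j * g x t i - m x * (mom j * γ i))
        =o[l] fun x => (n x : ℝ))
    (hmom : ∀ j, 1 ≤ j → j ≤ K → ∀ m : ι → ℕ, (∀ x, m x ≤ n x) →
      (fun x => ∑ t ∈ Icc 1 (m x), e x t ^ j - m x * mom j) =o[l] fun x => (n x : ℝ))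
    (hmom1 : mom 1 = 0) (hmom2 : mom 2 = 1) :
    IsPerturbation l n e (fun x t => √(V x t) / √(truncVar (θ + Δ x) (obs x) t))
      (fun x t => truncVar (θ + Δ x) (obs x) t / V x t - 1) (fun x => ∑ i, Δ x i * γ i) mom K
      √(2 * (1 + C ^ 2 * K₀)) := by
  -- A choice of A and B for all (x, t) at once, with the default (0, 0) where no expansion exists.
  have hAB : ∀ x t, ∃ AB : ℝ × ℝ,
      (∃ A B, HasVarExpansion θ (Δ x) (obs x) t (V x t) (U x t) (g x t) C R (ξ x) A B) →
        HasVarExpansion θ (Δ x) (obs x) t (V x t) (U x t) (g x t) C R (ξ x) AB.1 AB.2 := by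
    intro x t
    by_cases h : ∃ A B, HasVarExpansion θ (Δ x) (obs x) t (V x t) (U x t) (g x t) C R (ξ x) A B
    · obtain ⟨A, B, h⟩ := h
      exact ⟨(A, B), fun _ => h⟩
    · exact ⟨(0, 0), fun h' => absurd h' h⟩
  choose AB hAB using hAB
  set A : ι → ℕ → ℝ := fun x t => (AB x t).1 with hA
  set B : ι → ℕ → ℝ := fun x t => (AB x t).2 with hB
  have hexp' : ∀ᶠ x in l, ∀ t ∈ Icc 1 (n x), 0 ≤ U x t ∧ 0 < V x t ∧
      HasVarExpansion θ (Δ x) (obs x) t (V x t) (U x t) (g x t) C R (ξ x) (A x t) (B x t) := by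
    filter_upwards [hexp] with x hx t ht
    obtain ⟨h1, h2, h3⟩ := hx t ht
    exact ⟨h1, h2, hAB x t h3⟩
  have hn0 : ∀ᶠ x in l, (0 : ℝ) < n x := by
    filter_upwards [hn.eventually_gt_atTop 0] with x hx
    exact_mod_cast hx
  have hS : Tendsto (fun x => √(n x : ℝ)) l atTop :=
    Real.tendsto_sqrt_atTop.comp (tendsto_natCast_atTop_atTop.comp hn)
  have hone : (fun _ : ι => (1 : ℝ)) =o[l] fun x => √(n x : ℝ) := by
    rw [isLittleO_one_left_iff]
    exact tendsto_norm_atTop_atTop.comp hS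
  have hΔn : (fun x => ‖Δ x‖) =O[l] fun x => (√(n x : ℝ))⁻¹ := hΔ.norm_left
  have hΔ2 : (fun x => ‖Δ x‖ ^ 2) =O[l] fun x => (n x : ℝ)⁻¹ := by
    refine (hΔn.pow 2).congr_right fun x => ?_
    rw [inv_pow, Real.sq_sqrt (Nat.cast_nonneg _)]
  have hΔ2n : (fun x => ‖Δ x‖ ^ 2 * (n x : ℝ)) =O[l] fun _ => (1 : ℝ) := by
    refine (hΔ2.mul (isBigO_refl (fun x => (n x : ℝ)) l)).trans ?_
    refine IsBigO.of_bound 1 ?_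
    filter_upwards [hn0] with x hx
    rw [inv_mul_cancel₀ hx.ne']
    simp
  have hΔ1n : (fun x => ‖Δ x‖ * (n x : ℝ)) =O[l] fun x => √(n x : ℝ) := by
    refine (hΔn.mul (isBigO_refl (fun x => (n x : ℝ)) l)).congr_right fun x => ?_
    rw [inv_mul_eq_div, Real.div_sqrt]
  have hΔ2U : (fun x => ‖Δ x‖ ^ 2 * ∑ t ∈ Icc 1 (n x), (1 + |e x t|) ^ K * U x t)
      =O[l] fun _ => (1 : ℝ) :=
    ((isBigO_refl (fun x => ‖Δ x‖ ^ 2) l).mul hU).trans hΔ2n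
  have hΔ1U : (fun x => ‖Δ x‖ * ∑ t ∈ Icc 1 (n x), (1 + |e x t|) ^ K * U x t)
      =O[l] fun x => √(n x : ℝ) :=
    ((isBigO_refl (fun x => ‖Δ x‖) l).mul hU).trans hΔ1n
  -- Uniform smallness from A² ≤ C ‖Δ‖² U, with ‖Δ‖² = O(1/n) and max U = o(n). The threshold
  -- 1/(4Cc) makes the bound exactly 1/4.
  have hAhalf : ∀ᶠ x in l, ∀ t ∈ Icc 1 (n x), |A x t| ≤ 1 / 2 := by
    obtain ⟨c, hc0, hc⟩ := hΔ2n.exists_pos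
    filter_upwards [hc.bound, hUmax (1 / (4 * C * c)) (by positivity), hexp'] with x h1 h2 h3 t ht
    rw [norm_one, mul_one, Real.norm_of_nonneg (by positivity)] at h1
    have h4 := (h3 t ht).2.2.sq_le
    have h5 : A x t ^ 2 ≤ (1 / 2) ^ 2 := by
      refine h4.trans ?_
      calc C * ‖Δ x‖ ^ 2 * U x t ≤ C * ‖Δ x‖ ^ 2 * (1 / (4 * C * c) * n x) := by
            gcongr
            exact h2 t ht
        _ = (‖Δ x‖ ^ 2 * n x) * (C * (1 / (4 * C * c))) := by ring
        _ ≤ c * (C * (1 / (4 * C * c))) := by gcongr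
        _ = (1 / 2) ^ 2 := by field_simp; norm_num
    exact abs_le_of_sq_le_sq h5 (by norm_num)
  have hBle : ∀ᶠ x in l, ∀ t ∈ Icc 1 (n x), |B x t| ≤ C * K₀ * R ^ t := by
    filter_upwards [hexp', hξ] with x h1 h2 t ht
    refine (h1 t ht).2.2.abs_trunc_le.trans ?_
    have : 0 < R ^ t := pow_pos hR0 t
    calc C * R ^ t * ξ x ≤ C * R ^ t * K₀ := by gcongr; exact h2.2
      _ = _ := by ring
  refine ⟨hn, ?_, ?_, ?_, hpow, ?_, ?_, hmom, hmom1, hmom2⟩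
  · filter_upwards [hexp', hAhalf, hξ] with x h1 h2 h3 t ht
    obtain ⟨hU0, hV0, h4⟩ := h1 t ht
    have hT : 0 < truncVar (θ + Δ x) (obs x) t := (inv_pos.2 hC).trans_le h4.le_truncVar
    have hw : √(V x t) / √(truncVar (θ + Δ x) (obs x) t)
        = (√(1 + (truncVar (θ + Δ x) (obs x) t / V x t - 1)))⁻¹ := by
      rw [add_sub_cancel, Real.sqrt_div hT.le, inv_div]
    have h5 : -1 < truncVar (θ + Δ x) (obs x) t / V x t - 1 := by
      have := div_pos hT hV0
      linarith
    have h6 := abs_inv_sqrt_one_add_sub h5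
    rw [← hw] at h6
    refine ⟨by positivity, ?_, h6⟩
    rw [← Real.sqrt_div hV0.le]
    refine Real.sqrt_le_sqrt ((h4.div_le hC hR0 hR1 h3.1 hV0 (h2 t ht)).trans ?_)
    have := h3.2
    gcongr
  -- The sum is even O(1): ‖Δ‖² is multiplied by a sum of size O(n), and the truncation part is
  -- geometric.
  · refine IsBigO.trans_isLittleO (isBigO_sum_of_abs_le (y := fun x t =>
      2 * C * (‖Δ x‖ ^ 2 * ((1 + |e x t|) ^ K * U x t))
        + 2 * (C * K₀) ^ 2 * ((1 + |e x t|) ^ K * R ^ t)) ?_ ?_) hone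
    · filter_upwards [hexp', hBle] with x h1 h2 t ht
      obtain ⟨hU0, hV0, h4⟩ := h1 t ht
      rw [h4.eq_add, abs_of_nonneg (by positivity)]
      have h5 : B x t ^ 2 ≤ (C * K₀) ^ 2 * R ^ t := by
        rw [← sq_abs]
        refine (pow_le_pow_left₀ (abs_nonneg _) (h2 t ht) 2).trans ?_
        rw [mul_pow]
        refine mul_le_mul_of_nonneg_left ?_ (sq_nonneg _)
        have h7 : R ^ t ≤ 1 := pow_le_one₀ hR0.le hR1.le
        have h8 : 0 ≤ R ^ t := pow_nonneg hR0.le t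
        nlinarith
      have h6 : (A x t + B x t) ^ 2 ≤ 2 * (C * ‖Δ x‖ ^ 2 * U x t) + 2 * ((C * K₀) ^ 2 * R ^ t) := by
        have := h4.sq_le
        nlinarith [sq_nonneg (A x t - B x t)]
      calc (1 + |e x t|) ^ K * (A x t + B x t) ^ 2
          ≤ (1 + |e x t|) ^ K * (2 * (C * ‖Δ x‖ ^ 2 * U x t) + 2 * ((C * K₀) ^ 2 * R ^ t)) := by
            gcongr
        _ = _ := by ring
    · simp_rw [sum_add_distrib, ← mul_sum]
      exact (hΔ2U.const_mul_left _).add (hgeo.const_mul_left _)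
  · refine isBigO_sum_of_abs_le (y := fun x t => C * (‖Δ x‖ * ((1 + |e x t|) ^ K * U x t))
        + C * K₀ * ((1 + |e x t|) ^ K * R ^ t)) ?_ ?_
    · filter_upwards [hexp', hBle] with x h1 h2 t ht
      obtain ⟨hU0, hV0, h4⟩ := h1 t ht
      rw [h4.eq_add, abs_of_nonneg (by positivity)]
      have h5 : |A x t + B x t| ≤ C * ‖Δ x‖ * U x t + C * K₀ * R ^ t :=
        (abs_add_le _ _).trans (add_le_add h4.abs_le (h2 t ht))
      calc (1 + |e x t|) ^ K * |A x t + B x t|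
          ≤ (1 + |e x t|) ^ K * (C * ‖Δ x‖ * U x t + C * K₀ * R ^ t) := by gcongr
        _ = _ := by ring
    · simp_rw [sum_add_distrib, ← mul_sum]
      exact (hΔ1U.const_mul_left _).add ((hgeo.const_mul_left _).trans hone.isBigO)
  · refine IsBigO.fun_sum fun i _ => ?_
    refine (IsBigO.trans (IsBigO.of_bound |γ i| (Eventually.of_forall fun x => ?_)) hΔn)
    rw [norm_mul, norm_norm, Real.norm_eq_abs (γ i), mul_comm]
    exact mul_le_mul_of_nonneg_left (norm_le_pi_norm (Δ x) i) (abs_nonneg _)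
  · intro j hj hjK m hm
    have t1 : (fun x => ∑ t ∈ Icc 1 (m x), e x t ^ j * (A x t - ∑ i, Δ x i * g x t i))
        =o[l] fun x => √(n x) := by
      refine isLittleO_sum_of_abs_le hm
        (y := fun x t => C * (‖Δ x‖ ^ 2 * ((1 + |e x t|) ^ K * U x t))) ?_ ?_
      · filter_upwards [hexp'] with x h1 t ht
        obtain ⟨hU0, hV0, h4⟩ := h1 t ht
        rw [abs_mul, abs_pow]
        calc |e x t| ^ j * |A x t - ∑ i, Δ x i * g x t i|
            ≤ (1 + |e x t|) ^ K * (C * ‖Δ x‖ ^ 2 * U x t) :=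
              mul_le_mul (IsPerturbation.abs_pow_le_pow hjK) h4.abs_sub_le (abs_nonneg _)
                (by positivity)
          _ = _ := by ring
      · simp_rw [← mul_sum]
        exact (hΔ2U.const_mul_left C).trans_isLittleO hone
    have t2 : (fun x => ∑ t ∈ Icc 1 (m x), e x t ^ j * B x t) =o[l] fun x => √(n x) := by
      refine isLittleO_sum_of_abs_le hm
        (y := fun x t => C * K₀ * ((1 + |e x t|) ^ K * R ^ t)) ?_ ?_
      · filter_upwards [hBle] with x h1 t ht
        rw [abs_mul, abs_pow]
        calc |e x t| ^ j * |B x t| ≤ (1 + |e x t|) ^ K * (C * K₀ * R ^ t) :=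
              mul_le_mul (IsPerturbation.abs_pow_le_pow hjK) (h1 t ht) (abs_nonneg _)
                (by positivity)
          _ = _ := by ring
      · simp_rw [← mul_sum]
        exact (hgeo.const_mul_left _).trans_isLittleO hone
    -- Each increment is O(n^(-1/2)) and multiplies an o(n) error of the law of large numbers. Only
    -- this part needs an exact limit; the rest of a is bounded in absolute value.
    have t3 : (fun x => ∑ i, Δ x i * (∑ t ∈ Icc 1 (m x), e x t ^ j * g x t i
        - m x * (mom j * γ i))) =o[l] fun x => √(n x) := by
      refine IsLittleO.fun_sum fun i _ => ?_
      have hΔi : (fun x => Δ x i) =O[l] fun x => (√(n x : ℝ))⁻¹ := by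
        refine IsBigO.trans (IsBigO.of_bound 1 (Eventually.of_forall fun x => ?_)) hΔn
        rw [norm_norm, one_mul]
        exact norm_le_pi_norm (Δ x) i
      refine (hΔi.mul_isLittleO (hg i j hj hjK m hm)).congr_right fun x => ?_
      rw [inv_mul_eq_div, Real.div_sqrt]
    refine ((t1.add t2).add t3).congr' ?_ EventuallyEq.rfl
    filter_upwards [hexp'] with x h1
    have e1 : ∑ t ∈ Icc 1 (m x), e x t ^ j * (truncVar (θ + Δ x) (obs x) t / V x t - 1)
        = ∑ t ∈ Icc 1 (m x), e x t ^ j * (A x t - ∑ i, Δ x i * g x t i)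
          + ∑ t ∈ Icc 1 (m x), e x t ^ j * B x t
          + ∑ i, Δ x i * ∑ t ∈ Icc 1 (m x), e x t ^ j * g x t i := by
      simp_rw [mul_sum]
      rw [sum_comm, ← sum_add_distrib, ← sum_add_distrib]
      refine sum_congr rfl fun t ht => ?_
      have ht' : t ∈ Icc 1 (n x) := Icc_subset_Icc le_rfl (hm x) ht
      rw [(h1 t ht').2.2.eq_add]
      have : ∑ i, Δ x i * (e x t ^ j * g x t i) = e x t ^ j * ∑ i, Δ x i * g x t i := by
        rw [mul_sum]
        exact sum_congr rfl fun i _ => by ring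
      rw [this]
      ring
    rw [e1]
    simp_rw [mul_sub, sum_sub_distrib, mul_sum]
    have : ∀ i, Δ x i * (m x * (mom j * γ i)) = m x * mom j * (Δ x i * γ i) := fun i => by ring
    simp_rw [this]
    ring

end Residuals

end GARCH

namespace GARCH

/-! ### Averages of functionals of the past, in Landau notation -/

section Averages

open Asymptotics Finset

variable {Ω : Type*} [MeasurableSpace Ω] {P : Measure Ω} {ε : ℤ → Ω → ℝ}

lemma IsInnovation.isLittleO_sum [IsProbabilityMeasure P] (hε : IsInnovation ε P)
    {F : (ℕ → ℝ) → ℝ} (hF : Measurable F) (hint : Integrable F (pastLaw ε P))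
    {m : ℕ × Ω → ℕ} (hm : ∀ x, m x ≤ x.1) :
    (fun x => ∑ t ∈ Icc 1 (m x), F (past ε (t : ℕ) x.2) - m x * ∫ y, F y ∂(pastLaw ε P))
      =o[inProb P] fun x => (x.1 : ℝ) := by
  refine isLittleO_iff.2 fun c hc => ?_
  filter_upwards [hε.uniform_wlln hF hint hc] with x hx
  rw [Real.norm_eq_abs, Real.norm_natCast]
  exact hx _ (hm x)

lemma IsInnovation.isBigO_sum [IsProbabilityMeasure P] (hε : IsInnovation ε P)
    {F : (ℕ → ℝ) → ℝ} (hF : Measurable F) (hint : Integrable F (pastLaw ε P)) :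
    (fun x : ℕ × Ω => ∑ t ∈ Icc 1 x.1, F (past ε (t : ℕ) x.2))
      =O[inProb P] fun x => (x.1 : ℝ) := by
  have h1 := (hε.isLittleO_sum hF hint (m := Prod.fst) fun x => le_rfl).isBigO
  have h2 := (isBigO_refl (fun x : ℕ × Ω => (x.1 : ℝ)) (inProb P)).mul
    (isBigO_refl (fun _ : ℕ × Ω => ∫ y, F y ∂(pastLaw ε P)) (inProb P))
  have h3 : (fun x : ℕ × Ω => (x.1 : ℝ) * ∫ y, F y ∂(pastLaw ε P))
      =O[inProb P] fun x => (x.1 : ℝ) := by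
    refine IsBigO.of_bound ‖∫ y, F y ∂(pastLaw ε P)‖ (Eventually.of_forall fun x => ?_)
    rw [norm_mul, mul_comm]
  refine (h1.add h3).congr_left fun x => ?_
  ring

/-- The summands of a stationary sequence of finite mean are negligible compared with their
number. -/
lemma IsInnovation.eventually_forall_le [IsProbabilityMeasure P] (hε : IsInnovation ε P)
    {F : (ℕ → ℝ) → ℝ} (hF : Measurable F) (hint : Integrable F (pastLaw ε P)) {δ : ℝ}
    (hδ : 0 < δ) :
    ∀ᶠ x in inProb P, ∀ t ∈ Icc 1 x.1, F (past ε (t : ℕ) x.2) ≤ δ * x.1 := by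
  set c := ∫ y, F y ∂(pastLaw ε P) with hc
  have h1 : ∀ᶠ x : ℕ × Ω in inProb P, c ≤ δ / 3 * x.1 := by
    have h2 : Tendsto (fun N : ℕ => δ / 3 * (N : ℝ)) atTop atTop :=
      tendsto_natCast_atTop_atTop.const_mul_atTop (by positivity)
    exact tendsto_fst_inProb.eventually (h2.eventually_ge_atTop c)
  filter_upwards [hε.uniform_wlln hF hint (by positivity : 0 < δ / 3), h1] with x hx hx1 t ht
  rw [mem_Icc] at ht
  -- A summand is the difference of two consecutive partial sums. Each is within δn/3 of its mean,
  -- and the means differ by c ≤ δn/3.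
  obtain ⟨s, rfl⟩ : ∃ s, t = s + 1 := ⟨t - 1, by omega⟩
  have h2 := hx (s + 1) ht.2
  have h3 := hx s (by omega)
  rw [sum_Icc_succ_top (by omega)] at h2
  rw [← hc] at h2 h3
  push_cast at h2 h3 ⊢
  have h4 := (abs_le.1 h2).2
  have h5 := (abs_le.1 h3).1
  linarith

/-- F is evaluated one step earlier than f, so the product is a functional of the past whose mean
factorizes. This yields the common factor E[ε^j] in the first-order terms, and avoids moments of ε
beyond those in f. -/
lemma IsInnovation.sum_pow_mul [IsProbabilityMeasure P] (hε : IsInnovation ε P) {f : ℝ → ℝ}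
    (hf : Measurable f) (hfi : Integrable (fun ω => f (ε 0 ω)) P)
    {F : (ℕ → ℝ) → ℝ} (hF : Measurable F) (hFi : Integrable F (pastLaw ε P))
    {m : ℕ × Ω → ℕ} (hm : ∀ x, m x ≤ x.1) :
    (fun x => ∑ t ∈ Icc 1 (m x), f (ε (t : ℕ) x.2) * F (past ε ((t : ℕ) - 1) x.2)
        - m x * ((∫ ω, f (ε 0 ω) ∂P) * ∫ y, F y ∂(pastLaw ε P)))
      =o[inProb P] fun x => (x.1 : ℝ) := by
  obtain ⟨h1, h2⟩ := hε.integrable_mul_shift hf hfi hF hFi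
  have hmeas : Measurable fun x : ℕ → ℝ => f (x 0) * F fun i => x (i + 1) :=
    (hf.comp (measurable_pi_apply 0)).mul (hF.comp (measurable_shift 1))
  refine (hε.isLittleO_sum hmeas h1 hm).congr_left fun x => ?_
  rw [h2]
  congr 1
  refine sum_congr rfl fun t _ => ?_
  rw [past_shift]
  simp [past]

lemma IsInnovation.isBigO_sum_mul [IsProbabilityMeasure P] (hε : IsInnovation ε P) {f : ℝ → ℝ}
    (hf : Measurable f) (hfi : Integrable (fun ω => f (ε 0 ω)) P)
    {F : (ℕ → ℝ) → ℝ} (hF : Measurable F) (hFi : Integrable F (pastLaw ε P)) :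
    (fun x : ℕ × Ω => ∑ t ∈ Icc 1 x.1, f (ε (t : ℕ) x.2) * F (past ε ((t : ℕ) - 1) x.2))
      =O[inProb P] fun x => (x.1 : ℝ) := by
  obtain ⟨h1, -⟩ := hε.integrable_mul_shift hf hfi hF hFi
  have hmeas : Measurable fun x : ℕ → ℝ => f (x 0) * F fun i => x (i + 1) :=
    (hf.comp (measurable_pi_apply 0)).mul (hF.comp (measurable_shift 1))
  refine (hε.isBigO_sum hmeas h1).congr_left fun x => ?_
  refine sum_congr rfl fun t _ => ?_
  rw [past_shift]
  simp [past]

/-- A geometrically discounted sum of identically distributed terms is finite. -/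
lemma IsInnovation.ae_summable_discounted [IsProbabilityMeasure P] (hε : IsInnovation ε P)
    {f : ℝ → ℝ} (hf : Measurable f) (hf0 : ∀ r, 0 ≤ f r)
    (hfi : Integrable (fun ω => f (ε 0 ω)) P) {R : ℝ} (hR0 : 0 < R) (hR1 : R < 1) :
    ∀ᵐ ω ∂P, Summable fun t : ℕ => f (ε (t : ℕ) ω) * R ^ t := by
  refine (integrable_tsum_of_lintegral
    (fun t => (hf.comp (hε.measurable t)).mul_const _)
    (fun t => ae_of_all _ fun ω => mul_nonneg (hf0 _) (pow_nonneg hR0.le t)) ?_).1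
  have h1 : ∀ t : ℕ, ∫⁻ ω, ENNReal.ofReal (f (ε (t : ℕ) ω) * R ^ t) ∂P
      = (∫⁻ ω, ENNReal.ofReal (f (ε 0 ω)) ∂P) * ENNReal.ofReal R ^ t := by
    intro t
    simp_rw [ENNReal.ofReal_mul (hf0 _), ENNReal.ofReal_pow hR0.le]
    rw [lintegral_mul_const (f := fun ω => ENNReal.ofReal (f (ε (t : ℕ) ω))) _
      (hf.comp (hε.measurable t)).ennreal_ofReal]
    congr 1
    exact ((hε.identDistrib t).comp hf.ennreal_ofReal).lintegral_eq
  change ∑' t : ℕ, ∫⁻ ω, ENNReal.ofReal (f (ε (t : ℕ) ω) * R ^ t) ∂P < ⊤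
  simp_rw [h1]
  rw [ENNReal.tsum_mul_left, ENNReal.tsum_geometric]
  refine ENNReal.mul_lt_top ?_ ?_
  · rw [← hasFiniteIntegral_iff_ofReal (ae_of_all _ fun ω => hf0 _)]
    exact hfi.2
  · rw [ENNReal.inv_lt_top]
    exact tsub_pos_of_lt (by simpa using hR1)

lemma integrable_one_add_abs_pow [IsProbabilityMeasure P] {f : Ω → ℝ} (hf : Measurable f) {K : ℕ}
    (h : Integrable (fun ω => |f ω| ^ K) P) : Integrable (fun ω => (1 + |f ω|) ^ K) P := by
  refine (((integrable_const (1 : ℝ)).add h).const_mul (2 ^ (K - 1))).mono'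
    ((hf.abs.const_add 1).pow_const K).aestronglyMeasurable (ae_of_all _ fun ω => ?_)
  rw [Real.norm_of_nonneg (by positivity)]
  simpa using add_pow_le (zero_le_one) (abs_nonneg (f ω)) K

lemma integrable_pow_of_le [IsProbabilityMeasure P] {f : Ω → ℝ} (hf : Measurable f) {K j : ℕ}
    (hj : j ≤ K) (h : Integrable (fun ω => |f ω| ^ K) P) : Integrable (fun ω => f ω ^ j) P := by
  refine (integrable_one_add_abs_pow hf h).mono' (hf.pow_const j).aestronglyMeasurable
    (ae_of_all _ fun ω => ?_)
  rw [Real.norm_eq_abs, abs_pow]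
  exact IsPerturbation.abs_pow_le_pow hj

/-- A family of events indexed by `m ≤ n` holds eventually, if it does for every selection. -/
lemma eventually_forall_le_of_selection {ι : Type*} {l : Filter ι} {n : ι → ℕ}
    {Q : ι → ℕ → Prop} (h : ∀ m : ι → ℕ, (∀ x, m x ≤ n x) → ∀ᶠ x in l, Q x (m x)) :
    ∀ᶠ x in l, ∀ m ≤ n x, Q x m := by
  -- Select a counterexample wherever there is one; if the property holds for the selected m, there
  -- was none.
  have hsel : ∀ x, ∃ m ≤ n x, Q x m → ∀ m ≤ n x, Q x m := by
    intro x
    by_cases hx : ∀ m ≤ n x, Q x m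
    · exact ⟨0, Nat.zero_le _, fun _ => hx⟩
    · push Not at hx
      obtain ⟨m, hm, hQ⟩ := hx
      exact ⟨m, hm, fun h => absurd h hQ⟩
  choose m hm hQ using hsel
  filter_upwards [h m hm] with x hx
  exact hQ x hx

end Averages

end GARCH

namespace GARCH

/-! ### The theorem -/

section Main

open Asymptotics Finset

variable {Ω : Type*} [MeasurableSpace Ω] {P : Measure Ω} {ε X σ : ℤ → Ω → ℝ}
  {p q : ℕ} {θ : Param p q}

/-- The numerator of `selfNormalized`, with summation up to `m`, over its denominator. -/
noncomputable def normalizedSum (f : ℕ → ℝ) (n k m : ℕ) : ℝ :=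
  (∑ t ∈ Icc 1 m, (f t - sampleMean f n) ^ k) / sampleStd f n ^ k

lemma selfNormalized_eq (f : ℕ → ℝ) (n k : ℕ) (u : ℝ) :
    selfNormalized f n k u = normalizedSum f n k ⌊(n : ℝ) * u⌋₊ := rfl

/-- The probabilistic inputs are checked against the hypotheses of the deterministic perturbation
theorem, along the filter of convergence in probability. -/
theorem IsStationarySolution.eventually_normalizedSum_sub_le [IsProbabilityMeasure P]
    (hε : IsInnovation ε P) (hγ : topLyapunov θ ε P < 0)
    (hX : IsStationarySolution θ ε X σ P) (hp : 0 < p) {lo : ℝ} (hlo : 0 < lo)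
    (hθlo : ∀ l, lo ≤ θ l) (hsum : ∑ j : Fin q, θ (Sum.inr j) < 1) {θhat : ℕ → Ω → Param p q}
    (hroot : BoundedInProbability (fun n ω => √(n : ℝ) * ‖θhat n ω - θ‖) P)
    {k : ℕ} (hk : 1 ≤ k) (hmoment : Integrable (fun ω => |ε 0 ω| ^ max k 2) P) {δ : ℝ}
    (hδ : 0 < δ) :
    ∀ᶠ x in inProb P, ∀ m ≤ x.1,
      |normalizedSum (residual (θhat x.1 x.2) fun t : ℕ => X t x.2) x.1 k m
        - normalizedSum (fun t : ℕ => ε t x.2) x.1 k m| ≤ δ * √x.1 := by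
  obtain ⟨U, g, ξ, C, κ, R, hUm, hUi, hg, hξm, hC, hκ, hR0, hR1, hexp⟩ :=
    hX.exists_varExpansion hε hγ hp hlo hθlo hsum
  set K := max k 2 with hK
  have hεm := hε.measurable 0
  have hDi := integrable_one_add_abs_pow hεm hmoment
  have hDm : Measurable fun r : ℝ => (1 + |r|) ^ K :=
    (measurable_id.abs.const_add 1).pow_const K
  have hgeo := hε.ae_summable_discounted hDm (fun r => by positivity) hDi hR0 hR1
  set Ξ : Ω → ℝ := fun ω => ∑' t : ℕ, (1 + |ε (t : ℕ) ω|) ^ K * R ^ t with hΞ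
  have hΞm : Measurable Ξ := Measurable.tsum fun t =>
    (hDm.comp (hε.measurable t)).mul_const _
  have hjint : ∀ j ≤ K, Integrable (fun ω => ε 0 ω ^ j) P := fun j hj =>
    integrable_pow_of_le hεm hj hmoment
  have hone : Integrable (fun _ : ℕ → ℝ => (1 : ℝ)) (pastLaw ε P) := by
    have := hε.isProbabilityMeasure_pastLaw
    exact integrable_const 1
  have hint1 : ∫ _ : ℕ → ℝ, (1 : ℝ) ∂(pastLaw ε P) = 1 := by
    have := hε.isProbabilityMeasure_pastLaw
    simp
  -- On an event of probability at least 1 - η, for large n, the O_P bound on √n ‖Δ‖ and the almost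
  -- surely finite variables ξ and Ξ are bounded by constants. Along the restricted filter they
  -- become deterministic O bounds.
  refine eventually_inProb_of_forall fun η hη => ?_
  obtain ⟨K₁, hK₁⟩ := hroot (η / 3) (by positivity)
  obtain ⟨K₂, hK₂⟩ := exists_measure_lt_abs_le (P := P) hξm (by positivity : 0 < η / 3)
  obtain ⟨K₃, hK₃⟩ := exists_measure_lt_abs_le (P := P) hΞm (by positivity : 0 < η / 3)
  set E : Set (ℕ × Ω) := {x | |√(x.1 : ℝ) * ‖θhat x.1 x.2 - θ‖| ≤ K₁ ∧ |ξ x.2| ≤ K₂ ∧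
    |Ξ x.2| ≤ K₃} with hE
  refine ⟨E, ?_, ?_⟩
  · filter_upwards [hK₁] with n hn
    calc P {ω | (n, ω) ∉ E} ≤ P ({ω | K₁ < |√(n : ℝ) * ‖θhat n ω - θ‖|}
          ∪ ({ω | K₂ < |ξ ω|} ∪ {ω | K₃ < |Ξ ω|})) := by
          refine measure_mono fun ω hω => ?_
          by_contra hcon
          simp only [Set.mem_union, Set.mem_ofPred_eq, not_or, not_lt] at hcon
          exact hω ⟨hcon.1, hcon.2.1, hcon.2.2⟩
      _ ≤ ENNReal.ofReal (η / 3) + (ENNReal.ofReal (η / 3) + ENNReal.ofReal (η / 3)) :=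
          (measure_union_le _ _).trans (add_le_add hn
            ((measure_union_le _ _).trans (add_le_add hK₂ hK₃)))
      _ = ENNReal.ofReal η := by
          rw [← ENNReal.ofReal_add (by positivity) (by positivity),
            ← ENNReal.ofReal_add (by positivity) (by positivity)]
          congr 1
          ring
  set l : Filter (ℕ × Ω) := inProb P ⊓ 𝓟 E with hl
  have hle : l ≤ inProb P := inf_le_left
  have hEl : ∀ᶠ x in l, x ∈ E := mem_inf_of_right (mem_principal_self E)
  have hn : Tendsto (Prod.fst : ℕ × Ω → ℕ) l atTop := tendsto_fst_inProb.mono_left hle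
  have hpos : ∀ᶠ x in l, (0 : ℝ) < x.1 := by
    filter_upwards [hn.eventually_gt_atTop 0] with x hx
    exact_mod_cast hx
  have hS0 : Tendsto (fun x : ℕ × Ω => (√(x.1 : ℝ))⁻¹) l (𝓝 0) :=
    tendsto_inv_atTop_zero.comp (Real.tendsto_sqrt_atTop.comp
      (tendsto_natCast_atTop_atTop.comp hn))
  have hΔ : (fun x : ℕ × Ω => θhat x.1 x.2 - θ) =O[l] fun x => (√(x.1 : ℝ))⁻¹ := by
    refine IsBigO.of_bound K₁ ?_
    filter_upwards [hEl, hpos] with x hx hx0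
    have hs : 0 < √(x.1 : ℝ) := Real.sqrt_pos.2 hx0
    rw [Real.norm_of_nonneg (inv_pos.2 hs).le, ← div_eq_mul_inv, le_div_iff₀ hs, mul_comm]
    exact (le_abs_self _).trans hx.1
  have hΔκ : ∀ᶠ x in l, ‖θhat x.1 x.2 - θ‖ ≤ κ := by
    have h1 := (hΔ.trans_tendsto hS0).norm
    rw [norm_zero] at h1
    exact h1.eventually_le_const hκ
  have hmodel := (eventually_inProb_of_ae hexp).filter_mono hle
  have hpert : IsPerturbation l Prod.fst (fun x t => ε (t : ℕ) x.2)
      (fun x t => √(σ (t : ℕ) x.2 ^ 2)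
        / √(truncVar (θ + (θhat x.1 x.2 - θ)) (fun s : ℕ => X s x.2) t))
      (fun x t => truncVar (θ + (θhat x.1 x.2 - θ)) (fun s : ℕ => X s x.2) t
        / σ (t : ℕ) x.2 ^ 2 - 1)
      (fun x => ∑ i, (θhat x.1 x.2 - θ) i * ∫ y, g i y ∂(pastLaw ε P))
      (fun j => ∫ ω, ε 0 ω ^ j ∂P) K √(2 * (1 + C ^ 2 * K₂)) := by
    refine isPerturbation_of_hasVarExpansion (Δ := fun x => θhat x.1 x.2 - θ)
      (obs := fun x (s : ℕ) => X s x.2) (V := fun x t => σ (t : ℕ) x.2 ^ 2)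
      (U := fun x t => U (past ε ((t : ℕ) - 1) x.2))
      (g := fun x t i => g i (past ε ((t : ℕ) - 1) x.2)) (ξ := fun x => ξ x.2) (R := R)
      (γ := fun i => ∫ y, g i y ∂(pastLaw ε P)) hn hC hR0 hR1 hΔ ?_ ?_ ?_ ?_ ?_ ?_ ?_ ?_ ?_ ?_
    · filter_upwards [hmodel, hEl] with x h1 h2
      exact ⟨h1.1, (le_abs_self _).trans h2.2.1⟩
    · filter_upwards [hmodel, hΔκ] with x h1 h2 t _
      obtain ⟨h3, h4, -, h5⟩ := h1.2 t
      exact ⟨h3, by positivity, h5 _ h2⟩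
    · refine IsBigO.of_bound K₃ ?_
      filter_upwards [hEl, (eventually_inProb_of_ae hgeo).filter_mono hle] with x h1 h2
      rw [norm_one, mul_one, Real.norm_of_nonneg (sum_nonneg fun t _ => by positivity)]
      exact (h2.sum_le_tsum _ fun t _ => by positivity).trans ((le_abs_self _).trans h1.2.2)
    · exact (hε.isBigO_sum_mul hDm hDi hUm hUi).mono hle
    · intro δ' hδ'
      have h1 := hε.eventually_forall_le (F := fun y => U fun i => y (i + 1))
        (hUm.comp (measurable_shift 1))
        ((hε.measurePreserving_shift 1).integrable_comp_of_integrable hUi) hδ'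
      filter_upwards [h1.filter_mono hle] with x hx t ht
      have h2 := hx t ht
      rwa [past_shift, Nat.cast_one] at h2
    -- Plain moments of the innovations are the case F = 1.
    · refine ((hε.isBigO_sum_mul hDm hDi measurable_const hone).mono hle).congr_left fun x => ?_
      simp
    · intro i j _ hjK m hm
      exact (hε.sum_pow_mul (measurable_id.pow_const j) (hjint j hjK) (hg i).1 (hg i).2 hm).mono hle
    · intro j _ hjK m hm
      refine ((hε.sum_pow_mul (measurable_id.pow_const j) (hjint j hjK) measurable_const hone
        hm).mono hle).congr_left fun x => ?_
      rw [hint1]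
      simp
    · simpa using hε.mean_zero
    · exact hε.variance_one
  refine eventually_forall_le_of_selection fun m hm => ?_
  have hmain := hpert.sum_selfNormalized_sub (Real.sqrt_nonneg _) (le_max_right k 2) hk
    (le_max_left k 2) hm
  filter_upwards [hmain.def hδ, hmodel] with x h1 h2
  rw [Real.norm_eq_abs, Real.norm_of_nonneg (Real.sqrt_nonneg _)] at h1
  -- Since X_t = σ_t ε_t and σ_t > 0, the weighted innovation is the residual.
  have hres : (fun t : ℕ => ε t x.2 * (√(σ (t : ℕ) x.2 ^ 2)
      / √(truncVar (θ + (θhat x.1 x.2 - θ)) (fun s : ℕ => X s x.2) t)))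
      = residual (θhat x.1 x.2) fun t : ℕ => X t x.2 := by
    funext t
    obtain ⟨-, h3, h4, -⟩ := h2.2 t
    rw [residual, add_sub_cancel, Real.sqrt_sq h3.le, h4]
    ring
  have hres' := congrFun hres
  simp only [hres'] at h1
  exact h1

end Main

end GARCH

theorem theorem1p4 {Ω : Type*} [MeasurableSpace Ω] (P : Measure Ω) [IsProbabilityMeasure P]
    (p q : ℕ) (hp : 1 ≤ p)
    -- the GARCH(p, q) model: innovations, stationarity condition, stationary solution
    (ε X σ : ℤ → Ω → ℝ) (θ : GARCH.Param p q)
    (hε : GARCH.IsInnovation ε P)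
    (hγ : GARCH.topLyapunov θ ε P < 0)
    (hX : GARCH.IsStationarySolution θ ε X σ P)
    -- the true parameter is in the interior of the parameter space
    (lo hi ρ₀ : ℝ) (hlo : 0 < lo) (hlohi : lo < hi) (hρ₀ : 0 < ρ₀) (hρ₀' : ρ₀ < 1)
    (hqlo : (q : ℝ) * lo < ρ₀)
    (hθ : θ ∈ interior (GARCH.paramSpace p q lo hi ρ₀))
    -- a root-n consistent estimator based on the sample `X_0, …, X_n`
    (est : (n : ℕ) → (Fin (n + 1) → ℝ) → GARCH.Param p q)
    (hest : ∀ n, Measurable (est n))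
    (θhat : ℕ → Ω → GARCH.Param p q)
    (hθhat : ∀ n ω, θhat n ω = est n (fun i => X ((i : ℕ) : ℤ) ω))
    (hroot : GARCH.BoundedInProbability (fun n ω => √(n : ℝ) * ‖θhat n ω - θ‖) P)
    -- nondegenerate innovations, small mass near zero, moment condition
    (hnondeg : ¬ ∃ c : ℝ, ∀ᵐ ω ∂P, ε 0 ω = c)
    (hsmall : ∃ ζ : ℝ, 0 < ζ ∧
      Tendsto (fun x : ℝ => x ^ (-ζ) * P.real {ω | |ε 0 ω| ≤ x}) (𝓝[>] 0) (𝓝 0))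
    (k : ℕ) (hk : 1 ≤ k)
    (hmoment : Integrable (fun ω => |ε 0 ω| ^ max k 2) P) :
    TendstoInMeasure P
      (fun (n : ℕ) (ω : Ω) => ⨆ u : Set.Icc (0 : ℝ) 1,
        1 / √(n : ℝ) *
          |GARCH.selfNormalized (GARCH.residual (θhat n ω) (fun t : ℕ => X (t : ℤ) ω)) n k u
            - GARCH.selfNormalized (fun t : ℕ => ε (t : ℤ) ω) n k u|)
      atTop (fun _ => 0) := by
  have hθmem := interior_subset hθ
  have hsum : ∑ j : Fin q, θ (Sum.inr j) < 1 := hθmem.1.trans_lt hρ₀'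
  rw [tendstoInMeasure_iff_norm]
  intro δ hδ
  -- The bound is requested for δ/2 because the exceptional event is {δ ≤ ·}, while a supremum
  -- inherits only a non-strict bound.
  have hmain := hX.eventually_normalizedSum_sub_le hε hγ hp hlo (fun l => (hθmem.2 l).1) hsum hroot
    hk hmoment (half_pos hδ)
  refine ENNReal.tendsto_atTop_zero.2 fun η hη => ?_
  obtain ⟨η', hη'0, hη'⟩ : ∃ η' : ℝ, 0 < η' ∧ ENNReal.ofReal η' ≤ η := by
    rcases eq_or_ne η ⊤ with h | h
    · exact ⟨1, one_pos, by simp [h]⟩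
    · exact ⟨η.toReal, ENNReal.toReal_pos hη.ne' h, ENNReal.ofReal_toReal_le⟩
  obtain ⟨N, hN⟩ := eventually_atTop.1 (GARCH.eventually_inProb.1 hmain η' hη'0)
  refine ⟨max N 1, fun n hn => ?_⟩
  refine le_trans (measure_mono ?_) ((hN n ((le_max_left _ _).trans hn)).trans hη')
  intro ω hω hQ
  have hs : 0 < √(n : ℝ) := by
    have : 1 ≤ n := (le_max_right _ _).trans hn
    exact Real.sqrt_pos.2 (by exact_mod_cast this)
  have hle : ⨆ u : Set.Icc (0 : ℝ) 1, 1 / √(n : ℝ) *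
      |GARCH.selfNormalized (GARCH.residual (θhat n ω) (fun t : ℕ => X (t : ℤ) ω)) n k u
        - GARCH.selfNormalized (fun t : ℕ => ε (t : ℤ) ω) n k u| ≤ δ / 2 := by
    -- For u ≤ 1 the upper limit ⌊nu⌋ is at most n, so all u are covered by the bound over m ≤ n.
    refine Real.iSup_le (fun u => ?_) (half_pos hδ).le
    have hu : ⌊(n : ℝ) * u⌋₊ ≤ n :=
      Nat.floor_le_of_le (mul_le_of_le_one_right (Nat.cast_nonneg n) u.2.2)
    rw [GARCH.selfNormalized_eq, GARCH.selfNormalized_eq, one_div, inv_mul_le_iff₀ hs, mul_comm (√_)]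
    exact hQ _ hu
  have h0 : 0 ≤ ⨆ u : Set.Icc (0 : ℝ) 1, 1 / √(n : ℝ) *
      |GARCH.selfNormalized (GARCH.residual (θhat n ω) (fun t : ℕ => X (t : ℤ) ω)) n k u
        - GARCH.selfNormalized (fun t : ℕ => ε (t : ℤ) ω) n k u| :=
    Real.iSup_nonneg fun u => by positivity
  rw [Set.mem_ofPred_eq, sub_zero, Real.norm_of_nonneg h0] at hω
  linarith
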